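/- **Setting.** Let $\Bbbk$ be a commutative ring with $1$, let $n\ge 1$, and let $Q$ be a quiver with finite vertex set $I$ and finitely many arrows. For an arrow $a$ write $t(a)$, $h(a)$ for its tail and head. Let $\overline Q$ be the double of $Q$: it has the arrows $a\in Q$ and, for each of them, an arrow $a^*$ in the opposite direction; put $(a^*)^*=a$. Let $s_{\ell m}\in S_n$ be the transposition of $\ell$ and $m$. For $\underline j=(j_1,\dots,j_n)\in I^n$, $\sigma\in S_n$ and $a\in\overline Q$ with $t(a)=j_\ell$, let $\sigma(\underline j)=(j_{\sigma^{-1}(1)},\dots,j_{\sigma^{-1}(n)})$, and let $a_\ell(\underline j)$ be $\underline j$ with the $\ell$-th entry replaced by $h(a)$. **The algebra.** Let $B=\bigoplus_{i\in I}\Bbbk e_i$, let $E$ be the $B$-bimodule with $\Bbbk$-basis $\overline Q$ (with $a=e_{h(a)}\,a\,e_{t(a)}$), $\mathscr B=B^{\otimes n}$ and $\mathscr E=\bigoplus_{\ell=1}^n B^{\otimes(\ell-1)}\otimes E\otimes B^{\otimes(n-\ell)}$. Write $|_{\underline j}=e_{j_1}\otimes\cdots\otimes e_{j_n}$, and $a_\ell|_{\underline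 j}$ for the same tensor with $e_{j_\ell}$ replaced by $a e_{j_\ell}$. For $\lambda=(\lambda_i)_{i\in I}\in\Bbbk^I$ and $\nu\in\Bbbk$, the algebra $\mathscr A_{n,\lambda,\nu}$ is the quotient of $T_{\mathscr B}\mathscr E\rtimes\Bbbk[S_n]$ by the relations 1. $\big(\sum_{a\in Q}[a,a^*]-\lambda\big)_\ell\big|_{\underline j}=\nu\sum_{m\ne\ell,\ j_m=j_\ell}s_{\ell m}\big|_{\underline j}$ for all $\ell$ and $\underline j$, where $\lambda_\ell|_{\underline j}=\lambda_{j_\ell}|_{\underline j}$; 2. for $\ell\ne m$, $a,b\in\overline Q$, $j_\ell=t(a)$, $j_m=t(b)$: the element $a_\ell|_{b_m(\underline j)}\,b_m|_{\underline j}-b_m|_{a_\ell(\underline j)}\,a_\ell|_{\underline j}$ equals $\nu s_{\ell m}|_{\underline j}$ if $b\in Q$ and $a=b^*$, equals $-\nu s_{\ell m}|_{\underline j}$ if $a\in Q$ and $b=a^*$, and equals $0$ otherwise. **The reflection functor.** Let $i\in I$ be a vertex without edge-loops. Put $(r_i\lambda)_j=\lambda_j-(\epsilon_i,\epsilon_j)\lambda_i$,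 where $(\cdot,\cdot)$ is the symmetrization of the form $\langle\alpha,\beta\rangle=\sum_{j}\alpha_j\beta_j-\sum_{a\in Q}\alpha_{t(a)}\beta_{h(a)}$ on $\mathbb Z^I$. Suppose first that $i$ is a sink of $Q$, and put $R=\{r\in Q: h(r)=i\}$. Let $V$ be an $\mathscr A_{n,\lambda,\nu}$-module, $V_{\underline j}=|_{\underline j}V$, $\Delta(\underline j)=\{m: j_m=i\}$. For $D\subseteq\Delta(\underline j)$ and $\xi:D\to R$, let $t(\underline j,\xi)$ be $\underline j$ with the entry at each $m\in D$ replaced by $t(\xi(m))$, and let $V(\underline j,D)=\bigoplus_{\xi:D\to R}V_{t(\underline j,\xi)}$. For $p\in D$ let $\pi_p:V(\underline j,D)\to V(\underline j,D\setminus\{p\})$ map the summand of $\xi$ to that of $\xi|_{D\setminus\{p\}}$ by $\xi(p)_p$, and let $\mu_p:V(\underline j,D\setminus\{p\})\to V(\underline j,D)$ be the sum over $\xi:D\to R$ of the maps $\xi(p)^*_p$ from the summand of $\xi|_{D\setminus\{p\}}$ to that of $\xi$. Then $$F_i(V)=\bigoplus_{\underline j\in I^n}V'_{\underline j},\qquad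 V'_{\underline j}=\bigcap_{p\in\Delta(\underline j)}\operatorname{Ker}\big(\pi_p:V(\underline j,\Delta(\underline j))\to V(\underline j,\Delta(\underline j)\setminus\{p\})\big).$$ It is an $\mathscr A_{n,r_i\lambda,\nu}$-module: $|_{\underline j}$ acts as the projection to $V'_{\underline j}$; $\sigma\in S_n$ maps the summand of $(\underline j,\xi)$ to that of $(\sigma(\underline j),\xi\circ\sigma^{-1})$ by the action of $\sigma$ on $V$; and, for $j_\ell=t(a)$, the element $a_\ell|_{\underline j}$ acts as the following map $V'_{\underline j}\to V'_{a_\ell(\underline j)}$: - if $h(a),t(a)\neq i$: the restriction of the sum over $\xi$ of the maps $a_\ell$ from the summand of $(\underline j,\xi)$ to that of $(a_\ell(\underline j),\xi)$; - if $t(a)=i$: the restriction of the projection onto the summands with $\xi(\ell)=a^*$, where $\xi$ is then restricted to $\Delta(\underline j)\setminus\{\ell\}$; - if $h(a)=i$: the restriction of $\big(-\lambda_i+\mu_\ell\pi_\ell+\nu\sum_{m\in\Delta(\underline j)}s_{m\ell}\big)\circ\tau$, where $\tau:V(\underline j,\Delta(\underline j))\to V(a_\ell(\underline j),\Delta(\underline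 j)\cup\{\ell\})$ is the inclusion of the summands with $\xi(\ell)=a$. If $i$ is not a sink, let $Q'$ be obtained from $Q$ by replacing each arrow $c$ with $t(c)=i$ by an arrow $b$ in the opposite direction. Then $F_i$ is defined as above for $Q'$, modules for $Q$ and $Q'$ being identified through the isomorphism of algebras that sends $b_\ell\mapsto c^*_\ell$, $b^*_\ell\mapsto -c_\ell$ and fixes the other generators. **Statement.** Let $\Lambda_i$ be the set of all $(\lambda,\nu)\in\Bbbk^I\times\Bbbk$ such that, for all $r\in\{1,\dots,n\}$, both elements $\lambda_i+\nu\sum_{m=2}^r s_{1m}$ and $\lambda_i-\nu\sum_{m=2}^r s_{1m}$ are invertible in $\Bbbk[S_r]$. Let $(\lambda,\nu)\in\Lambda_i$, let $V$ be any $\mathscr A_{n,\lambda,\nu}$-module, and let $\Bbbk'$ be any commutative $\Bbbk$-algebra. Let $V\otimes_\Bbbk\Bbbk'$ be the induced module over the algebra $\mathscr A_{n,\lambda,\nu}$ formed over $\Bbbk'$ (with the images of $\lambda$, $\nu$ in $\Bbbk'$). Then $F_i(V)\otimes_\Bbbk\Bbbk'=F_i(V\otimes_\Bbbk\Bbbk')$;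 that is, the natural map $$F_i(V)\otimes_\Bbbk\Bbbk'\longrightarrow F_i(V\otimes_\Bbbk\Bbbk'),\qquad f\otimes c\longmapsto f\otimes c\ \text{ (on every summand } V_{t(\underline j,\xi)}\text{)},$$ is an isomorphism of modules over the $\Bbbk'$-algebra $\mathscr A_{n,r_i\lambda,\nu}$ formed over $\Bbbk'$. -/

import Mathlib

open scoped TensorProduct Classical
set_option linter.unusedSectionVars false

namespace WreathReflection

noncomputable section

universe uI uQ uk uV

/-! ## The quiver, its double, and the reflections -/

/-- The arrows of the double of a quiver `Q` on the vertex set `I`: the summand `inl` holds the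
arrows `a` of `Q`, the summand `inr` the reversed arrows `a*`. -/
abbrev DArrow (I : Type uI) [Quiver.{uQ} I] := Quiver.Total I ⊕ Quiver.Total I

section quiver

variable {I : Type uI} [Quiver.{uQ} I]

/-- The tail of an arrow of the double. -/
def tail : DArrow I → I := Sum.elim Quiver.Total.left Quiver.Total.right

/-- The head of an arrow of the double. -/
def head : DArrow I → I := Sum.elim Quiver.Total.right Quiver.Total.left

/-- The involution `a ↦ a*`, with `(a*)* = a`. -/
def star : DArrow I → DArrow I := Sum.swap

/-- `1` on the arrows of `Q`, and `-1` on the reversed arrows. -/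
def sgn : DArrow I → ℤ := Sum.elim (fun _ => 1) (fun _ => -1)

@[simp] theorem tail_star (a : DArrow I) : tail (star a) = head a := by cases a <;> rfl
@[simp] theorem head_star (a : DArrow I) : head (star a) = tail a := by cases a <;> rfl
@[simp] theorem star_star (a : DArrow I) : star (star a) = a := by cases a <;> rfl
@[simp] theorem sgn_star (a : DArrow I) : sgn (star a) = - sgn a := by cases a <;> simp [sgn, star]
theorem sgn_mul_self (a : DArrow I) : sgn a * sgn a = 1 := by cases a <;> simp [sgn]
theorem star_inj {a b : DArrow I} : star a = star b ↔ a = b :=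
  ⟨fun h => by rw [← star_star a, h, star_star], fun h => by rw [h]⟩

variable [Fintype I] [Fintype (Quiver.Total I)]

/-- The Ringel form `⟨α, β⟩ = ∑ αᵢβᵢ - ∑_{a ∈ Q} α_{t(a)} β_{h(a)}`. -/
def ringelForm (α β : I → ℤ) : ℤ :=
  ∑ i, α i * β i - ∑ a : Quiver.Total I, α a.left * β a.right

/-- The symmetrized Ringel form `(α, β)`. -/
def symForm (α β : I → ℤ) : ℤ := ringelForm α β + ringelForm β α

/-- The reflection `r_i` on parameters, `(r_i λ)_j = λ_j - (ε_i, ε_j) λ_i`. -/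
def reflect {k : Type uk} [CommRing k] (i : I) (lam : I → k) : I → k :=
  fun j => lam j - (symForm (Pi.single i 1) (Pi.single j 1) : ℤ) * lam i

end quiver

/-! ## The algebra `𝒜_{n,λ,ν}` -/

section algebra

/-- The defining relations of `𝒜_{n,λ,ν}`, between elements `e j`, `s σ`, `x a ℓ` of an algebra.
Here `e j` stands for `|_j = e_{j_1} ⊗ ⋯ ⊗ e_{j_n}`, the element `s σ` for `σ ∈ S_n`, and `x a ℓ`
for the arrow `a` of the double placed in the `ℓ`-th tensor factor, so that `a_ℓ|_j` is
`x a ℓ * e j`. The relations other than `rel_one` and `rel_two` present `T_𝓑 𝓔 ⋊ 𝕜[S_n]`: the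
`e j` form the standard basis of `𝓑 = B^{⊗ n}`, and the `x a ℓ * e j` with `j_ℓ = t(a)` the
standard basis of the `𝓑`-bimodule `𝓔`. -/
inductive Rel {I : Type uI} [Quiver.{uQ} I] [Fintype I] [Fintype (Quiver.Total I)]
    {n : ℕ} {k : Type*} [CommRing k] (lam : I → k) (ν : k) {S : Type*} [Ring S] [Algebra k S]
    (e : (Fin n → I) → S) (s : Equiv.Perm (Fin n) → S) (x : DArrow I → Fin n → S) : S → S → Prop
  | idem_self (j : Fin n → I) : Rel lam ν e s x (e j * e j) (e j)
  | idem_ne (j j' : Fin n → I) (h : j ≠ j') : Rel lam ν e s x (e j * e j') 0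
  | idem_sum : Rel lam ν e s x (∑ j, e j) 1
  | perm_one : Rel lam ν e s x (s 1) 1
  | perm_mul (σ τ : Equiv.Perm (Fin n)) : Rel lam ν e s x (s (σ * τ)) (s σ * s τ)
  | perm_idem (σ : Equiv.Perm (Fin n)) (j : Fin n → I) :
      Rel lam ν e s x (s σ * e j) (e (j ∘ ⇑σ⁻¹) * s σ)
  | perm_arrow (σ : Equiv.Perm (Fin n)) (a : DArrow I) (ℓ : Fin n) :
      Rel lam ν e s x (s σ * x a ℓ) (x a (σ ℓ) * s σ)
  | arrow_idem (a : DArrow I) (ℓ : Fin n) (j : Fin n → I) (h : j ℓ = tail a) :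
      Rel lam ν e s x (x a ℓ * e j) (e (Function.update j ℓ (head a)) * (x a ℓ * e j))
  | arrow_idem_ne (a : DArrow I) (ℓ : Fin n) (j : Fin n → I) (h : j ℓ ≠ tail a) :
      Rel lam ν e s x (x a ℓ * e j) 0
  /-- `(∑_{a ∈ Q} [a, a*] - λ)_ℓ |_j = ν ∑_{m ≠ ℓ, j_m = j_ℓ} s_{ℓm} |_j`. -/
  | rel_one (ℓ : Fin n) (j : Fin n → I) :
      Rel lam ν e s x
        ((∑ a : Quiver.Total I, (x (.inl a) ℓ * x (.inr a) ℓ - x (.inr a) ℓ * x (.inl a) ℓ)) * e j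
          - lam (j ℓ) • e j)
        (ν • ∑ m with m ≠ ℓ ∧ j m = j ℓ, s (Equiv.swap ℓ m) * e j)
  /-- `a_ℓ b_m |_j - b_m a_ℓ |_j` is `ν s_{ℓm} |_j` if `b ∈ Q` and `a = b*`, it is `- ν s_{ℓm} |_j`
  if `a ∈ Q` and `b = a*`, and it is `0` otherwise. -/
  | rel_two (ℓ m : Fin n) (hne : ℓ ≠ m) (a b : DArrow I) (j : Fin n → I) (ha : j ℓ = tail a)
      (hb : j m = tail b) :
      Rel lam ν e s x
        (x a ℓ * (x b m * e j) - x b m * (x a ℓ * e j))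
        ((if a = star b then (sgn b : k) * ν else 0) • (s (Equiv.swap ℓ m) * e j))

/-- The elements `e j`, `s σ`, `x a ℓ` satisfy the defining relations of `𝒜_{n,λ,ν}`. -/
def Satisfies {I : Type uI} [Quiver.{uQ} I] [Fintype I] [Fintype (Quiver.Total I)]
    {n : ℕ} {k : Type*} [CommRing k] (lam : I → k) (ν : k) {S : Type*} [Ring S] [Algebra k S]
    (e : (Fin n → I) → S) (s : Equiv.Perm (Fin n) → S) (x : DArrow I → Fin n → S) : Prop :=
  ∀ p q, Rel lam ν e s x p q → p = q

theorem Rel.map {I : Type uI} [Quiver.{uQ} I] [Fintype I] [Fintype (Quiver.Total I)]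
    {n : ℕ} {k : Type*} [CommRing k] {lam : I → k} {ν : k} {S : Type*} [Ring S] [Algebra k S]
    {e : (Fin n → I) → S} {s : Equiv.Perm (Fin n) → S} {x : DArrow I → Fin n → S}
    {k' : Type*} [CommRing k'] [Algebra k k'] {S' : Type*} [Ring S'] [Algebra k S'] [Algebra k' S']
    [IsScalarTower k k' S'] (φ : S →ₐ[k] S') {p q : S} (h : Rel lam ν e s x p q) :
    Rel (fun i => algebraMap k k' (lam i)) (algebraMap k k' ν)
      (fun j => φ (e j)) (fun σ => φ (s σ)) (fun a ℓ => φ (x a ℓ)) (φ p) (φ q) := by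
  cases h with
  | idem_self j => simpa using Rel.idem_self j
  | idem_ne j j' h => simpa using Rel.idem_ne j j' h
  | idem_sum => simpa using Rel.idem_sum
  | perm_one => simpa using Rel.perm_one
  | perm_mul σ τ => simpa using Rel.perm_mul σ τ
  | perm_idem σ j => simpa using Rel.perm_idem σ j
  | perm_arrow σ a ℓ => simpa using Rel.perm_arrow σ a ℓ
  | arrow_idem a ℓ j h => simpa using Rel.arrow_idem a ℓ j h
  | arrow_idem_ne a ℓ j h => simpa using Rel.arrow_idem_ne a ℓ j h
  | rel_one ℓ j =>
    have := Rel.rel_one (lam := fun i => algebraMap k k' (lam i)) (ν := algebraMap k k' ν)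
      (e := fun j => φ (e j)) (s := fun σ => φ (s σ)) (x := fun a ℓ => φ (x a ℓ)) ℓ j
    simpa only [map_sub, map_mul, map_sum, map_smul, algebraMap_smul] using this
  | rel_two ℓ m hne a b j ha hb =>
    have := Rel.rel_two (lam := fun i => algebraMap k k' (lam i)) (ν := algebraMap k k' ν)
      (e := fun j => φ (e j)) (s := fun σ => φ (s σ)) (x := fun a ℓ => φ (x a ℓ))
      ℓ m hne a b j ha hb
    have hc : (if a = star b then (sgn b : k') * algebraMap k k' ν else 0)
        = algebraMap k k' (if a = star b then (sgn b : k) * ν else 0) := by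
      split_ifs <;> simp
    rw [hc] at this
    simpa only [map_sub, map_mul, map_smul, algebraMap_smul] using this

theorem Rel.exists_preimage {I : Type uI} [Quiver.{uQ} I] [Fintype I] [Fintype (Quiver.Total I)]
    {n : ℕ} {k : Type*} [CommRing k] {lam : I → k} {ν : k} {S : Type*} [Ring S] [Algebra k S]
    {e : (Fin n → I) → S} {s : Equiv.Perm (Fin n) → S} {x : DArrow I → Fin n → S}
    {k' : Type*} [CommRing k'] [Algebra k k'] {S' : Type*} [Ring S'] [Algebra k S'] [Algebra k' S']
    [IsScalarTower k k' S'] (φ : S →ₐ[k] S') {P Q : S'}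
    (h : Rel (fun i => algebraMap k k' (lam i)) (algebraMap k k' ν)
      (fun j => φ (e j)) (fun σ => φ (s σ)) (fun a ℓ => φ (x a ℓ)) P Q) :
    ∃ p q, Rel lam ν e s x p q ∧ φ p = P ∧ φ q = Q := by
  cases h with
  | idem_self j => exact ⟨_, _, Rel.idem_self j, by simp, by simp⟩
  | idem_ne j j' h => exact ⟨_, _, Rel.idem_ne j j' h, by simp, by simp⟩
  | idem_sum => exact ⟨_, _, Rel.idem_sum, by simp, by simp⟩
  | perm_one => exact ⟨_, _, Rel.perm_one, by simp, by simp⟩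
  | perm_mul σ τ => exact ⟨_, _, Rel.perm_mul σ τ, by simp, by simp⟩
  | perm_idem σ j => exact ⟨_, _, Rel.perm_idem σ j, by simp, by simp⟩
  | perm_arrow σ a ℓ => exact ⟨_, _, Rel.perm_arrow σ a ℓ, by simp, by simp⟩
  | arrow_idem a ℓ j h => exact ⟨_, _, Rel.arrow_idem a ℓ j h, by simp, by simp⟩
  | arrow_idem_ne a ℓ j h => exact ⟨_, _, Rel.arrow_idem_ne a ℓ j h, by simp, by simp⟩
  | rel_one ℓ j =>
    exact ⟨_, _, Rel.rel_one ℓ j,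
      by simp only [map_sub, map_mul, map_sum, map_smul, algebraMap_smul],
      by simp only [map_mul, map_sum, map_smul, algebraMap_smul]⟩
  | rel_two ℓ m hne a b j ha hb =>
    have hc : (if a = star b then (sgn b : k') * algebraMap k k' ν else 0)
        = algebraMap k k' (if a = star b then (sgn b : k) * ν else 0) := by
      split_ifs <;> simp
    exact ⟨_, _, Rel.rel_two ℓ m hne a b j ha hb,
      by simp only [map_sub, map_mul],
      by rw [hc]; simp only [map_mul, map_smul, algebraMap_smul]⟩

/-- Names of the generators of `𝒜_{n,λ,ν}`. -/
inductive Gen (I : Type uI) [Quiver.{uQ} I] (n : ℕ) : Type (max uI uQ)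
  | idem (j : Fin n → I)
  | perm (σ : Equiv.Perm (Fin n))
  | arrow (a : DArrow I) (ℓ : Fin n)

variable {I : Type uI} [Quiver.{uQ} I] [Fintype I] [Fintype (Quiver.Total I)]
  {k : Type uk} [CommRing k] (n : ℕ) (lam : I → k) (ν : k)

/-- The relations on the free algebra on the generators of `𝒜_{n,λ,ν}`. -/
abbrev FreeRel : FreeAlgebra k (Gen I n) → FreeAlgebra k (Gen I n) → Prop :=
  Rel lam ν (fun j => FreeAlgebra.ι k (Gen.idem j)) (fun σ => FreeAlgebra.ι k (Gen.perm σ))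
    (fun a ℓ => FreeAlgebra.ι k (Gen.arrow a ℓ))

/-- The algebra `𝒜_{n,λ,ν}` over `k`. -/
def WreathAlg : Type (max uI uQ uk) := RingQuot (FreeRel n lam ν)

instance : Ring (WreathAlg n lam ν) := inferInstanceAs (Ring (RingQuot (FreeRel n lam ν)))
instance : Algebra k (WreathAlg n lam ν) :=
  inferInstanceAs (Algebra k (RingQuot (FreeRel n lam ν)))

namespace WreathAlg

/-- The quotient map. -/
def mk : FreeAlgebra k (Gen I n) →ₐ[k] WreathAlg n lam ν := RingQuot.mkAlgHom k (FreeRel n lam ν)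

variable {n}

/-- The element `|_j = e_{j_1} ⊗ ⋯ ⊗ e_{j_n}` of `𝒜_{n,λ,ν}`. -/
def e (j : Fin n → I) : WreathAlg n lam ν := mk n lam ν (FreeAlgebra.ι k (Gen.idem j))
/-- The element `σ ∈ S_n` of `𝒜_{n,λ,ν}`. -/
def s (σ : Equiv.Perm (Fin n)) : WreathAlg n lam ν := mk n lam ν (FreeAlgebra.ι k (Gen.perm σ))
/-- The element `a_ℓ` of `𝒜_{n,λ,ν}`. -/
def x (a : DArrow I) (ℓ : Fin n) : WreathAlg n lam ν :=
  mk n lam ν (FreeAlgebra.ι k (Gen.arrow a ℓ))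

variable {lam ν}

theorem rel {p q : WreathAlg n lam ν} (h : Rel lam ν (e lam ν) (s lam ν) (x lam ν) p q) :
    p = q := by
  obtain ⟨p', q', h', rfl, rfl⟩ := Rel.exists_preimage (k' := k) (mk n lam ν) h
  exact RingQuot.mkAlgHom_rel k h'

/-- Elements of an algebra that satisfy the relations define a homomorphism from `𝒜_{n,λ,ν}`. -/
def lift {S : Type*} [Ring S] [Algebra k S] (e' : (Fin n → I) → S)
    (s' : Equiv.Perm (Fin n) → S) (x' : DArrow I → Fin n → S)
    (h : Satisfies lam ν e' s' x') : WreathAlg n lam ν →ₐ[k] S :=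
  RingQuot.liftAlgHom k ⟨FreeAlgebra.lift k (fun g => match g with
    | .idem j => e' j
    | .perm σ => s' σ
    | .arrow a ℓ => x' a ℓ), fun p q hpq => by
      apply h
      simpa using hpq.map (k' := k) (FreeAlgebra.lift k (fun g : Gen I n => match g with
        | .idem j => e' j
        | .perm σ => s' σ
        | .arrow a ℓ => x' a ℓ))⟩

section
variable {S : Type*} [Ring S] [Algebra k S] (e' : (Fin n → I) → S)
    (s' : Equiv.Perm (Fin n) → S) (x' : DArrow I → Fin n → S)
    (h : Satisfies lam ν e' s' x')

@[simp] theorem lift_e (j : Fin n → I) : lift e' s' x' h (e lam ν j) = e' j :=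
  (RingQuot.liftAlgHom_mkAlgHom_apply _ _ _ _).trans (by simp)
@[simp] theorem lift_s (σ : Equiv.Perm (Fin n)) : lift e' s' x' h (s lam ν σ) = s' σ :=
  (RingQuot.liftAlgHom_mkAlgHom_apply _ _ _ _).trans (by simp)
@[simp] theorem lift_x (a : DArrow I) (ℓ : Fin n) : lift e' s' x' h (x lam ν a ℓ) = x' a ℓ :=
  (RingQuot.liftAlgHom_mkAlgHom_apply _ _ _ _).trans (by simp)
end

/-- Equal parameters give the same algebra. -/
def congr {lam lam' : I → k} (h : lam = lam') : WreathAlg n lam ν ≃ₐ[k] WreathAlg n lam' ν :=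
  h ▸ AlgEquiv.refl

theorem congr_e {lam lam' : I → k} (h : lam = lam') (j : Fin n → I) :
    congr (ν := ν) h (e lam ν j) = e lam' ν j := by subst h; rfl
theorem congr_s {lam lam' : I → k} (h : lam = lam') (σ : Equiv.Perm (Fin n)) :
    congr h (s lam ν σ) = s lam' ν σ := by subst h; rfl
theorem congr_x {lam lam' : I → k} (h : lam = lam') (a : DArrow I) (ℓ : Fin n) :
    congr h (x lam ν a ℓ) = x lam' ν a ℓ := by subst h; rfl

end WreathAlg
end algebra

/-! ## Base change of modules -/

section baseChange

variable {I : Type uI} [Quiver.{uQ} I] [Fintype I] [Fintype (Quiver.Total I)]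
  {k : Type uk} [CommRing k] {n : ℕ} (lam : I → k) (ν : k)
  (k' : Type*) [CommRing k'] [Algebra k k']
  (V : Type uV) [AddCommGroup V] [Module k V] [Module (WreathAlg n lam ν) V]
  [IsScalarTower k (WreathAlg n lam ν) V]

/-- The action of `𝒜_{n,λ,ν}` on `k' ⊗ V` through the factor `V`. -/
def baseChangeAux : WreathAlg n lam ν →ₐ[k] Module.End k' (k' ⊗[k] V) :=
  (Module.End.baseChangeHom k k' V).comp (Algebra.lsmul k k V)

/-- The `k'`-algebra `𝒜_{n,λ,ν}` over `k'` (for the images of `λ`, `ν` in `k'`) acts on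
`k' ⊗ V`, each generator through its action on `V`. -/
def baseChangeHom : WreathAlg n (fun i => algebraMap k k' (lam i)) (algebraMap k k' ν) →ₐ[k']
    Module.End k' (k' ⊗[k] V) :=
  WreathAlg.lift (fun j => baseChangeAux lam ν k' V (WreathAlg.e lam ν j))
    (fun σ => baseChangeAux lam ν k' V (WreathAlg.s lam ν σ))
    (fun a ℓ => baseChangeAux lam ν k' V (WreathAlg.x lam ν a ℓ))
    (fun P Q h => by
      obtain ⟨p, q, h', rfl, rfl⟩ :=
        Rel.exists_preimage (k' := k') (lam := lam) (ν := ν) (e := WreathAlg.e lam ν)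
          (s := WreathAlg.s lam ν) (x := WreathAlg.x lam ν) (S' := Module.End k' (k' ⊗[k] V)) (baseChangeAux lam ν k' V) h
      rw [WreathAlg.rel h'])

variable (n)

/-- `V ⊗ k'` as a module over the algebra `𝒜_{n,λ,ν}` over `k'`. -/
@[nolint unusedArguments]
def BaseChange (_ : ℕ) (_ : I → k) (_ : k) (k' : Type*) [CommRing k'] [Algebra k k']
    (V : Type uV) [AddCommGroup V] [Module k V] : Type _ := k' ⊗[k] V

instance : AddCommGroup (BaseChange n lam ν k' V) := inferInstanceAs (AddCommGroup (k' ⊗[k] V))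
instance : Module k' (BaseChange n lam ν k' V) := inferInstanceAs (Module k' (k' ⊗[k] V))
instance : Module (WreathAlg n (fun i => algebraMap k k' (lam i)) (algebraMap k k' ν))
    (BaseChange n lam ν k' V) :=
  Module.compHom (k' ⊗[k] V) (baseChangeHom (n := n) lam ν k' V).toRingHom
instance : IsScalarTower k'
    (WreathAlg n (fun i => algebraMap k k' (lam i)) (algebraMap k k' ν))
    (BaseChange n lam ν k' V) where
  smul_assoc c a v := congrArg (fun f : Module.End k' (k' ⊗[k] V) => f v)
    (map_smul (baseChangeHom (n := n) lam ν k' V) c a)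

variable {k' V}

/-- The element `v ⊗ c` of `V ⊗ k'`. -/
def BaseChange.tmul (c : k') (v : V) : BaseChange n lam ν k' V := c ⊗ₜ[k] v

theorem BaseChange.e_smul (j : Fin n → I) (c : k') (v : V) :
    WreathAlg.e (fun i => algebraMap k k' (lam i)) (algebraMap k k' ν) j •
      BaseChange.tmul n lam ν c v = BaseChange.tmul n lam ν c (WreathAlg.e lam ν j • v) :=
  congrArg (fun f : Module.End k' (k' ⊗[k] V) => f (c ⊗ₜ v))
    (show baseChangeHom lam ν k' V _ = _ from WreathAlg.lift_e _ _ _ _ j)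

theorem BaseChange.s_smul (σ : Equiv.Perm (Fin n)) (c : k') (v : V) :
    WreathAlg.s (fun i => algebraMap k k' (lam i)) (algebraMap k k' ν) σ •
      BaseChange.tmul n lam ν c v = BaseChange.tmul n lam ν c (WreathAlg.s lam ν σ • v) :=
  congrArg (fun f : Module.End k' (k' ⊗[k] V) => f (c ⊗ₜ v))
    (show baseChangeHom lam ν k' V _ = _ from WreathAlg.lift_s _ _ _ _ σ)

theorem BaseChange.x_smul (a : DArrow I) (ℓ : Fin n) (c : k') (v : V) :
    WreathAlg.x (fun i => algebraMap k k' (lam i)) (algebraMap k k' ν) a ℓ •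
      BaseChange.tmul n lam ν c v = BaseChange.tmul n lam ν c (WreathAlg.x lam ν a ℓ • v) :=
  congrArg (fun f : Module.End k' (k' ⊗[k] V) => f (c ⊗ₜ v))
    (show baseChangeHom lam ν k' V _ = _ from WreathAlg.lift_x _ _ _ _ a ℓ)

end baseChange
end
end WreathReflection

namespace WreathReflection
noncomputable section
universe uI uQ uk uV

/-! ## The reflection functor `F_i` -/

section words

variable {I : Type uI} [Quiver.{uQ} I]

/-- The arrows of the double with head `i`. If `i` is a sink of `Q`, this is the set
`R = {a ∈ Q | h(a) = i}`. -/
abbrev RArrow (i : I) := {a : DArrow I // head a = i}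

/-- A pair of `j ∈ I^n` and a map `ξ : D → R`, with `D ⊆ Δ(j) = {m | j_m = i}`, is recorded as a word
`w` in the alphabet `I ⊔ R`: the letter `w_m` is `ξ(m)` if `m ∈ D`, and it is `j_m` otherwise. -/
abbrev Word (n : ℕ) (i : I) := Fin n → I ⊕ RArrow i

variable {n : ℕ} {i : I}

/-- A letter of a word gives a component of `j`. -/
def letterVertex : I ⊕ RArrow i → I := Sum.elim id (fun _ => i)

/-- A letter of a word gives a component of `t(j, ξ)`. -/
def letterTail : I ⊕ RArrow i → I := Sum.elim id (fun r => tail r.1)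

/-- The tuple `j` of the word that stands for `(j, ξ)`. -/
def Word.vertex (w : Word n i) : Fin n → I := fun m => letterVertex (w m)

/-- The tuple `t(j, ξ)` of the word that stands for `(j, ξ)`. -/
def Word.tail (w : Word n i) : Fin n → I := fun m => letterTail (w m)

end words

/-! Functions `f` on words with `f w ∈ V_{t(w)}` form the direct sum of all
`V(j, D) = ⨁_{ξ : D → R} V_{t(j, ξ)}` (there are finitely many words). The following operators on
functions on words are given in terms of the operators `S σ` and `X a ℓ` by which `σ ∈ S_n` and
`a_ℓ` act on `V`. -/

section operators

variable {I : Type uI} [Quiver.{uQ} I] [Fintype I] [Fintype (Quiver.Total I)]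
  {k : Type uk} [CommRing k] {n : ℕ} (lam : I → k) (ν : k) (i : I)
  {V : Type uV} [AddCommGroup V] [Module k V]
  (E : (Fin n → I) → Module.End k V) (S : Equiv.Perm (Fin n) → Module.End k V)
  (X : DArrow I → Fin n → Module.End k V)

/-- The map `π_{j,p} : V(j, D) → V(j, D ∖ {p})` for all `j`, all `D` that contain `p`. -/
def piOp (p : Fin n) : Module.End k (Word n i → V) where
  toFun f w := if w p = .inl i then ∑ r : RArrow i, X r.1 p (f (Function.update w p (.inr r))) else 0
  map_add' f g := by ext w; by_cases h : w p = .inl i <;> simp [h, Finset.sum_add_distrib]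
  map_smul' c f := by ext w; by_cases h : w p = .inl i <;> simp [h, Finset.smul_sum]

/-- The map `μ_{j,p} : V(j, D ∖ {p}) → V(j, D)` for all `j`, all `D` that contain `p`. The sign is `1`
if `i` is a sink of `Q`. In general, let `Q'` be obtained from `Q` by replacing every arrow `c` with
tail `i` by an arrow `b` in the opposite direction. Then `i` is a sink of `Q'`, and `b ↦ c*`,
`b* ↦ -c` defines an isomorphism between the algebras of `Q'` and `Q`. With the signs, `muOp` and
`edgeOp` are the maps for `Q'`, carried over to `Q` by this isomorphism. -/
def muOp (p : Fin n) : Module.End k (Word n i → V) where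
  toFun f w := Sum.elim (fun _ => 0)
    (fun r => sgn r.1 • X (star r.1) p (f (Function.update w p (.inl i)))) (w p)
  map_add' f g := by ext w; rcases h : w p <;> simp [h]
  map_smul' c f := by ext w; rcases h : w p <;> simp [h, smul_comm c]

/-- The map `σ|_j : V(j, D) → V(σ(j), σ(D))`. -/
def permOp (σ : Equiv.Perm (Fin n)) : Module.End k (Word n i → V) where
  toFun f w := S σ (f (w ∘ σ))
  map_add' f g := by ext w; simp
  map_smul' c f := by ext w; simp

/-- The inclusion `τ_{r,ℓ,j,D !} : V(r*_ℓ(j), D ∖ {ℓ}) → V(j, D)`. -/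
def tauIncl (r : RArrow i) (ℓ : Fin n) : Module.End k (Word n i → V) where
  toFun f w := if w ℓ = .inr r then f (Function.update w ℓ (.inl (tail r.1))) else 0
  map_add' f g := by ext w; by_cases h : w ℓ = .inr r <;> simp [h]
  map_smul' c f := by ext w; by_cases h : w ℓ = .inr r <;> simp [h]

/-- The projection `τ_{r,ℓ,j,D}^! : V(j, D) → V(r*_ℓ(j), D ∖ {ℓ})`. -/
def tauProj (r : RArrow i) (ℓ : Fin n) : Module.End k (Word n i → V) where
  toFun f w := if w ℓ = .inl (tail r.1) then f (Function.update w ℓ (.inr r)) else 0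
  map_add' f g := by ext w; by_cases h : w ℓ = .inl (tail r.1) <;> simp [h]
  map_smul' c f := by ext w; by_cases h : w ℓ = .inl (tail r.1) <;> simp [h]

/-- For an arrow `a` with head `i`, the map `θ_{a,ℓ,j,D} : V(j, D) → V(a_ℓ(j), D ∪ {ℓ})`,
`θ = (-λ_i + μ_ℓ π_ℓ + ν ∑_{m ∈ D} s_{mℓ}) τ_{a,ℓ !}`; its value at a word `w` has
`D = {m ≠ ℓ | w_m ∈ R}` and vanishes unless `w_ℓ ∈ R`. -/
def thetaOp (a : RArrow i) (ℓ : Fin n) : Module.End k (Word n i → V) :=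
  LinearMap.pi fun w => if (w ℓ).isRight then
    LinearMap.proj w ∘ₗ ((-lam i) • (1 : Module.End k (Word n i → V))
      + muOp i X ℓ * piOp i X ℓ
      + ν • ∑ m with m ≠ ℓ ∧ (w m).isRight, permOp i S (Equiv.swap m ℓ)) ∘ₗ tauIncl i a ℓ
    else 0

/-- For an arrow `a` with `h(a), t(a) ≠ i`, the map `a_ℓ|_{j,D} : V(j, D) → V(a_ℓ(j), D)`. -/
def arrowOp (a : DArrow I) (ℓ : Fin n) : Module.End k (Word n i → V) where
  toFun f w := if w ℓ = .inl (head a) then X a ℓ (f (Function.update w ℓ (.inl (tail a)))) else 0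
  map_add' f g := by ext w; by_cases h : w ℓ = .inl (head a) <;> simp [h]
  map_smul' c f := by ext w; by_cases h : w ℓ = .inl (head a) <;> simp [h]

/-- The operator `a'_ℓ`: the map `θ_{a,ℓ}` if `h(a) = i`, the projection `τ_{a*,ℓ}^!` if `t(a) = i`
(up to a sign, which is `1` if `i` is a sink of `Q`, see `muOp`), and `a_ℓ` otherwise. -/
def edgeOp (a : DArrow I) (ℓ : Fin n) : Module.End k (Word n i → V) :=
  if h : head a = i then thetaOp lam ν i S X ⟨a, h⟩ ℓ
  else if h : tail a = i then sgn (star a) • tauProj i ⟨star a, by simp [h]⟩ ℓ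
  else arrowOp i X a ℓ

/-- The projection to the summand with a given `j`. -/
def idemOp (j : Fin n → I) : Module.End k (Word n i → V) where
  toFun f w := if w.vertex = j then f w else 0
  map_add' f g := by ext w; by_cases h : w.vertex = j <;> simp [h]
  map_smul' c f := by ext w; by_cases h : w.vertex = j <;> simp [h]

/-- The space `F_i(V) = ⨁_j V'_j` with `V'_j ⊆ V(j, Δ(j))` the intersection of the kernels of
the `π_{j,p}`, `p ∈ Δ(j)`. The first condition is `f w ∈ V_{t(w)}`; the second one says that
`f` is supported on the words with `D = Δ(j)`. -/
def reflectionSubmodule : Submodule k (Word n i → V) where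
  carrier := {f | (∀ w, E w.tail (f w) = f w) ∧ (∀ w p, w p = .inl i → f w = 0) ∧
    ∀ p, piOp i X p f = 0}
  add_mem' {f g} hf hg := ⟨fun w => by simp [hf.1 w, hg.1 w],
    fun w p h => by simp [hf.2.1 w p h, hg.2.1 w p h], fun p => by simp [hf.2.2 p, hg.2.2 p]⟩
  zero_mem' := by simp
  smul_mem' c f hf := ⟨fun w => by simp [hf.1 w], fun w p h => by simp [hf.2.1 w p h],
    fun p => by simp [hf.2.2 p]⟩

end operators
end
end WreathReflection

namespace WreathReflection
noncomputable section
universe uI uQ uk uV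

/-! ### The operators `a'_ℓ` satisfy the relations of `𝒜_{n, r_i λ, ν}` -/

section facts

variable {I : Type uI} [Quiver.{uQ} I] [Fintype I] [Fintype (Quiver.Total I)]
  {k : Type uk} [CommRing k] {n : ℕ} {lam : I → k} {ν : k}
  {V : Type uV} [AddCommGroup V] [Module k V]
  {E : (Fin n → I) → Module.End k V} {S : Equiv.Perm (Fin n) → Module.End k V}
  {X : DArrow I → Fin n → Module.End k V}

theorem rel_apply (hR : Satisfies lam ν E S X) {p q : Module.End k V}
    (h : Rel lam ν E S X p q) (v : V) : p v = q v := by rw [hR p q h]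


theorem E_ne (hR : Satisfies lam ν E S X) {j j' : Fin n → I} {v : V} (hv : E j v = v) (h : j' ≠ j) : E j' v = 0 := by
  rw [← hv]; exact rel_apply hR (.idem_ne j' j h) v

theorem S_one (hR : Satisfies lam ν E S X) (v : V) : S 1 v = v := rel_apply hR .perm_one v
theorem S_mul (hR : Satisfies lam ν E S X) (σ τ : Equiv.Perm (Fin n)) (v : V) : S σ (S τ v) = S (σ * τ) v :=
  (rel_apply hR (.perm_mul σ τ) v).symm
theorem S_X (hR : Satisfies lam ν E S X) (σ : Equiv.Perm (Fin n)) (a : DArrow I) (ℓ : Fin n) (v : V) :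
    S σ (X a ℓ v) = X a (σ ℓ) (S σ v) := rel_apply hR (.perm_arrow σ a ℓ) v
theorem E_S (hR : Satisfies lam ν E S X) {j j' : Fin n → I} {v : V} (hv : E j v = v) (σ : Equiv.Perm (Fin n))
    (h : j' ∘ σ = j) : E j' (S σ v) = S σ v := by
  have : j' = j ∘ ⇑σ⁻¹ := by subst h; ext m; simp
  have h2 := rel_apply hR (.perm_idem σ j) v
  rw [Module.End.mul_apply, Module.End.mul_apply, hv] at h2
  rw [this, ← h2]
theorem E_X (hR : Satisfies lam ν E S X) {j j' : Fin n → I} {v : V} (hv : E j v = v) (a : DArrow I) (ℓ : Fin n)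
    (h : j ℓ = tail a) (h' : j' = Function.update j ℓ (head a)) : E j' (X a ℓ v) = X a ℓ v := by
  have h2 := rel_apply hR (.arrow_idem a ℓ j h) v
  simp only [Module.End.mul_apply, hv] at h2
  rw [h', ← h2]
theorem X_zero (hR : Satisfies lam ν E S X) {j : Fin n → I} {v : V} (hv : E j v = v) (a : DArrow I) (ℓ : Fin n)
    (h : j ℓ ≠ tail a) : X a ℓ v = 0 := by
  have h2 := rel_apply hR (.arrow_idem_ne a ℓ j h) v
  simpa only [Module.End.mul_apply, hv, LinearMap.zero_apply] using h2

theorem rel_two' (hR : Satisfies lam ν E S X) {j : Fin n → I} {v : V} (hv : E j v = v) {ℓ m : Fin n} (hne : ℓ ≠ m)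
    (a b : DArrow I) (ha : j ℓ = tail a) (hb : j m = tail b) :
    X a ℓ (X b m v) = X b m (X a ℓ v) +
      if a = star b then ν • sgn b • S (Equiv.swap ℓ m) v else 0 := by
  have h2 := rel_apply hR (.rel_two ℓ m hne a b j ha hb) v
  simp only [Module.End.mul_apply, hv, LinearMap.sub_apply, LinearMap.smul_apply] at h2
  rw [sub_eq_iff_eq_add'] at h2
  rw [h2]
  split_ifs
  · rw [mul_comm, mul_smul, Int.cast_smul_eq_zsmul]
  · simp

theorem X_comm (hR : Satisfies lam ν E S X) {j : Fin n → I} {v : V} (hv : E j v = v) {ℓ m : Fin n} (hne : ℓ ≠ m)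
    (a b : DArrow I) (ha : j ℓ = tail a) (hb : j m = tail b) (hab : a ≠ star b) :
    X a ℓ (X b m v) = X b m (X a ℓ v) := by
  rw [rel_two' hR hv hne a b ha hb, if_neg hab, add_zero]

theorem rel_one' (hR : Satisfies lam ν E S X) {j : Fin n → I} {v : V} (hv : E j v = v) (ℓ : Fin n) :
    ∑ a : DArrow I with head a = j ℓ, sgn a • X a ℓ (X (star a) ℓ v) =
      lam (j ℓ) • v + ν • ∑ m with m ≠ ℓ ∧ j m = j ℓ, S (Equiv.swap ℓ m) v := by
  have h2 := rel_apply hR (.rel_one ℓ j) v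
  simp only [Module.End.mul_apply, hv, LinearMap.sub_apply, LinearMap.smul_apply,
    LinearMap.sum_apply] at h2
  rw [sub_eq_iff_eq_add'] at h2
  rw [← h2, Finset.sum_filter_of_ne]
  · rw [Fintype.sum_sum_type, ← Finset.sum_add_distrib]
    refine Finset.sum_congr rfl fun a _ => ?_
    simp [sgn, star, sub_eq_add_neg]
  · intro a _ h
    by_contra h'
    apply h
    rw [X_zero hR hv (star a) ℓ (by simpa using fun h => h' h.symm)]
    simp

theorem rel_one_R (hR : Satisfies lam ν E S X) {i : I} {j : Fin n → I} {v : V} (hv : E j v = v) (ℓ : Fin n) (hj : j ℓ = i) :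
    ∑ r : RArrow i, sgn r.1 • X r.1 ℓ (X (star r.1) ℓ v) =
      lam i • v + ν • ∑ m with m ≠ ℓ ∧ j m = i, S (Equiv.swap ℓ m) v := by
  have := rel_one' hR hv ℓ
  rw [hj] at this
  rw [← this]
  exact (Finset.sum_subtype _ (by simp) (fun a : DArrow I =>
    sgn a • X a ℓ (X (star a) ℓ v))).symm

end facts

section wordLemmas

variable {I : Type uI} [Quiver.{uQ} I] {n : ℕ} {i : I}

@[simp] theorem letterVertex_inl (v : I) : letterVertex (i := i) (.inl v) = v := rfl
@[simp] theorem letterVertex_inr (r : RArrow i) : letterVertex (.inr r) = i := rfl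
@[simp] theorem letterTail_inl (v : I) : letterTail (i := i) (.inl v) = v := rfl
@[simp] theorem letterTail_inr (r : RArrow i) : letterTail (.inr r) = tail r.1 := rfl
theorem Word.tail_apply (w : Word n i) (m : Fin n) : w.tail m = letterTail (w m) := rfl
theorem Word.vertex_apply (w : Word n i) (m : Fin n) : w.vertex m = letterVertex (w m) := rfl
theorem Word.tail_update (w : Word n i) (m : Fin n) (l : I ⊕ RArrow i) :
    Word.tail (Function.update w m l) = Function.update w.tail m (letterTail l) := by
  ext p; by_cases h : p = m
  · subst h; simp [Word.tail]
  · simp [Word.tail, h]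
theorem Word.vertex_update (w : Word n i) (m : Fin n) (l : I ⊕ RArrow i) :
    Word.vertex (Function.update w m l) = Function.update w.vertex m (letterVertex l) := by
  ext p; by_cases h : p = m
  · subst h; simp [Word.vertex]
  · simp [Word.vertex, h]
theorem Word.tail_comp (w : Word n i) (σ : Equiv.Perm (Fin n)) :
    Word.tail (w ∘ σ) = w.tail ∘ σ := rfl
theorem Word.vertex_comp (w : Word n i) (σ : Equiv.Perm (Fin n)) :
    Word.vertex (w ∘ σ) = w.vertex ∘ σ := rfl

theorem no_loop [IsEmpty (i ⟶ i)] {a : DArrow I} (h : head a = i) (h' : tail a = i) : False := by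
  rcases a with ⟨l, r, a⟩ | ⟨l, r, a⟩ <;>
  · simp only [head, tail, Sum.elim_inl, Sum.elim_inr] at h h'
    subst h; subst h'
    exact IsEmpty.false a

theorem tail_ne [IsEmpty (i ⟶ i)] (r : RArrow i) : tail r.1 ≠ i := fun h => no_loop r.2 h

theorem ne_star [IsEmpty (i ⟶ i)] (r r' : RArrow i) : r.1 ≠ star r'.1 := fun h =>
  tail_ne r (by rw [h, tail_star, r'.2])

theorem update_comp_perm {α : Type*} (w : Fin n → α) (σ : Equiv.Perm (Fin n)) (p : Fin n) (l : α) :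
    Function.update w (σ p) l ∘ σ = Function.update (w ∘ σ) p l := by
  ext q; by_cases h : q = p
  · subst h; simp
  · simp [h]

theorem comp_swap_of_eq {α : Type*} (w : Fin n → α) {p q : Fin n} (h : w p = w q) :
    w ∘ Equiv.swap p q = w := by
  ext m; by_cases hp : m = p
  · subst hp; simp [h]
  · by_cases hq : m = q
    · subst hq; simp [h]
    · simp [Equiv.swap_apply_of_ne_of_ne hp hq]

theorem comp_swap_eq_update {α : Type*} (w : Fin n → α) {p q : Fin n} (_hne : p ≠ q) :
    w ∘ Equiv.swap p q = Function.update (Function.update w p (w q)) q (w p) := by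
  ext m; by_cases hq : m = q
  · subst hq; simp
  · by_cases hp : m = p
    · subst hp; simp [hq]
    · simp [Equiv.swap_apply_of_ne_of_ne hp hq, hp, hq]

end wordLemmas
end
end WreathReflection

namespace WreathReflection
noncomputable section
universe uI uQ uk uV

section preserve

variable {I : Type uI} [Quiver.{uQ} I] [Fintype I] [Fintype (Quiver.Total I)]
  {k : Type uk} [CommRing k] {n : ℕ} {lam : I → k} {ν : k} {i : I}
  {V : Type uV} [AddCommGroup V] [Module k V]
  {E : (Fin n → I) → Module.End k V} {S : Equiv.Perm (Fin n) → Module.End k V}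
  {X : DArrow I → Fin n → Module.End k V}

theorem muPi_inr (f : Word n i → V) {w : Word n i} {ℓ : Fin n} {r : RArrow i} (hw : w ℓ = .inr r) :
    muOp i X ℓ (piOp i X ℓ f) w = sgn r.1 • X (star r.1) ℓ
      (∑ r' : RArrow i, X r'.1 ℓ (f (Function.update w ℓ (.inr r')))) := by
  simp [muOp, piOp, hw]

theorem muPi_inl (f : Word n i → V) {w : Word n i} {ℓ : Fin n} {v : I} (hw : w ℓ = .inl v) :
    muOp i X ℓ (piOp i X ℓ f) w = 0 := by
  simp [muOp, hw]

theorem theta_isLeft (a : RArrow i) (f : Word n i → V) {w : Word n i} {ℓ : Fin n} {v : I}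
    (hw : w ℓ = .inl v) : thetaOp lam ν i S X a ℓ f w = 0 := by
  simp [thetaOp, hw]

theorem theta_eq (a : RArrow i) (f : Word n i → V) {w : Word n i} {ℓ : Fin n} {r : RArrow i}
    (hw : w ℓ = .inr r) : thetaOp lam ν i S X a ℓ f w = (-lam i) • tauIncl (k := k) i a ℓ f w
      + muOp i X ℓ (piOp i X ℓ (tauIncl (k := k) i a ℓ f)) w
      + ν • ∑ m with m ≠ ℓ, permOp i S (Equiv.swap m ℓ) (tauIncl (k := k) i a ℓ f) w := by
  have h : ∑ m with m ≠ ℓ ∧ (w m).isRight, permOp i S (Equiv.swap m ℓ) (tauIncl (k := k) i a ℓ f) w =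
      ∑ m with m ≠ ℓ, permOp i S (Equiv.swap m ℓ) (tauIncl (k := k) i a ℓ f) w := by
    rw [← Finset.filter_filter]
    refine Finset.sum_filter_of_ne fun m _ h => ?_
    rcases hm : w m with v | r'
    · simp [permOp, tauIncl, hm] at h
    · rfl
  rw [← h]
  simp [thetaOp, hw]

theorem theta_inr (a : RArrow i) (f : Word n i → V) {w : Word n i} {ℓ : Fin n} {r : RArrow i}
    (hw : w ℓ = .inr r) : thetaOp lam ν i S X a ℓ f w =
      (-lam i) • (if r = a then f (Function.update w ℓ (.inl (tail a.1))) else 0)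
      + sgn r.1 • X (star r.1) ℓ (X a.1 ℓ (f (Function.update w ℓ (.inl (tail a.1)))))
      + ν • ∑ m with m ≠ ℓ, S (Equiv.swap m ℓ) (if w m = .inr a then
          f (Function.update (Function.update w m (.inr r)) ℓ (.inl (tail a.1))) else 0) := by
  rw [theta_eq a f hw, muPi_inr _ hw]
  congr 1
  · congr 1
    · simp [tauIncl, hw]
    · congr 2
      rw [Finset.sum_eq_single a]
      · simp [tauIncl]
      · intro b _ hb
        simp [tauIncl, hb]
      · simp
  · congr 1
    refine Finset.sum_congr rfl fun m hm => ?_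
    have hm : m ≠ ℓ := by simpa using hm
    simp only [permOp, LinearMap.coe_mk, AddHom.coe_mk, tauIncl, Function.comp_apply,
      Equiv.swap_apply_right]
    rw [comp_swap_eq_update w hm, hw, Function.update_idem]

theorem memE {f : Word n i → V} (hf : f ∈ reflectionSubmodule i E X) (w : Word n i) :
    E w.tail (f w) = f w := hf.1 w

theorem memZ {f : Word n i → V} (hf : f ∈ reflectionSubmodule i E X) {w : Word n i} {p : Fin n}
    (h : w p = .inl i) : f w = 0 := hf.2.1 w p h

theorem memK {f : Word n i → V} (hf : f ∈ reflectionSubmodule i E X) (w : Word n i) (p : Fin n) :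
    ∑ r : RArrow i, X r.1 p (f (Function.update w p (.inr r))) = 0 := by
  have := congrFun (hf.2.2 p) (Function.update w p (.inl i))
  simpa [piOp] using this

theorem mem_of {f : Word n i → V} (h1 : ∀ w, E w.tail (f w) = f w)
    (h2 : ∀ w p, w p = .inl i → f w = 0)
    (h3 : ∀ w p, w p = .inl i → ∑ r : RArrow i, X r.1 p (f (Function.update w p (.inr r))) = 0) :
    f ∈ reflectionSubmodule i E X :=
  ⟨h1, h2, fun p => by
    ext w
    by_cases h : w p = .inl i
    · simpa [piOp, h] using h3 w p h
    · simp [piOp, h]⟩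

theorem idem_mem {f : Word n i → V} (hf : f ∈ reflectionSubmodule i E X) (j : Fin n → I) :
    idemOp (k := k) i j f ∈ reflectionSubmodule i E X := by
  refine mem_of (fun w => ?_) (fun w p h => ?_) (fun w p h => ?_)
  · by_cases hw : Word.vertex w = j <;> simp [idemOp, hw, memE hf]
  · simp [idemOp, memZ hf h]
  · have : ∀ r : RArrow i, Word.vertex (Function.update w p (.inr r)) = Word.vertex w := by
      intro r
      rw [Word.vertex_update, letterVertex_inr, Function.update_eq_self_iff, Word.vertex_apply, h]
      rfl
    by_cases hw : Word.vertex w = j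
    · simpa [idemOp, this, hw] using memK hf w p
    · simp [idemOp, this, hw]

theorem perm_mem (hR : Satisfies lam ν E S X) {f : Word n i → V}
    (hf : f ∈ reflectionSubmodule i E X) (σ : Equiv.Perm (Fin n)) :
    permOp i S σ f ∈ reflectionSubmodule i E X := by
  refine mem_of (fun w => ?_) (fun w p h => ?_) (fun w p h => ?_)
  · exact E_S hR (memE hf (w ∘ σ)) σ rfl
  · have : (w ∘ σ) (σ⁻¹ p) = .inl i := by simpa using h
    simp [permOp, memZ hf this]
  · have h1 : ∀ r : RArrow i, X r.1 p (permOp i S σ f (Function.update w p (.inr r))) =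
        S σ (X r.1 (σ⁻¹ p) (f (Function.update (w ∘ σ) (σ⁻¹ p) (.inr r)))) := by
      intro r
      rw [S_X hR, ← update_comp_perm]
      simp [permOp]
    simp_rw [h1]
    rw [← map_sum, memK hf, map_zero]

theorem arrow_mem [IsEmpty (i ⟶ i)] (hR : Satisfies lam ν E S X) {f : Word n i → V}
    (hf : f ∈ reflectionSubmodule i E X) {a : DArrow I} (ha : head a ≠ i) (ha' : tail a ≠ i)
    (ℓ : Fin n) : arrowOp i X a ℓ f ∈ reflectionSubmodule i E X := by
  refine mem_of (fun w => ?_) (fun w p h => ?_) (fun w p h => ?_)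
  · by_cases hw : w ℓ = .inl (head a)
    · simp only [arrowOp, LinearMap.coe_mk, AddHom.coe_mk, hw, if_true]
      refine E_X hR (memE hf _) a ℓ ?_ ?_
      · simp [Word.tail_update]
      · rw [Word.tail_update, Function.update_idem, eq_comm, Function.update_eq_self_iff,
          Word.tail_apply, hw]; rfl
    · simp [arrowOp, hw]
  · by_cases hw : w ℓ = .inl (head a)
    · have hp : p ≠ ℓ := by
        rintro rfl; rw [h] at hw; exact ha (Sum.inl.inj hw).symm
      have : Function.update w ℓ (.inl (tail a)) p = .inl i := by simpa [hp] using h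
      simp [arrowOp, hw, memZ hf this]
    · simp [arrowOp, hw]
  · by_cases hp : p = ℓ
    · subst hp
      simp [arrowOp]
    · by_cases hw : w ℓ = .inl (head a)
      · have h1 : ∀ r : RArrow i,
            X r.1 p (arrowOp i X a ℓ f (Function.update w p (.inr r))) =
            X a ℓ (X r.1 p (f (Function.update (Function.update w ℓ (.inl (tail a))) p
              (.inr r)))) := by
          intro r
          have h2 : Function.update w p (.inr r) ℓ = .inl (head a) := by simpa [Ne.symm hp] using hw
          simp only [arrowOp, LinearMap.coe_mk, AddHom.coe_mk, h2, if_true]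
          rw [Function.update_comm hp]
          refine X_comm hR (memE hf _) hp _ _ ?_ ?_ ?_
          · simp [Word.tail_update]
          · simp [Word.tail_update, Ne.symm hp]
          · intro h3
            apply ha'
            rw [← head_star, ← h3, r.2]
        simp_rw [h1]
        rw [← map_sum, memK hf, map_zero]
      · simp [arrowOp, hw, Ne.symm hp]

theorem tauProj_mem [IsEmpty (i ⟶ i)] {f : Word n i → V}
    (hf : f ∈ reflectionSubmodule i E X) (r : RArrow i)
    (ℓ : Fin n) : tauProj (k := k) i r ℓ f ∈ reflectionSubmodule i E X := by
  refine mem_of (fun w => ?_) (fun w p h => ?_) (fun w p h => ?_)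
  · by_cases hw : w ℓ = .inl (tail r.1)
    · have : w.tail = Word.tail (Function.update w ℓ (.inr r)) := by
        rw [Word.tail_update, eq_comm, Function.update_eq_self_iff, Word.tail_apply, hw]; rfl
      simp only [tauProj, LinearMap.coe_mk, AddHom.coe_mk, hw, if_true]
      rw [this, memE hf]
    · simp [tauProj, hw]
  · by_cases hw : w ℓ = .inl (tail r.1)
    · have hp : p ≠ ℓ := by
        rintro rfl; rw [h] at hw; exact tail_ne r (Sum.inl.inj hw).symm
      have : Function.update w ℓ (.inr r) p = .inl i := by simpa [hp] using h
      simp [tauProj, memZ hf this]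
    · simp [tauProj, hw]
  · by_cases hp : p = ℓ
    · subst hp
      simp [tauProj]
    · by_cases hw : w ℓ = .inl (tail r.1)
      · have := memK hf (Function.update w ℓ (.inr r)) p
        simp only [tauProj, LinearMap.coe_mk, AddHom.coe_mk, Function.update_of_ne (Ne.symm hp),
          hw, if_true]
        simp_rw [Function.update_comm hp]
        exact this
      · simp [tauProj, hw, Ne.symm hp]

end preserve
end
end WreathReflection

namespace WreathReflection
noncomputable section
universe uI uQ uk uV

section thetaPreserve

variable {I : Type uI} [Quiver.{uQ} I] [Fintype I] [Fintype (Quiver.Total I)]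
  {k : Type uk} [CommRing k] {n : ℕ} {lam : I → k} {ν : k} {i : I}
  {V : Type uV} [AddCommGroup V] [Module k V]
  {E : (Fin n → I) → Module.End k V} {S : Equiv.Perm (Fin n) → Module.End k V}
  {X : DArrow I → Fin n → Module.End k V}

theorem sgn_smul_smul {M : Type*} [AddCommGroup M] (a : DArrow I) (v : M) :
    sgn a • sgn a • v = v := by rw [smul_smul, sgn_mul_self, one_smul]

theorem theta_K_self [IsEmpty (i ⟶ i)] (hR : Satisfies lam ν E S X) {f : Word n i → V}
    (hf : f ∈ reflectionSubmodule i E X) (a : RArrow i) (ℓ : Fin n) (w : Word n i) :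
    ∑ r : RArrow i, X r.1 ℓ (thetaOp lam ν i S X a ℓ f (Function.update w ℓ (.inr r))) = 0 := by
  set u : Word n i := Function.update w ℓ (.inl (tail a.1)) with hu
  have hE : E (Function.update u.tail ℓ i) (X a.1 ℓ (f u)) = X a.1 ℓ (f u) :=
    E_X hR (memE hf u) a.1 ℓ (by simp [hu, Word.tail_update]) (by rw [a.2])
  have h1 : ∀ r : RArrow i,
      X r.1 ℓ (thetaOp lam ν i S X a ℓ f (Function.update w ℓ (.inr r))) =
      (if r = a then (-lam i) • X a.1 ℓ (f u) else 0)
      + sgn r.1 • X r.1 ℓ (X (star r.1) ℓ (X a.1 ℓ (f u)))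
      + ν • ∑ m with m ≠ ℓ, (if w m = .inr a then S (Equiv.swap m ℓ)
          (X r.1 m (f (Function.update u m (.inr r)))) else 0) := by
    intro r
    rw [theta_inr a f (r := r) (by simp), map_add, map_add, map_smul, map_zsmul, map_smul, map_sum,
      Function.update_idem, ← hu]
    congr 1
    · congr 1
      by_cases h : r = a
      · subst h; simp
      · simp [h]
    · congr 1
      refine Finset.sum_congr rfl fun m hm => ?_
      have hm : m ≠ ℓ := by simpa using hm
      rw [Function.update_of_ne hm]
      split_ifs
      · rw [S_X hR, Equiv.swap_apply_left, Function.update_comm hm, Function.update_idem]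
      · simp
  simp_rw [h1]
  rw [Finset.sum_add_distrib, Finset.sum_add_distrib, Finset.sum_ite_eq' Finset.univ a,
    rel_one_R hR hE ℓ (by simp), ← Finset.smul_sum, Finset.sum_comm]
  have h2 : ∑ m with m ≠ ℓ ∧ Function.update u.tail ℓ i m = i,
      S (Equiv.swap ℓ m) (X a.1 ℓ (f u)) = 0 := by
    refine Finset.sum_eq_zero fun m hm => ?_
    simp only [Finset.mem_filter, Finset.mem_univ, true_and] at hm
    obtain ⟨hm, h⟩ := hm
    rw [Function.update_of_ne hm, Word.tail_apply, hu, Function.update_of_ne hm] at h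
    rcases hw : w m with v | r
    · rw [hw] at h
      have hum : u m = .inl i := by
        rw [hu, Function.update_of_ne hm, hw, ← h]; rfl
      simp [memZ hf hum]
    · rw [hw] at h
      exact absurd h (tail_ne r)
  have h3 : ∑ m with m ≠ ℓ, ∑ r : RArrow i, (if w m = .inr a then S (Equiv.swap m ℓ)
          (X r.1 m (f (Function.update u m (.inr r)))) else 0) = 0 := by
    refine Finset.sum_eq_zero fun m _ => ?_
    split_ifs
    · rw [← map_sum, memK hf, map_zero]
    · simp
  rw [h2, h3]
  simp

theorem theta_K_ne [IsEmpty (i ⟶ i)] (hR : Satisfies lam ν E S X) {f : Word n i → V}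
    (hf : f ∈ reflectionSubmodule i E X) (a : RArrow i) {ℓ p : Fin n} (hp : p ≠ ℓ) (w : Word n i) :
    ∑ r : RArrow i, X r.1 p (thetaOp lam ν i S X a ℓ f (Function.update w p (.inr r))) = 0 := by
  rcases hw : w ℓ with v | r
  · refine Finset.sum_eq_zero fun r _ => ?_
    rw [theta_isLeft a f (v := v) (by simpa [Ne.symm hp] using hw), map_zero]
  set u : Word n i := Function.update w ℓ (.inl (tail a.1)) with hu
  have h1 : ∀ r' : RArrow i,
      X r'.1 p (thetaOp lam ν i S X a ℓ f (Function.update w p (.inr r'))) =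
      (if r = a then (-lam i) • X r'.1 p (f (Function.update u p (.inr r'))) else 0)
      + (sgn r.1 • X (star r.1) ℓ (X a.1 ℓ (X r'.1 p (f (Function.update u p (.inr r')))))
      - (if r' = r then ν • S (Equiv.swap p ℓ) (X a.1 ℓ (f (Function.update u p (.inr r)))) else 0))
      + ν • ((if r' = a then S (Equiv.swap p ℓ) (X a.1 ℓ (f (Function.update u p (.inr r)))) else 0)
        + ∑ m with m ≠ ℓ ∧ m ≠ p, (if w m = .inr a then S (Equiv.swap m ℓ) (X r'.1 p
          (f (Function.update (Function.update u m (.inr r)) p (.inr r')))) else 0)) := by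
    intro r'
    have hw' : Function.update w p (.inr r') ℓ = .inr r := by simpa [Ne.symm hp] using hw
    have hu' : Function.update (Function.update w p (.inr r')) ℓ (.inl (tail a.1)) =
      Function.update u p (.inr r') := by rw [hu, Function.update_comm hp]
    rw [theta_inr a f hw', map_add, map_add, map_smul, map_zsmul, map_smul, map_sum, hu']
    congr 1
    · congr 1
      · split_ifs <;> simp
      · have hE := memE hf (Function.update u p (.inr r'))
        have hE2 : E (Function.update (Word.tail (Function.update u p (.inr r'))) ℓ i)
            (X a.1 ℓ (f (Function.update u p (.inr r')))) =
            X a.1 ℓ (f (Function.update u p (.inr r'))) :=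
          E_X hR hE a.1 ℓ (by simp [hu, Word.tail_update, Ne.symm hp]) (by rw [a.2])
        rw [rel_two' hR hE2 hp r'.1 (star r.1) (by simp [Word.tail_update, hp]) (by simp [r.2]),
          smul_add, star_star]
        rw [X_comm hR hE hp r'.1 a.1 (by simp [Word.tail_update])
          (by simp [hu, Word.tail_update, Ne.symm hp]) (ne_star _ _), sub_eq_add_neg]
        congr 1
        by_cases h : r' = r
        · subst h
          rw [if_pos rfl, if_pos rfl, sgn_star, neg_smul, smul_neg, smul_neg, smul_comm ν,
            sgn_smul_smul]
        · rw [if_neg h, if_neg (fun h' => h (Subtype.ext h')), smul_zero, neg_zero]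
    · congr 1
      have : (Finset.univ.filter fun m => m ≠ ℓ) =
          insert p (Finset.univ.filter fun m => m ≠ ℓ ∧ m ≠ p) := by
        ext m
        by_cases h : m = p
        · subst h; simp [hp]
        · simp [h]
      rw [this, Finset.sum_insert (by simp)]
      congr 1
      · rw [Function.update_self, Function.update_idem]
        by_cases h : r' = a
        · subst h
          rw [if_pos rfl, if_pos rfl, S_X hR, Equiv.swap_apply_right, hu, Function.update_comm hp]
        · have h' : (Sum.inr r' : I ⊕ RArrow i) ≠ .inr a := fun h' => h (Sum.inr.inj h')
          rw [if_neg h, if_neg h', map_zero, map_zero]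
      · refine Finset.sum_congr rfl fun m hm => ?_
        simp only [Finset.mem_filter, Finset.mem_univ, true_and] at hm
        obtain ⟨hm, hm'⟩ := hm
        rw [Function.update_of_ne hm']
        split_ifs
        · rw [S_X hR, Equiv.swap_apply_of_ne_of_ne (Ne.symm hm') hp, hu,
            Function.update_comm hm, Function.update_comm hp, Function.update_comm hm']
        · simp
  simp_rw [h1]
  rw [Finset.sum_add_distrib, Finset.sum_add_distrib, Finset.sum_sub_distrib, ← Finset.smul_sum,
    ← Finset.smul_sum, Finset.sum_add_distrib, Finset.sum_comm (s := Finset.univ) (t := Finset.filter _ _),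
    Finset.sum_ite_eq' Finset.univ a, Finset.sum_ite_eq' Finset.univ r,
    ← map_sum, ← map_sum, memK hf]
  have h2 : ∑ r' : RArrow i, (if r = a then (-lam i) •
      X r'.1 p (f (Function.update u p (.inr r'))) else 0) = 0 := by
    split_ifs
    · rw [← Finset.smul_sum, memK hf, smul_zero]
    · simp
  have h3 : ∑ m with m ≠ ℓ ∧ m ≠ p, ∑ r' : RArrow i, (if w m = .inr a then S (Equiv.swap m ℓ)
      (X r'.1 p (f (Function.update (Function.update u m (.inr r)) p (.inr r')))) else 0) = 0 := by
    refine Finset.sum_eq_zero fun m _ => ?_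
    split_ifs
    · rw [← map_sum, memK hf, map_zero]
    · simp
  rw [h2, h3]
  simp

theorem theta_mem [IsEmpty (i ⟶ i)] (hR : Satisfies lam ν E S X) {f : Word n i → V}
    (hf : f ∈ reflectionSubmodule i E X) (a : RArrow i) (ℓ : Fin n) :
    thetaOp lam ν i S X a ℓ f ∈ reflectionSubmodule i E X := by
  refine mem_of (fun w => ?_) (fun w p h => ?_) (fun w p h => ?_)
  · rcases hw : w ℓ with v | r
    · rw [theta_isLeft a f hw, map_zero]
    · rw [theta_inr a f hw]
      have hu := memE hf (Function.update w ℓ (.inl (tail a.1)))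
      have h1 : E w.tail (if r = a then f (Function.update w ℓ (.inl (tail a.1))) else 0) =
          if r = a then f (Function.update w ℓ (.inl (tail a.1))) else 0 := by
        split_ifs with h
        · have : w.tail = Word.tail (Function.update w ℓ (.inl (tail a.1))) := by
            rw [Word.tail_update, eq_comm, Function.update_eq_self_iff, Word.tail_apply, hw, h]; rfl
          rw [this, hu]
        · simp
      have h2 : E w.tail (X (star r.1) ℓ (X a.1 ℓ (f (Function.update w ℓ (.inl (tail a.1)))))) =
          X (star r.1) ℓ (X a.1 ℓ (f (Function.update w ℓ (.inl (tail a.1))))) := by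
        refine E_X hR (E_X hR hu a.1 ℓ (by simp [Word.tail_update]) rfl) _ ℓ (by simp [a.2, r.2]) ?_
        rw [Word.tail_update, Function.update_idem, Function.update_idem, eq_comm,
          Function.update_eq_self_iff, Word.tail_apply, hw, head_star]
        rfl
      have h3 : ∀ m, m ≠ ℓ → E w.tail (S (Equiv.swap m ℓ) (if w m = .inr a then
          f (Function.update (Function.update w m (.inr r)) ℓ (.inl (tail a.1))) else 0)) =
          S (Equiv.swap m ℓ) (if w m = .inr a then
          f (Function.update (Function.update w m (.inr r)) ℓ (.inl (tail a.1))) else 0) := by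
        intro m hm
        split_ifs with h
        · refine E_S hR (memE hf _) _ ?_
          rw [comp_swap_eq_update _ hm, Word.tail_update, Word.tail_update, Word.tail_apply,
            Word.tail_apply, h, hw]
          rfl
        · simp
      rw [map_add, map_add, map_smul, map_zsmul, map_smul, map_sum, h1, h2,
        Finset.sum_congr rfl (fun m hm => h3 m (by simpa using hm))]
  · rcases hw : w ℓ with v | r
    · rw [theta_isLeft a f hw]
    · have hp : p ≠ ℓ := by rintro rfl; simp [h] at hw
      rw [theta_inr a f hw, memZ hf (p := p) (by simpa [hp] using h)]
      have h3 : ∀ m ∈ Finset.univ.filter (fun m => m ≠ ℓ), (S (Equiv.swap m ℓ) (if w m = .inr a then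
          f (Function.update (Function.update w m (.inr r)) ℓ (.inl (tail a.1))) else 0)) = 0 := by
        intro m _
        split_ifs with h'
        · have hpm : p ≠ m := by rintro rfl; simp [h] at h'
          rw [memZ hf (p := p) (by simpa [hp, hpm] using h), map_zero]
        · simp
      rw [Finset.sum_eq_zero h3]
      simp
  · by_cases hp : p = ℓ
    · subst hp; exact theta_K_self hR hf a p w
    · exact theta_K_ne hR hf a hp w

theorem edge_head (r : RArrow i) (ℓ : Fin n) :
    edgeOp lam ν i S X r.1 ℓ = thetaOp lam ν i S X r ℓ := by
  simp [edgeOp, r.2]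

theorem edge_tail [IsEmpty (i ⟶ i)] (r : RArrow i) (ℓ : Fin n) :
    edgeOp lam ν i S X (star r.1) ℓ = sgn r.1 • tauProj (k := k) i r ℓ := by
  have h1 : ¬ head (star r.1) = i := by rw [head_star]; exact tail_ne r
  have h2 : tail (star r.1) = i := by rw [tail_star, r.2]
  simp only [edgeOp, h1, h2, dif_neg, dif_pos, not_false_iff, star_star]

theorem edge_else {a : DArrow I} (h : head a ≠ i) (h' : tail a ≠ i) (ℓ : Fin n) :
    edgeOp lam ν i S X a ℓ = arrowOp i X a ℓ := by
  simp [edgeOp, h, h']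

theorem arrow_cases (i : I) (a : DArrow I) :
    (∃ r : RArrow i, a = r.1) ∨ (∃ r : RArrow i, a = star r.1) ∨ (head a ≠ i ∧ tail a ≠ i) := by
  by_cases h : head a = i
  · exact .inl ⟨⟨a, h⟩, rfl⟩
  · by_cases h' : tail a = i
    · exact .inr (.inl ⟨⟨star a, by simp [h']⟩, by simp⟩)
    · exact .inr (.inr ⟨h, h'⟩)

theorem edge_mem [IsEmpty (i ⟶ i)] (hR : Satisfies lam ν E S X) {f : Word n i → V}
    (hf : f ∈ reflectionSubmodule i E X) (a : DArrow I) (ℓ : Fin n) :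
    edgeOp lam ν i S X a ℓ f ∈ reflectionSubmodule i E X := by
  rcases arrow_cases i a with ⟨r, rfl⟩ | ⟨r, rfl⟩ | ⟨h, h'⟩
  · rw [edge_head]; exact theta_mem hR hf r ℓ
  · rw [edge_tail]
    exact zsmul_mem (tauProj_mem hf r ℓ) _
  · rw [edge_else h h']; exact arrow_mem hR hf h h' ℓ

end thetaPreserve
end
end WreathReflection

namespace WreathReflection
noncomputable section
universe uI uQ uk uV

section relations

variable {I : Type uI} [Quiver.{uQ} I] [Fintype I] [Fintype (Quiver.Total I)]
  {k : Type uk} [CommRing k] {n : ℕ} {lam : I → k} {ν : k} {i : I}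
  {V : Type uV} [AddCommGroup V] [Module k V]
  {E : (Fin n → I) → Module.End k V} {S : Equiv.Perm (Fin n) → Module.End k V}
  {X : DArrow I → Fin n → Module.End k V}

theorem perm_theta (hR : Satisfies lam ν E S X) (σ : Equiv.Perm (Fin n)) (a : RArrow i) (ℓ : Fin n)
    (f : Word n i → V) : permOp i S σ (thetaOp lam ν i S X a ℓ f) =
      thetaOp lam ν i S X a (σ ℓ) (permOp i S σ f) := by
  ext w
  change S σ (thetaOp lam ν i S X a ℓ f (w ∘ σ)) = _
  rcases hw : w (σ ℓ) with v | r
  · rw [theta_isLeft a f (v := v) (by simpa using hw), theta_isLeft a _ hw, map_zero]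
  · rw [theta_inr a f (r := r) (by simpa using hw), theta_inr a _ hw, map_add, map_add, map_smul,
      map_zsmul, map_smul, map_sum]
    congr 1
    · congr 1
      · congr 1
        split_ifs
        · simp [permOp, update_comp_perm]
        · simp
      · simp [permOp, update_comp_perm, S_X hR]
    · congr 1
      refine Finset.sum_equiv σ (by simp) fun m hm => ?_
      rw [S_mul hR]
      simp only [Function.comp_apply]
      split_ifs with h
      · change _ = S _ (S σ (f (_ ∘ _)))
        rw [S_mul hR, update_comp_perm, update_comp_perm]
        congr 2
        ext q
        simp [Equiv.swap_apply_def]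
        split_ifs <;> simp
      · simp

theorem perm_edge [IsEmpty (i ⟶ i)] (hR : Satisfies lam ν E S X) (σ : Equiv.Perm (Fin n))
    (a : DArrow I) (ℓ : Fin n) (f : Word n i → V) :
    permOp i S σ (edgeOp lam ν i S X a ℓ f) = edgeOp lam ν i S X a (σ ℓ) (permOp i S σ f) := by
  rcases arrow_cases i a with ⟨r, rfl⟩ | ⟨r, rfl⟩ | ⟨h, h'⟩
  · rw [edge_head, edge_head, perm_theta hR]
  · rw [edge_tail, edge_tail, LinearMap.smul_apply, LinearMap.smul_apply, map_zsmul]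
    congr 1
    ext w
    by_cases h : w (σ ℓ) = .inl (tail r.1) <;> simp [permOp, tauProj, h, update_comp_perm]
  · rw [edge_else h h', edge_else h h']
    ext w
    by_cases h : w (σ ℓ) = .inl (head a) <;>
      simp [permOp, arrowOp, h, update_comp_perm, S_X hR]

theorem edge_zero [IsEmpty (i ⟶ i)] (a : DArrow I) (ℓ : Fin n) (f : Word n i → V) {w : Word n i}
    (hw : w.vertex ℓ ≠ head a) : edgeOp lam ν i S X a ℓ f w = 0 := by
  rw [Word.vertex_apply] at hw
  rcases arrow_cases i a with ⟨r, rfl⟩ | ⟨r, rfl⟩ | ⟨h, h'⟩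
  · rw [edge_head]
    rcases h : w ℓ with v | r'
    · exact theta_isLeft r f h
    · rw [h, r.2] at hw; exact absurd rfl hw
  · rw [edge_tail]
    have : w ℓ ≠ .inl (tail r.1) := fun h => hw (by rw [h]; simp)
    simp [tauProj, this]
  · rw [edge_else h h']
    have : w ℓ ≠ .inl (head a) := fun h => hw (by rw [h]; simp)
    simp [arrowOp, this]

theorem edge_eq_zero_of [IsEmpty (i ⟶ i)] (a : DArrow I) (ℓ : Fin n) (f : Word n i → V)
    {w : Word n i}
    (hf : ∀ w' : Word n i, w'.vertex = Function.update w.vertex ℓ (tail a) → f w' = 0) :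
    edgeOp lam ν i S X a ℓ f w = 0 := by
  rcases arrow_cases i a with ⟨r, rfl⟩ | ⟨r, rfl⟩ | ⟨h, h'⟩
  · rw [edge_head]
    rcases h : w ℓ with v | r'
    · exact theta_isLeft r f h
    · rw [theta_inr r f h, hf _ (by rw [Word.vertex_update]; rfl)]
      have : ∀ m ∈ Finset.univ.filter (fun m => m ≠ ℓ), S (Equiv.swap m ℓ) (if w m = .inr r then
          f (Function.update (Function.update w m (.inr r')) ℓ (.inl (tail r.1))) else 0) = 0 := by
        intro m _
        split_ifs with h2
        · rw [hf, map_zero]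
          rw [Word.vertex_update, Word.vertex_update]
          congr 1
          rw [Function.update_eq_self_iff, Word.vertex_apply, h2]
          rfl
        · simp
      rw [Finset.sum_eq_zero this]
      simp
  · rw [edge_tail]
    by_cases h : w ℓ = .inl (tail r.1)
    · have := hf (Function.update w ℓ (.inr r)) (by rw [Word.vertex_update, tail_star, r.2]; rfl)
      simp [tauProj, this]
    · simp [tauProj, h]
  · rw [edge_else h h']
    have := hf (Function.update w ℓ (.inl (tail a))) (by rw [Word.vertex_update]; rfl)
    simp [arrowOp, this]

theorem edge_idem [IsEmpty (i ⟶ i)] (a : DArrow I) (ℓ : Fin n) (f : Word n i → V)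
    (j : Fin n → I) (hj : j ℓ = tail a) : edgeOp lam ν i S X a ℓ (idemOp (k := k) i j f) =
      idemOp (k := k) i (Function.update j ℓ (head a)) (edgeOp lam ν i S X a ℓ (idemOp (k := k) i j f)) := by
  ext w
  by_cases hw : w.vertex = Function.update j ℓ (head a)
  · simp [idemOp, hw]
  · have h1 : idemOp (k := k) i (Function.update j ℓ (head a)) (edgeOp lam ν i S X a ℓ (idemOp (k := k) i j f)) w
      = 0 := by simp [idemOp, hw]
    rw [h1]
    by_cases h : w.vertex ℓ = head a
    · refine edge_eq_zero_of a ℓ _ fun w' hw' => ?_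
      have : w'.vertex ≠ j := by
        rintro rfl
        apply hw
        rw [hw', Function.update_idem, eq_comm, Function.update_eq_self_iff, h]
      simp [idemOp, this]
    · exact edge_zero a ℓ _ h

theorem edge_idem_ne [IsEmpty (i ⟶ i)] (a : DArrow I) (ℓ : Fin n) (f : Word n i → V)
    (j : Fin n → I) (hj : j ℓ ≠ tail a) :
    edgeOp lam ν i S X a ℓ (idemOp (k := k) i j f) = 0 := by
  ext w
  refine edge_eq_zero_of a ℓ _ fun w' hw' => ?_
  have : w'.vertex ≠ j := by
    rintro rfl
    apply hj
    rw [hw']; simp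
  simp [idemOp, this]

theorem ringelForm_single (p q : I) : ringelForm (Pi.single p 1) (Pi.single q 1) =
    (if p = q then 1 else 0) -
      ((Finset.univ.filter fun a : Quiver.Total I => a.left = p ∧ a.right = q).card : ℤ) := by
  unfold ringelForm
  congr 1
  · simp [Pi.single_apply, eq_comm]
  · rw [Finset.card_filter, Nat.cast_sum]
    refine Finset.sum_congr rfl fun a _ => ?_
    by_cases h1 : a.left = p <;> by_cases h2 : a.right = q <;> simp [h1, h2]

theorem symForm_single (p q : I) : symForm (Pi.single p 1) (Pi.single q 1) =
    (if p = q then 2 else 0) -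
      ((Finset.univ.filter fun a : DArrow I => head a = p ∧ tail a = q).card : ℤ) := by
  have h : (Finset.univ.filter fun a : DArrow I => head a = p ∧ tail a = q).card =
      (Finset.univ.filter fun a : Quiver.Total I => a.left = q ∧ a.right = p).card +
      (Finset.univ.filter fun a : Quiver.Total I => a.left = p ∧ a.right = q).card := by
    rw [Finset.card_filter, Fintype.sum_sum_type, Finset.card_filter, Finset.card_filter]
    simp only [head, tail, Sum.elim_inl, Sum.elim_inr]
    congr 1
    refine Finset.sum_congr rfl fun a _ => ?_
    simp only [and_comm]
  rw [symForm, ringelForm_single, ringelForm_single, h]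
  push_cast
  by_cases hpq : p = q
  · subst hpq; simp; ring
  · simp [hpq, Ne.symm hpq]

theorem reflect_self [IsEmpty (i ⟶ i)] : reflect i lam i = - lam i := by
  rw [reflect, symForm_single]
  have : (Finset.univ.filter fun a : DArrow I => head a = i ∧ tail a = i) = ∅ := by
    ext a
    simp only [Finset.mem_filter, Finset.mem_univ, true_and, Finset.notMem_empty, iff_false]
    exact fun h => no_loop h.1 h.2
  rw [this]
  simp; ring

theorem reflect_ne {v : I} (hv : v ≠ i) : reflect i lam v =
    lam v + ((Finset.univ.filter fun r : RArrow i => tail r.1 = v).card : k) * lam i := by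
  rw [reflect, symForm_single]
  have : (Finset.univ.filter fun a : DArrow I => head a = i ∧ tail a = v).card =
      (Finset.univ.filter fun r : RArrow i => tail r.1 = v).card := by
    rw [← Finset.card_map (Function.Embedding.subtype _)]
    congr 1
    ext a
    simp [and_comm]
  rw [this]
  simp [Ne.symm hv]

theorem rel_one_self [IsEmpty (i ⟶ i)] {f : Word n i → V}
    (hf : f ∈ reflectionSubmodule i E X) {ℓ : Fin n} {w : Word n i} {r : RArrow i}
    (hw : w ℓ = .inr r) :
    ∑ a : DArrow I, sgn a • edgeOp lam ν i S X a ℓ (edgeOp lam ν i S X (star a) ℓ f) w =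
      reflect i lam i • f w + ν • ∑ m with m ≠ ℓ ∧ w.vertex m = i,
        S (Equiv.swap ℓ m) (f (w ∘ Equiv.swap ℓ m)) := by
  have h0 : ∑ a : DArrow I, sgn a • edgeOp lam ν i S X a ℓ (edgeOp lam ν i S X (star a) ℓ f) w =
      ∑ r' : RArrow i, thetaOp lam ν i S X r' ℓ (tauProj (k := k) i r' ℓ f) w := by
    have h1 : ∑ a : DArrow I with head a = i,
        sgn a • edgeOp lam ν i S X a ℓ (edgeOp lam ν i S X (star a) ℓ f) w =
        ∑ a : DArrow I, sgn a • edgeOp lam ν i S X a ℓ (edgeOp lam ν i S X (star a) ℓ f) w := by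
      refine Finset.sum_filter_of_ne fun a _ h => ?_
      by_contra h'
      apply h
      rw [edge_zero a ℓ _ (by rw [Word.vertex_apply, hw]; exact Ne.symm h'), smul_zero]
    rw [← h1, Finset.sum_subtype (p := fun a : DArrow I => head a = i) _ (by simp)]
    refine Finset.sum_congr rfl fun r' _ => ?_
    rw [edge_head, edge_tail, LinearMap.smul_apply, map_zsmul, Pi.smul_apply, sgn_smul_smul]
  have h1 : ∀ r' : RArrow i, thetaOp lam ν i S X r' ℓ (tauProj (k := k) i r' ℓ f) w =
      (if r = r' then (-lam i) • f w else 0)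
      + sgn r.1 • X (star r.1) ℓ (X r'.1 ℓ (f (Function.update w ℓ (.inr r'))))
      + ν • ∑ m with m ≠ ℓ, (if w m = .inr r' then
          S (Equiv.swap ℓ m) (f (w ∘ Equiv.swap ℓ m)) else 0) := by
    intro r'
    rw [theta_inr r' _ hw]
    congr 1
    · congr 1
      · by_cases h : r = r'
        · subst h
          have : Function.update w ℓ (.inr r) = w := by
            rw [Function.update_eq_self_iff, hw]
          simp [tauProj, this]
        · simp [h]
      · simp [tauProj]
    · congr 1
      refine Finset.sum_congr rfl fun m hm => ?_
      have hm : m ≠ ℓ := by simpa using hm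
      by_cases h : w m = .inr r'
      · rw [if_pos h, if_pos h, Equiv.swap_comm ℓ m, comp_swap_eq_update w hm, hw, h]
        simp [tauProj]
      · simp [h]
  rw [h0]
  simp_rw [h1]
  rw [Finset.sum_add_distrib, Finset.sum_add_distrib, Finset.sum_ite_eq Finset.univ r,
    ← Finset.smul_sum, ← Finset.smul_sum, ← map_sum, memK hf, Finset.sum_comm, reflect_self,
    if_pos (Finset.mem_univ _), map_zero, smul_zero, add_zero]
  congr 2
  rw [← Finset.filter_filter, Finset.sum_filter (fun m => w.vertex m = i)]
  refine Finset.sum_congr rfl fun m hm => ?_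
  have hm : m ≠ ℓ := by simpa using hm
  rw [Word.vertex_apply]
  rcases h : w m with v | r'
  · rw [Finset.sum_eq_zero (fun r'' _ => if_neg (by simp))]
    by_cases h2 : v = i
    · rw [memZ hf (p := ℓ) (by simp [h, h2]), map_zero]
      exact (ite_self _).symm
    · exact (if_neg (show ¬ letterVertex (i := i) (.inl v) = i from h2)).symm
  · rw [if_pos (show letterVertex (.inr r') = i from rfl), Finset.sum_eq_single r']
    · simp
    · intro b _ hb
      rw [if_neg]
      exact fun h' => hb (Sum.inr.inj h').symm
    · simp

theorem sum_split (i : I) {M : Type*} [AddCommGroup M] (F : DArrow I → M) :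
    ∑ a, F a = ∑ r : RArrow i, F (star r.1) + ∑ a with tail a ≠ i, F a := by
  rw [← Finset.sum_filter_add_sum_filter_not Finset.univ (fun a => tail a = i)]
  congr 1
  rw [← Finset.sum_subtype (p := fun a : DArrow I => head a = i)
    (Finset.univ.filter fun a => head a = i) (by simp) (fun a => F (star a))]
  exact Finset.sum_bij (fun a _ => star a) (by simp) (fun a _ b _ h => star_inj.1 h)
    (fun b hb => ⟨star b, by simpa using hb, by simp⟩) (by simp)

theorem rel_one_ne [IsEmpty (i ⟶ i)] (hR : Satisfies lam ν E S X) {f : Word n i → V}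
    (hf : f ∈ reflectionSubmodule i E X) {ℓ : Fin n} {w : Word n i} {v : I} (hv : v ≠ i)
    (hw : w ℓ = .inl v) :
    ∑ a : DArrow I, sgn a • edgeOp lam ν i S X a ℓ (edgeOp lam ν i S X (star a) ℓ f) w =
      reflect i lam v • f w + ν • ∑ m with m ≠ ℓ ∧ w.vertex m = v,
        S (Equiv.swap ℓ m) (f (w ∘ Equiv.swap ℓ m)) := by
  have hvl : w.tail ℓ = v := by rw [Word.tail_apply, hw]; rfl
  have hone := rel_one' hR (memE hf w) ℓ
  rw [Finset.sum_filter, sum_split i, hvl] at hone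
  rw [sum_split i]
  have h1 : ∀ r : RArrow i, sgn (star r.1) • edgeOp lam ν i S X (star r.1) ℓ
      (edgeOp lam ν i S X (star (star r.1)) ℓ f) w =
      (if head (star r.1) = v then sgn (star r.1) • X (star r.1) ℓ (X (star (star r.1)) ℓ (f w))
        else 0)
      + ((if tail r.1 = v then lam i • f w else 0)
      - ν • ∑ m with m ≠ ℓ, if tail r.1 = v ∧ w m = .inr r then S (Equiv.swap ℓ m) (f w)
          else 0) := by
    intro r
    rw [star_star, edge_head, edge_tail, sgn_star, LinearMap.smul_apply, Pi.smul_apply, neg_smul,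
      sgn_smul_smul, head_star]
    by_cases h : tail r.1 = v
    · have hw2 : w ℓ = .inl (tail r.1) := by rw [hw, h]
      have hw3 : Function.update w ℓ (.inl (tail r.1)) = w := by
        rw [Function.update_eq_self_iff, hw2]
      have h4 : tauProj (k := k) i r ℓ (thetaOp lam ν i S X r ℓ f) w =
          thetaOp lam ν i S X r ℓ f (Function.update w ℓ (.inr r)) := by simp [tauProj, hw2]
      rw [h4, theta_inr r f (r := r) (by simp), if_pos rfl, if_pos h, if_pos h,
        Function.update_idem, hw3]
      have h5 : ∑ m with m ≠ ℓ, S (Equiv.swap m ℓ) (if Function.update w ℓ (.inr r) m = .inr r then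
          f (Function.update (Function.update (Function.update w ℓ (.inr r)) m (.inr r)) ℓ
            (.inl (tail r.1))) else 0) =
          ∑ m with m ≠ ℓ, if tail r.1 = v ∧ w m = .inr r then S (Equiv.swap ℓ m) (f w) else 0 := by
        refine Finset.sum_congr rfl fun m hm => ?_
        have hm : m ≠ ℓ := by simpa using hm
        rw [Function.update_of_ne hm, Equiv.swap_comm]
        by_cases h6 : w m = .inr r
        · have : Function.update w m (.inr r) = w := by
            rw [Function.update_eq_self_iff, h6]
          rw [if_pos h6, if_pos ⟨h, h6⟩, Function.update_comm hm.symm, Function.update_idem,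
            this, hw3]
        · rw [if_neg h6, if_neg (fun h => h6 h.2), map_zero]
      rw [h5]
      module
    · have hw2 : w ℓ ≠ .inl (tail r.1) := by rw [hw]; simpa using Ne.symm h
      simp [tauProj, hw2, h]
  have h2 : ∀ a ∈ Finset.univ.filter (fun a : DArrow I => tail a ≠ i),
      sgn a • edgeOp lam ν i S X a ℓ (edgeOp lam ν i S X (star a) ℓ f) w =
      if head a = v then sgn a • X a ℓ (X (star a) ℓ (f w)) else 0 := by
    intro a ha
    have ha : tail a ≠ i := by simpa using ha
    split_ifs with h
    · have ha' : head a ≠ i := by rw [h]; exact hv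
      rw [edge_else ha' ha, edge_else (by simpa using ha) (by simpa using ha')]
      have hw2 : w ℓ = .inl (head a) := by rw [hw, h]
      have hw3 : Function.update w ℓ (.inl (head a)) = w := by
        rw [Function.update_eq_self_iff, hw2]
      simp [arrowOp, hw2, hw3]
    · rw [edge_zero a ℓ _ (by rw [Word.vertex_apply, hw]; exact Ne.symm h), smul_zero]
  simp_rw [h1]
  rw [Finset.sum_congr rfl h2, Finset.sum_add_distrib, add_right_comm, hone,
    Finset.sum_sub_distrib, reflect_ne hv, ← Finset.sum_filter, Finset.sum_const,
    ← Finset.smul_sum, Finset.sum_comm]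
  have h3 : ∑ m with m ≠ ℓ ∧ w.tail m = v, S (Equiv.swap ℓ m) (f w) =
      ∑ m with m ≠ ℓ ∧ w.vertex m = v, S (Equiv.swap ℓ m) (f (w ∘ Equiv.swap ℓ m)) +
      ∑ m with m ≠ ℓ, ∑ r : RArrow i, if tail r.1 = v ∧ w m = .inr r then
        S (Equiv.swap ℓ m) (f w) else 0 := by
    rw [← Finset.filter_filter, Finset.sum_filter (fun m => w.tail m = v), ← Finset.filter_filter,
      Finset.sum_filter (fun m => w.vertex m = v), ← Finset.sum_add_distrib]
    refine Finset.sum_congr rfl fun m hm => ?_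
    rw [Word.tail_apply, Word.vertex_apply]
    rcases h : w m with v' | r
    · rw [Finset.sum_eq_zero (fun r'' _ => if_neg (by simp)), add_zero]
      by_cases h' : v' = v
      · rw [comp_swap_of_eq w (by rw [hw, h, h'])]
        rfl
      · exact (if_neg (show ¬ letterTail (i := i) (.inl v') = v from h')).trans
          (if_neg (show ¬ letterVertex (i := i) (.inl v') = v from h')).symm
    · rw [if_neg (show ¬ letterVertex (.inr r) = v from Ne.symm hv), zero_add,
        Finset.sum_eq_single r]
      · simp only [and_true]
        rfl
      · intro b _ hb
        rw [if_neg]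
        rintro ⟨_, h'⟩
        exact hb (Sum.inr.inj h').symm
      · simp
  rw [h3, ← Nat.cast_smul_eq_nsmul k, smul_smul, add_smul]
  module

end relations
end
end WreathReflection

namespace WreathReflection
noncomputable section
universe uI uQ uk uV

section relTwo

variable {I : Type uI} [Quiver.{uQ} I] [Fintype I] [Fintype (Quiver.Total I)]
  {k : Type uk} [CommRing k] {n : ℕ} {lam : I → k} {ν : k} {i : I}
  {V : Type uV} [AddCommGroup V] [Module k V]
  {E : (Fin n → I) → Module.End k V} {S : Equiv.Perm (Fin n) → Module.End k V}
  {X : DArrow I → Fin n → Module.End k V}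

/-- The commutation relation of `a'_ℓ` and `b'_m`, evaluated at `f` and the word `w`. -/
def CommAt (lam : I → k) (ν : k) (i : I) (S : Equiv.Perm (Fin n) → Module.End k V)
    (X : DArrow I → Fin n → Module.End k V) (a b : DArrow I) (ℓ m : Fin n) (f : Word n i → V)
    (w : Word n i) : Prop :=
  edgeOp lam ν i S X a ℓ (edgeOp lam ν i S X b m f) w =
    edgeOp lam ν i S X b m (edgeOp lam ν i S X a ℓ f) w +
      if a = star b then ν • sgn b • S (Equiv.swap ℓ m) (f (w ∘ Equiv.swap ℓ m)) else 0

theorem CommAt.symm {a b : DArrow I} {ℓ m : Fin n} {f : Word n i → V} {w : Word n i}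
    (h : CommAt lam ν i S X a b ℓ m f w) : CommAt lam ν i S X b a m ℓ f w := by
  unfold CommAt at *
  rw [h, Equiv.swap_comm m ℓ]
  by_cases h' : a = star b
  · subst h'
    simp
  · have h2 : b ≠ star a := fun h => h' (by rw [h, star_star])
    rw [if_neg h', if_neg h2, add_zero, add_zero]

theorem arrow_apply (a : DArrow I) (f : Word n i → V) {w : Word n i} {ℓ : Fin n}
    (h : w ℓ = .inl (head a)) :
    arrowOp i X a ℓ f w = X a ℓ (f (Function.update w ℓ (.inl (tail a)))) := by
  simp [arrowOp, h]

theorem tauProj_apply (r : RArrow i) (f : Word n i → V) {w : Word n i} {ℓ : Fin n}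
    (h : w ℓ = .inl (tail r.1)) :
    tauProj (k := k) i r ℓ f w = f (Function.update w ℓ (.inr r)) := by
  simp [tauProj, h]

theorem comm_arrow_arrow [IsEmpty (i ⟶ i)] (hR : Satisfies lam ν E S X) {f : Word n i → V}
    (hf : f ∈ reflectionSubmodule i E X) {a b : DArrow I} (ha : head a ≠ i) (ha' : tail a ≠ i)
    (hb : head b ≠ i) (hb' : tail b ≠ i) {ℓ m : Fin n} (hne : ℓ ≠ m) {w : Word n i}
    (hwl : w ℓ = .inl (head a)) (hwm : w m = .inl (head b)) : CommAt lam ν i S X a b ℓ m f w := by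
  unfold CommAt
  rw [edge_else ha ha', edge_else hb hb', arrow_apply a _ hwl, arrow_apply b _ hwm,
    arrow_apply b _ (by simpa [hne.symm] using hwm), arrow_apply a _ (by simpa [hne] using hwl),
    Function.update_comm hne.symm,
    rel_two' hR (memE hf _) hne a b (by simp [Word.tail_update, hne])
      (by simp [Word.tail_update])]
  congr 1
  by_cases h : a = star b
  · rw [if_pos h, if_pos h, comp_swap_eq_update w hne, hwl, hwm, h]
    simp [Function.update_comm hne]
  · rw [if_neg h, if_neg h]

theorem comm_tail_arrow [IsEmpty (i ⟶ i)] {f : Word n i → V} (r : RArrow i) {b : DArrow I}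
    (hb : head b ≠ i) (hb' : tail b ≠ i) {ℓ m : Fin n} (hne : ℓ ≠ m) {w : Word n i}
    (hwl : w ℓ = .inl (tail r.1)) (hwm : w m = .inl (head b)) :
    CommAt lam ν i S X (star r.1) b ℓ m f w := by
  unfold CommAt
  have h : star r.1 ≠ star b := fun h => hb (by rw [← star_inj.1 h, r.2])
  rw [if_neg h, add_zero, edge_tail, edge_else hb hb', LinearMap.smul_apply, LinearMap.smul_apply,
    Pi.smul_apply, map_zsmul, Pi.smul_apply, tauProj_apply r _ hwl, arrow_apply b _ hwm,
    arrow_apply b _ (by simpa [hne.symm] using hwm), tauProj_apply r _ (by simpa [hne] using hwl),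
    Function.update_comm hne]

theorem comm_tail_tail [IsEmpty (i ⟶ i)] {f : Word n i → V} (r r' : RArrow i)
    {ℓ m : Fin n} (hne : ℓ ≠ m) {w : Word n i}
    (hwl : w ℓ = .inl (tail r.1)) (hwm : w m = .inl (tail r'.1)) :
    CommAt lam ν i S X (star r.1) (star r'.1) ℓ m f w := by
  unfold CommAt
  have h : star r.1 ≠ star (star r'.1) := fun h => ne_star _ _ (star_inj.1 h)
  rw [if_neg h, add_zero, edge_tail, edge_tail, LinearMap.smul_apply, LinearMap.smul_apply,
    LinearMap.smul_apply, LinearMap.smul_apply, map_zsmul, map_zsmul,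
    Pi.smul_apply, Pi.smul_apply, Pi.smul_apply, Pi.smul_apply, tauProj_apply r _ hwl,
    tauProj_apply r' _ hwm, tauProj_apply r' _ (by simpa [hne.symm] using hwm),
    tauProj_apply r _ (by simpa [hne] using hwl), Function.update_comm hne, smul_comm]

theorem comm_head_arrow [IsEmpty (i ⟶ i)] (hR : Satisfies lam ν E S X) {f : Word n i → V}
    (hf : f ∈ reflectionSubmodule i E X) (a : RArrow i) {b : DArrow I}
    (hb : head b ≠ i) (hb' : tail b ≠ i) {ℓ m : Fin n} (hne : ℓ ≠ m) {w : Word n i} {r : RArrow i}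
    (hwl : w ℓ = .inr r) (hwm : w m = .inl (head b)) :
    CommAt lam ν i S X a.1 b ℓ m f w := by
  unfold CommAt
  have h : a.1 ≠ star b := fun h => hb' (by rw [← head_star, ← h, a.2])
  have h2 : ∀ r : RArrow i, star r.1 ≠ star b := fun r h => hb (by rw [← star_inj.1 h, r.2])
  rw [if_neg h, add_zero, edge_head, edge_else hb hb', arrow_apply b _ hwm,
    theta_inr a _ hwl, theta_inr a f (r := r) (by simpa [hne] using hwl), map_add, map_add,
    map_smul, map_zsmul, map_smul, map_sum]
  rw [arrow_apply b f (by simpa [hne.symm] using hwm), Function.update_comm hne.symm]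
  congr 1
  · congr 1
    · congr 1
      split_ifs <;> simp
    · have hE := memE hf (Function.update (Function.update w ℓ (.inl (tail a.1))) m
        (.inl (tail b)))
      rw [X_comm hR hE hne a.1 b (by simp [Word.tail_update, hne])
        (by simp [Word.tail_update]) h]
      have hE2 := E_X hR hE a.1 ℓ (by simp [Word.tail_update, hne]) rfl
      rw [X_comm hR hE2 hne (star r.1) b (by simp [a.2, r.2])
        (by simp [Word.tail_update, hne.symm]) (h2 r)]
  · congr 1
    refine Finset.sum_congr rfl fun q hq => ?_
    have hq : q ≠ ℓ := by simpa using hq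
    by_cases hqm : q = m
    · subst hqm
      simp [hwm]
    · rw [Function.update_of_ne hqm]
      split_ifs
      · rw [arrow_apply b f (by simpa [hne.symm, Ne.symm hqm] using hwm), S_X hR,
          Equiv.swap_apply_of_ne_of_ne (Ne.symm hqm) hne.symm,
          Function.update_comm hne, Function.update_comm hqm]
      · simp

theorem comm_head_tail [IsEmpty (i ⟶ i)] {f : Word n i → V} (a r' : RArrow i)
    {ℓ m : Fin n} (hne : ℓ ≠ m) {w : Word n i} {r : RArrow i}
    (hwl : w ℓ = .inr r) (hwm : w m = .inl (tail r'.1)) :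
    CommAt lam ν i S X a.1 (star r'.1) ℓ m f w := by
  unfold CommAt
  rw [edge_head, edge_tail, LinearMap.smul_apply, LinearMap.smul_apply, map_zsmul, Pi.smul_apply,
    Pi.smul_apply, star_star, tauProj_apply r' _ hwm, sgn_star, theta_inr a _ hwl,
    theta_inr a f (r := r) (by simpa [hne] using hwl),
    tauProj_apply r' _ (by simpa [hne.symm] using hwm), Function.update_comm hne.symm]
  have h1 : ∑ q with q ≠ ℓ, S (Equiv.swap q ℓ) (if w q = .inr a then tauProj (k := k) i r' m f
        (Function.update (Function.update w q (.inr r)) ℓ (.inl (tail a.1))) else 0) =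
      ∑ q with q ≠ ℓ, S (Equiv.swap q ℓ) (if Function.update w m (.inr r') q = .inr a then
        f (Function.update (Function.update (Function.update w m (.inr r')) q (.inr r)) ℓ
          (.inl (tail a.1))) else 0)
      - if a.1 = r'.1 then S (Equiv.swap ℓ m) (f (w ∘ Equiv.swap ℓ m)) else 0 := by
    rw [eq_sub_iff_add_eq, ← Finset.add_sum_erase _ _ (show m ∈ Finset.univ.filter fun q => q ≠ ℓ by
      simpa using hne.symm), ← Finset.add_sum_erase (Finset.univ.filter fun q => q ≠ ℓ) (fun q =>
        S (Equiv.swap q ℓ) (if Function.update w m (.inr r') q = .inr a then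
        f (Function.update (Function.update (Function.update w m (.inr r')) q (.inr r)) ℓ
          (.inl (tail a.1))) else 0)) (show m ∈ Finset.univ.filter fun q => q ≠ ℓ by
      simpa using hne.symm), hwm, if_neg (by simp), map_zero, zero_add, add_comm]
    congr 1
    · rw [Function.update_self, Function.update_idem]
      by_cases h : a = r'
      · subst h
        rw [if_pos rfl, if_pos rfl, Equiv.swap_comm ℓ m, comp_swap_eq_update w hne.symm, hwl, hwm]
      · have h' : ¬ (Sum.inr r' : I ⊕ RArrow i) = .inr a := fun h' => h (Sum.inr.inj h').symm
        rw [if_neg (fun h' => h (Subtype.ext h')), if_neg h', map_zero]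
    · refine Finset.sum_congr rfl fun q hq => ?_
      have hqm : q ≠ m := Finset.ne_of_mem_erase hq
      rw [Function.update_of_ne hqm, tauProj_apply r' f
        (by simpa [hne.symm, Ne.symm hqm] using hwm), Function.update_comm hne,
        Function.update_comm hqm]
  rw [h1]
  by_cases h : a.1 = r'.1
  · rw [if_pos h, if_pos h]
    module
  · rw [if_neg h, if_neg h]
    module

theorem alg_identity {A : Type*} [Ring A] [Algebra k A] (c ν : k) {Pl Pm T Nl Nm : A}
    (h1 : Pl * Nm = Nm * Pl) (h2 : Pm * Nl = Nl * Pm) (h3 : (T + Nl) * Nm = (T + Nm) * Nl) :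
    (c • 1 + Pl + ν • (T + Nl)) * (c • 1 + Pm + ν • Nm) -
      (c • 1 + Pm + ν • (T + Nm)) * (c • 1 + Pl + ν • Nl) =
      (Pl * Pm + ν • (T * Pm)) - (Pm * Pl + ν • (T * Pl)) := by
  have : (c • 1 + Pl + ν • (T + Nl)) * (c • 1 + Pm + ν • Nm) -
      (c • 1 + Pm + ν • (T + Nm)) * (c • 1 + Pl + ν • Nl) =
      (Pl * Pm + ν • (T * Pm)) - (Pm * Pl + ν • (T * Pl)) + ν • (Pl * Nm - Nm * Pl)
      - ν • (Pm * Nl - Nl * Pm) + (ν * ν) • ((T + Nl) * Nm - (T + Nm) * Nl) := by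
    simp only [mul_add, add_mul, smul_mul_assoc, mul_smul_comm, one_mul, mul_one, smul_add,
      smul_sub, smul_smul]
    module
  rw [this, h1, h2, h3]
  simp

/-- The operator `μ_ℓ π_ℓ`. -/
def muPi (i : I) (X : DArrow I → Fin n → Module.End k V) (ℓ : Fin n) :
    Module.End k (Word n i → V) := muOp i X ℓ * piOp i X ℓ

/-- The sum of the transpositions `s_{qℓ}` with `q ≠ ℓ, m`. -/
def swapSum (i : I) (S : Equiv.Perm (Fin n) → Module.End k V) (ℓ m : Fin n) :
    Module.End k (Word n i → V) := ∑ q with q ≠ ℓ ∧ q ≠ m, permOp i S (Equiv.swap q ℓ)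

theorem permOp_mul (hR : Satisfies lam ν E S X) (σ τ : Equiv.Perm (Fin n)) :
    permOp i S σ * permOp i S τ = permOp i S (σ * τ) := by
  refine LinearMap.ext fun f => funext fun w => ?_
  change S σ (S τ (f ((w ∘ σ) ∘ τ))) = S (σ * τ) (f (w ∘ ⇑(σ * τ)))
  rw [S_mul hR]
  rfl

theorem perm_muPi (hR : Satisfies lam ν E S X) (σ : Equiv.Perm (Fin n)) (ℓ : Fin n) :
    permOp i S σ * muPi i X ℓ = muPi i X (σ ℓ) * permOp i S σ := by
  refine LinearMap.ext fun f => funext fun w => ?_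
  change S σ (muOp i X ℓ (piOp i X ℓ f) (w ∘ σ)) =
    muOp i X (σ ℓ) (piOp i X (σ ℓ) (permOp i S σ f)) w
  rcases h : w (σ ℓ) with v | r
  · rw [muPi_inl _ h, muPi_inl (v := v) _ (by simpa using h), map_zero]
  · rw [muPi_inr _ h, muPi_inr (r := r) _ (by simpa using h), map_zsmul, S_X hR, map_sum]
    congr 2
    refine Finset.sum_congr rfl fun r' _ => ?_
    rw [S_X hR, ← update_comp_perm]
    rfl

theorem swapSum_muPi (hR : Satisfies lam ν E S X) {ℓ m : Fin n} (hne : ℓ ≠ m) :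
    muPi i X ℓ * swapSum i S m ℓ = swapSum i S m ℓ * muPi i X ℓ := by
  rw [swapSum, Finset.mul_sum, Finset.sum_mul]
  refine Finset.sum_congr rfl fun q hq => ?_
  simp only [Finset.mem_filter, Finset.mem_univ, true_and] at hq
  rw [perm_muPi hR, Equiv.swap_apply_of_ne_of_ne (Ne.symm hq.2) hne]

theorem swapSum_comm (hR : Satisfies lam ν E S X) {ℓ m : Fin n} (hne : ℓ ≠ m) :
    (permOp i S (Equiv.swap m ℓ) + swapSum i S ℓ m) * swapSum i S m ℓ =
      (permOp i S (Equiv.swap m ℓ) + swapSum i S m ℓ) * swapSum i S ℓ m := by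
  have hs : (Finset.univ.filter fun q : Fin n => q ≠ ℓ ∧ q ≠ m) =
      Finset.univ.filter fun q : Fin n => q ≠ m ∧ q ≠ ℓ := by simp only [and_comm]
  set s := Finset.univ.filter fun q : Fin n => q ≠ m ∧ q ≠ ℓ with hsdef
  have hN : ∀ A B : Fin n → Module.End k (Word n i → V), (∑ q ∈ s, A q) * (∑ q ∈ s, B q) =
      ∑ q ∈ s, A q * B q + ∑ p ∈ s, ∑ q ∈ s.erase p, A p * B q := by
    intro A B
    rw [Finset.sum_mul_sum, ← Finset.sum_add_distrib]
    exact Finset.sum_congr rfl fun p hp => (Finset.add_sum_erase s _ hp).symm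
  rw [swapSum, swapSum, hs, ← hsdef, add_mul, add_mul, hN, hN, Finset.mul_sum, Finset.mul_sum]
  have h1 : ∑ q ∈ s, permOp i S (Equiv.swap q ℓ) * permOp i S (Equiv.swap q m) =
      ∑ q ∈ s, permOp i S (Equiv.swap m ℓ) * permOp i S (Equiv.swap q ℓ) := by
    refine Finset.sum_congr rfl fun q hq => ?_
    simp only [hsdef, Finset.mem_filter, Finset.mem_univ, true_and] at hq
    rw [permOp_mul hR, permOp_mul hR, Equiv.mul_swap_eq_swap_mul, Equiv.swap_apply_left,
      Equiv.swap_apply_of_ne_of_ne (Ne.symm hq.1) hne.symm, Equiv.swap_comm ℓ m]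
  have h2 : ∑ q ∈ s, permOp i S (Equiv.swap q m) * permOp i S (Equiv.swap q ℓ) =
      ∑ q ∈ s, permOp i S (Equiv.swap m ℓ) * permOp i S (Equiv.swap q m) := by
    refine Finset.sum_congr rfl fun q hq => ?_
    simp only [hsdef, Finset.mem_filter, Finset.mem_univ, true_and] at hq
    rw [permOp_mul hR, permOp_mul hR, Equiv.mul_swap_eq_swap_mul, Equiv.swap_apply_left,
      Equiv.swap_apply_of_ne_of_ne (Ne.symm hq.2) hne]
  have h3 : ∑ p ∈ s, ∑ q ∈ s.erase p, permOp i S (Equiv.swap p ℓ) * permOp i S (Equiv.swap q m) =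
      ∑ p ∈ s, ∑ q ∈ s.erase p, permOp i S (Equiv.swap p m) * permOp i S (Equiv.swap q ℓ) := by
    rw [Finset.sum_comm' (t' := s) (s' := fun q => s.erase q)
      (by intro x y; simp only [Finset.mem_erase]; tauto)]
    refine Finset.sum_congr rfl fun q hq => Finset.sum_congr rfl fun p hp => ?_
    simp only [hsdef, Finset.mem_filter, Finset.mem_univ, true_and, Finset.mem_erase] at hq hp
    rw [permOp_mul hR, permOp_mul hR, Equiv.mul_swap_eq_swap_mul,
      Equiv.swap_apply_of_ne_of_ne (Ne.symm hp.1) hq.2,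
      Equiv.swap_apply_of_ne_of_ne (Ne.symm hp.2.1) hne.symm]
  rw [h1, h2, h3]
  abel

theorem tauIncl_supp {f : Word n i → V} (hf : ∀ w, E w.tail (f w) = f w) (a : RArrow i)
    (ℓ : Fin n) (w : Word n i) :
    E w.tail (tauIncl (k := k) i a ℓ f w) = tauIncl (k := k) i a ℓ f w := by
  by_cases h : w ℓ = .inr a
  · have h1 : tauIncl (k := k) i a ℓ f w = f (Function.update w ℓ (.inl (tail a.1))) := by
      simp [tauIncl, h]
    have h2 : w.tail = Word.tail (Function.update w ℓ (.inl (tail a.1))) := by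
      rw [Word.tail_update, eq_comm, Function.update_eq_self_iff, Word.tail_apply, h]; rfl
    rw [h1, h2, hf]
  · simp [tauIncl, h]

theorem tauIncl_comm (a b : RArrow i) {ℓ m : Fin n} (hne : ℓ ≠ m) (f : Word n i → V) :
    tauIncl (k := k) i a ℓ (tauIncl (k := k) i b m f) =
      tauIncl (k := k) i b m (tauIncl (k := k) i a ℓ f) := by
  ext w
  by_cases h : w ℓ = .inr a <;> by_cases h' : w m = .inr b <;>
    simp [tauIncl, h, h', hne, hne.symm, Function.update_comm hne]

theorem muPi_swap [IsEmpty (i ⟶ i)] (hR : Satisfies lam ν E S X) {h : Word n i → V}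
    (hh : ∀ w, E w.tail (h w) = h w) {ℓ m : Fin n} (hne : ℓ ≠ m) {w : Word n i} {r r' : RArrow i}
    (hwl : w ℓ = .inr r) (hwm : w m = .inr r') :
    muPi i X ℓ (muPi i X m h) w + ν • permOp i S (Equiv.swap m ℓ) (muPi i X m h) w =
      sgn r.1 • sgn r'.1 • X (star r.1) ℓ (X (star r'.1) m (∑ r1 : RArrow i, ∑ r2 : RArrow i,
        X r1.1 ℓ (X r2.1 m (h (Function.update (Function.update w ℓ (.inr r1)) m (.inr r2)))))) := by
  set Y : RArrow i → V := fun r1 => ∑ r2 : RArrow i,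
    X r2.1 m (h (Function.update (Function.update w ℓ (.inr r1)) m (.inr r2))) with hY
  have hEY : ∀ r1 : RArrow i,
      E (Function.update (Function.update w.tail ℓ (tail r1.1)) m i) (Y r1) = Y r1 := by
    intro r1
    rw [hY, map_sum]
    refine Finset.sum_congr rfl fun r2 _ => E_X hR (hh _) _ m (by simp [Word.tail_update]) ?_
    rw [Word.tail_update, Word.tail_update, Function.update_idem, r2.2]
    rfl
  have h1 : ∀ r1 : RArrow i, X r1.1 ℓ (muPi i X m h (Function.update w ℓ (.inr r1))) =
      sgn r'.1 • X (star r'.1) m (X r1.1 ℓ (Y r1)) -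
        if r1 = r' then ν • S (Equiv.swap m ℓ) (Y r') else 0 := by
    intro r1
    change X r1.1 ℓ (muOp i X m (piOp i X m h) (Function.update w ℓ (.inr r1))) = _
    rw [muPi_inr (r := r') _ (by simpa [hne.symm] using hwm), map_zsmul,
      rel_two' hR (hEY r1) hne r1.1 (star r'.1) (by simp [hne]) (by simp [r'.2]), smul_add,
      sub_eq_add_neg, star_star, sgn_star, Equiv.swap_comm m ℓ]
    congr 1
    by_cases h : r1 = r'
    · subst h
      rw [if_pos rfl, if_pos rfl, neg_smul, smul_neg, smul_neg, smul_comm ν, sgn_smul_smul]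
    · rw [if_neg h, if_neg (fun h' => h (Subtype.ext h')), smul_zero, neg_zero]
  have h2 : permOp i S (Equiv.swap m ℓ) (muPi i X m h) w =
      sgn r.1 • X (star r.1) ℓ (S (Equiv.swap m ℓ) (Y r')) := by
    change S _ (muOp i X m (piOp i X m h) (w ∘ Equiv.swap m ℓ)) = _
    rw [muPi_inr (r := r) _ (by simpa using hwl), map_zsmul, S_X hR, Equiv.swap_apply_left]
    congr 4
    funext r2
    rw [comp_swap_eq_update w hne.symm, hwl, hwm, Function.update_comm hne, Function.update_idem,
      Function.update_comm hne]
  have h3 : muPi i X ℓ (muPi i X m h) w = sgn r.1 • X (star r.1) ℓ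
      (∑ r1 : RArrow i, X r1.1 ℓ (muPi i X m h (Function.update w ℓ (.inr r1)))) :=
    muPi_inr _ hwl
  rw [h3, h2]
  simp_rw [h1]
  rw [Finset.sum_sub_distrib, Finset.sum_ite_eq' Finset.univ r', if_pos (Finset.mem_univ _),
    ← Finset.smul_sum, ← map_sum, map_sub, map_zsmul, map_smul]
  simp only [hY, map_sum]
  module

theorem muPi_swap_comm [IsEmpty (i ⟶ i)] (hR : Satisfies lam ν E S X) {h : Word n i → V}
    (hh : ∀ w, E w.tail (h w) = h w) {ℓ m : Fin n} (hne : ℓ ≠ m) {w : Word n i} {r r' : RArrow i}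
    (hwl : w ℓ = .inr r) (hwm : w m = .inr r') :
    muPi i X ℓ (muPi i X m h) w + ν • permOp i S (Equiv.swap m ℓ) (muPi i X m h) w =
      muPi i X m (muPi i X ℓ h) w + ν • permOp i S (Equiv.swap m ℓ) (muPi i X ℓ h) w := by
  have h2 := muPi_swap hR hh hne.symm hwm hwl
  rw [Equiv.swap_comm ℓ m] at h2
  rw [h2, muPi_swap hR hh hne hwl hwm, smul_comm, Finset.sum_comm]
  congr 2
  have h3 : ∀ r2 r1 : RArrow i,
      X r1.1 ℓ (X r2.1 m (h (Function.update (Function.update w ℓ (.inr r1)) m (.inr r2)))) =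
      X r2.1 m (X r1.1 ℓ (h (Function.update (Function.update w m (.inr r2)) ℓ (.inr r1)))) := by
    intro r2 r1
    rw [X_comm hR (hh _) hne r1.1 r2.1 (by simp [Word.tail_update, hne])
      (by simp [Word.tail_update]) (ne_star _ _), Function.update_comm hne]
  simp_rw [h3]
  refine X_comm hR (j := Function.update (Function.update w.tail ℓ i) m i) ?_ hne _ _
    (by simp [hne, r.2]) (by simp [r'.2]) (by rw [star_star]; exact (ne_star r' r).symm)
  simp only [map_sum]
  refine Finset.sum_congr rfl fun r2 _ => Finset.sum_congr rfl fun r1 _ => ?_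
  refine E_X hR (E_X hR (hh _) _ ℓ (by simp [Word.tail_update]) rfl) _ m
    (by simp [Word.tail_update, hne.symm]) ?_
  rw [Word.tail_update, Word.tail_update, Function.update_idem, r1.2, r2.2,
    Function.update_comm hne.symm, Function.update_idem]

theorem theta_muPi (a : RArrow i) (f : Word n i → V) {ℓ m : Fin n} (hne : ℓ ≠ m)
    {w : Word n i} {r : RArrow i} (hw : w ℓ = .inr r) : thetaOp lam ν i S X a ℓ f w =
      ((-lam i) • (1 : Module.End k (Word n i → V)) + muPi i X ℓ
        + ν • (permOp i S (Equiv.swap m ℓ) + swapSum i S ℓ m)) (tauIncl (k := k) i a ℓ f) w := by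
  rw [theta_eq a f hw]
  have : (Finset.univ.filter fun q => q ≠ ℓ) =
      insert m (Finset.univ.filter fun q => q ≠ ℓ ∧ q ≠ m) := by
    ext q
    by_cases h : q = m
    · subst h; simp [hne.symm]
    · simp [h]
  rw [this, Finset.sum_insert (by simp)]
  simp [swapSum, muPi]

theorem tau_theta (a b : RArrow i) (f : Word n i → V) {ℓ m : Fin n} (hne : ℓ ≠ m)
    {w : Word n i} {r' : RArrow i} (hwm : w m = .inr r') :
    tauIncl (k := k) i a ℓ (thetaOp lam ν i S X b m f) w =
      ((-lam i) • (1 : Module.End k (Word n i → V)) + muPi i X m + ν • swapSum i S m ℓ)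
        (tauIncl (k := k) i a ℓ (tauIncl (k := k) i b m f)) w := by
  set h := tauIncl (k := k) i a ℓ (tauIncl (k := k) i b m f) with hh
  have h0 : ((-lam i) • (1 : Module.End k (Word n i → V)) + muPi i X m + ν • swapSum i S m ℓ) h w =
      (-lam i) • h w + muOp i X m (piOp i X m h) w
        + ν • ∑ q with q ≠ m ∧ q ≠ ℓ, permOp i S (Equiv.swap q m) h w := by
    simp [swapSum, muPi]
  rw [h0, muPi_inr _ hwm]
  by_cases hwl : w ℓ = .inr a
  · have h1 : ∀ (g : Word n i → V) (w : Word n i), w ℓ = .inr a →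
        tauIncl (k := k) i a ℓ g w = g (Function.update w ℓ (.inl (tail a.1))) := by
      intro g w hw; simp [tauIncl, hw]
    rw [h1 _ w hwl, theta_eq b f (r := r') (by simpa [hne.symm] using hwm),
      muPi_inr (r := r') _ (by simpa [hne.symm] using hwm), hh, h1 _ w hwl]
    congr 1
    · congr 4
      funext r2
      rw [h1 _ _ (by simpa [hne] using hwl), Function.update_comm hne]
    · congr 1
      have : (Finset.univ.filter fun q => q ≠ m) =
          insert ℓ (Finset.univ.filter fun q => q ≠ m ∧ q ≠ ℓ) := by
        ext q
        by_cases h : q = ℓ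
        · subst h; simp [hne]
        · simp [h]
      rw [this, Finset.sum_insert (by simp)]
      have h2 : permOp i S (Equiv.swap ℓ m) (tauIncl (k := k) i b m f)
          (Function.update w ℓ (.inl (tail a.1))) = 0 := by
        simp [permOp, tauIncl]
      rw [h2, zero_add]
      refine Finset.sum_congr rfl fun q hq => ?_
      simp only [Finset.mem_filter, Finset.mem_univ, true_and] at hq
      have hs : Equiv.swap q m ℓ = ℓ := Equiv.swap_apply_of_ne_of_ne (Ne.symm hq.2) hne
      change S _ (tauIncl (k := k) i b m f _) = S _ (tauIncl (k := k) i a ℓ _ _)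
      rw [h1 _ _ (by simpa [hs] using hwl), ← update_comp_perm, hs]
  · have h1 : ∀ (g : Word n i → V) (w : Word n i), w ℓ ≠ .inr a →
        tauIncl (k := k) i a ℓ g w = 0 := by
      intro g w hw; simp [tauIncl, hw]
    rw [h1 _ w hwl, hh, h1 _ w hwl, Finset.sum_eq_zero, Finset.sum_eq_zero]
    · simp
    · intro q hq
      simp only [Finset.mem_filter, Finset.mem_univ, true_and] at hq
      have hs : Equiv.swap q m ℓ = ℓ := Equiv.swap_apply_of_ne_of_ne (Ne.symm hq.2) hne
      change S _ (tauIncl (k := k) i a ℓ _ _) = 0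
      rw [h1 _ _ (by simpa [hs] using hwl), map_zero]
    · intro r2 _
      rw [h1 _ _ (by simpa [hne] using hwl), map_zero]

theorem theta_theta (a b : RArrow i) (f : Word n i → V) {ℓ m : Fin n} (hne : ℓ ≠ m)
    {w : Word n i} {r r' : RArrow i} (hwl : w ℓ = .inr r) (hwm : w m = .inr r') :
    thetaOp lam ν i S X a ℓ (thetaOp lam ν i S X b m f) w =
      (((-lam i) • (1 : Module.End k (Word n i → V)) + muPi i X ℓ
        + ν • (permOp i S (Equiv.swap m ℓ) + swapSum i S ℓ m)) *
      ((-lam i) • (1 : Module.End k (Word n i → V)) + muPi i X m + ν • swapSum i S m ℓ))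
        (tauIncl (k := k) i a ℓ (tauIncl (k := k) i b m f)) w := by
  rw [theta_muPi a _ hne hwl, Module.End.mul_apply]
  set g := tauIncl (k := k) i a ℓ (thetaOp lam ν i S X b m f) with hg
  set g' := ((-lam i) • (1 : Module.End k (Word n i → V)) + muPi i X m + ν • swapSum i S m ℓ)
        (tauIncl (k := k) i a ℓ (tauIncl (k := k) i b m f)) with hg'
  have key : ∀ (w : Word n i) (r' : RArrow i), w m = .inr r' → g w = g' w :=
    fun w r' hw => tau_theta a b f hne hw
  have h0 : ∀ g : Word n i → V, ((-lam i) • (1 : Module.End k (Word n i → V)) + muPi i X ℓ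
        + ν • (permOp i S (Equiv.swap m ℓ) + swapSum i S ℓ m)) g w =
      (-lam i) • g w + muOp i X ℓ (piOp i X ℓ g) w + ν • (permOp i S (Equiv.swap m ℓ) g w +
        ∑ q with q ≠ ℓ ∧ q ≠ m, permOp i S (Equiv.swap q ℓ) g w) := by
    intro g
    simp [swapSum, muPi]
  rw [h0, h0, muPi_inr _ hwl, muPi_inr _ hwl, key w r' hwm]
  congr 2
  · congr 3
    funext r2
    rw [key _ r' (by simpa [hne.symm] using hwm)]
  · congr 1
    · change S _ (g _) = S _ (g' _)
      rw [key _ r (by simpa using hwl)]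
    · refine Finset.sum_congr rfl fun q hq => ?_
      simp only [Finset.mem_filter, Finset.mem_univ, true_and] at hq
      change S _ (g _) = S _ (g' _)
      rw [key _ r' (by simpa [Equiv.swap_apply_of_ne_of_ne (Ne.symm hq.2) hne.symm] using hwm)]

theorem comm_head_head [IsEmpty (i ⟶ i)] (hR : Satisfies lam ν E S X) {f : Word n i → V}
    (hf : f ∈ reflectionSubmodule i E X) (a b : RArrow i) {ℓ m : Fin n} (hne : ℓ ≠ m)
    {w : Word n i} {r r' : RArrow i} (hwl : w ℓ = .inr r) (hwm : w m = .inr r') :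
    CommAt lam ν i S X a.1 b.1 ℓ m f w := by
  unfold CommAt
  rw [if_neg (ne_star a b), add_zero, edge_head, edge_head, theta_theta a b f hne hwl hwm,
    theta_theta b a f hne.symm hwm hwl, ← tauIncl_comm a b hne, Equiv.swap_comm ℓ m]
  set h := tauIncl (k := k) i a ℓ (tauIncl (k := k) i b m f) with hh
  have h1 := muPi_swap_comm hR (h := h) (fun w => tauIncl_supp
    (fun w => tauIncl_supp (fun w => memE hf w) b m w) a ℓ w) hne hwl hwm
  have h2 := alg_identity (-lam i) ν (swapSum_muPi (i := i) hR hne)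
    (swapSum_muPi (i := i) hR hne.symm) (swapSum_comm hR hne)
  have h3 := congrFun (congrArg (fun F : Module.End k (Word n i → V) => F h) h2) w
  simp only [LinearMap.sub_apply, Pi.sub_apply, LinearMap.add_apply (muPi _ _ _ * muPi _ _ _),
    Pi.add_apply, LinearMap.smul_apply, Pi.smul_apply, Module.End.mul_apply (muPi _ _ _),
    Module.End.mul_apply (permOp _ _ _)] at h3
  rw [h1, sub_self, sub_eq_zero] at h3
  exact h3

end relTwo
end
end WreathReflection

namespace WreathReflection
noncomputable section
universe uI uQ uk uV

section functor

variable {I : Type uI} [Quiver.{uQ} I] [Fintype I] [Fintype (Quiver.Total I)]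
  {k : Type uk} [CommRing k] {n : ℕ} {lam : I → k} {ν : k} {i : I}
  {V : Type uV} [AddCommGroup V] [Module k V]
  {E : (Fin n → I) → Module.End k V} {S : Equiv.Perm (Fin n) → Module.End k V}
  {X : DArrow I → Fin n → Module.End k V}

theorem letter_ne {w : Word n i} {ℓ : Fin n} {v : I} (hv : v ≠ i) (h : w.vertex ℓ = v) :
    w ℓ = .inl v := by
  rw [Word.vertex_apply] at h
  rcases hw : w ℓ with v' | r
  · rw [hw] at h; exact congrArg _ h
  · rw [hw] at h; exact absurd h.symm hv

theorem letter_eq {w : Word n i} {ℓ : Fin n} (h : w.vertex ℓ = i) :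
    w ℓ = .inl i ∨ ∃ r, w ℓ = .inr r := by
  rw [Word.vertex_apply] at h
  rcases hw : w ℓ with v' | r
  · rw [hw] at h; exact .inl (congrArg _ h)
  · exact .inr ⟨r, rfl⟩

theorem comm_zero [IsEmpty (i ⟶ i)] (hR : Satisfies lam ν E S X) {f : Word n i → V}
    (hf : f ∈ reflectionSubmodule i E X) (a b : DArrow I) {ℓ m : Fin n}
    {w : Word n i} {p : Fin n} (hw : w p = .inl i) : CommAt lam ν i S X a b ℓ m f w := by
  unfold CommAt
  rw [memZ (edge_mem hR (edge_mem hR hf b m) a ℓ) hw,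
    memZ (edge_mem hR (edge_mem hR hf a ℓ) b m) hw,
    show S (Equiv.swap ℓ m) (f (w ∘ Equiv.swap ℓ m)) = 0 from
      memZ (perm_mem hR hf (Equiv.swap ℓ m)) hw]
  simp

theorem comm_at [IsEmpty (i ⟶ i)] (hR : Satisfies lam ν E S X) {f : Word n i → V}
    (hf : f ∈ reflectionSubmodule i E X) (a b : DArrow I) {ℓ m : Fin n} (hne : ℓ ≠ m)
    {w : Word n i} (hl : w.vertex ℓ = head a) (hm : w.vertex m = head b) :
    CommAt lam ν i S X a b ℓ m f w := by
  rcases arrow_cases i a with ⟨r, rfl⟩ | ⟨r, rfl⟩ | ⟨h, h'⟩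
  · rw [r.2] at hl
    rcases letter_eq hl with hl | ⟨r1, hl⟩
    · exact comm_zero hR hf _ _ hl
    rcases arrow_cases i b with ⟨r', rfl⟩ | ⟨r', rfl⟩ | ⟨g, g'⟩
    · rw [r'.2] at hm
      rcases letter_eq hm with hm | ⟨r2, hm⟩
      · exact comm_zero hR hf _ _ hm
      · exact comm_head_head hR hf r r' hne hl hm
    · rw [head_star] at hm
      exact comm_head_tail r r' hne hl (letter_ne (tail_ne r') hm)
    · exact comm_head_arrow hR hf r g g' hne hl (letter_ne g hm)
  · rw [head_star] at hl
    have hl := letter_ne (tail_ne r) hl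
    rcases arrow_cases i b with ⟨r', rfl⟩ | ⟨r', rfl⟩ | ⟨g, g'⟩
    · rw [r'.2] at hm
      rcases letter_eq hm with hm | ⟨r2, hm⟩
      · exact comm_zero hR hf _ _ hm
      · exact (comm_head_tail r' r hne.symm hm hl).symm
    · rw [head_star] at hm
      exact comm_tail_tail r r' hne hl (letter_ne (tail_ne r') hm)
    · exact comm_tail_arrow r g g' hne hl (letter_ne g hm)
  · have hl := letter_ne h hl
    rcases arrow_cases i b with ⟨r', rfl⟩ | ⟨r', rfl⟩ | ⟨g, g'⟩
    · rw [r'.2] at hm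
      rcases letter_eq hm with hm | ⟨r2, hm⟩
      · exact comm_zero hR hf _ _ hm
      · exact (comm_head_arrow hR hf r' h h' hne.symm hm hl).symm
    · rw [head_star] at hm
      exact (comm_tail_arrow r' h h' hne.symm (letter_ne (tail_ne r') hm) hl).symm
    · exact comm_arrow_arrow hR hf h h' g g' hne hl (letter_ne g hm)

theorem rel_one_at [IsEmpty (i ⟶ i)] (hR : Satisfies lam ν E S X) {f : Word n i → V}
    (hf : f ∈ reflectionSubmodule i E X) (ℓ : Fin n) (w : Word n i) :
    ∑ a : DArrow I, sgn a • edgeOp lam ν i S X a ℓ (edgeOp lam ν i S X (star a) ℓ f) w =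
      reflect i lam (w.vertex ℓ) • f w + ν • ∑ m with m ≠ ℓ ∧ w.vertex m = w.vertex ℓ,
        S (Equiv.swap ℓ m) (f (w ∘ Equiv.swap ℓ m)) := by
  by_cases h : w.vertex ℓ = i
  · rcases letter_eq h with hw | ⟨r, hw⟩
    · have h2 : ∀ m, S (Equiv.swap ℓ m) (f (w ∘ Equiv.swap ℓ m)) = 0 := fun m =>
        memZ (perm_mem hR hf (Equiv.swap ℓ m)) hw
      have h3 : ∀ a, edgeOp lam ν i S X a ℓ (edgeOp lam ν i S X (star a) ℓ f) w = 0 := fun a =>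
        memZ (edge_mem hR (edge_mem hR hf _ ℓ) a ℓ) hw
      simp [h2, h3, memZ hf hw]
    · rw [h]; exact rel_one_self hf hw
  · exact rel_one_ne hR hf h (letter_ne h rfl)

theorem idem_apply (j : Fin n → I) (f : Word n i → V) (w : Word n i) :
    idemOp (k := k) i j f w = if w.vertex = j then f w else 0 := rfl

theorem idem_apply_self (f : Word n i → V) (w : Word n i) :
    idemOp (k := k) i w.vertex f w = f w := if_pos rfl

theorem idem_apply_ne {j : Fin n → I} (f : Word n i → V) {w : Word n i} (h : w.vertex ≠ j) :
    idemOp (k := k) i j f w = 0 := if_neg h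

theorem edge_edge_idem_zero [IsEmpty (i ⟶ i)] {a b : DArrow I} {ℓ m : Fin n} {f : Word n i → V}
    {j : Fin n → I} {w : Word n i}
    (hw : w.vertex = Function.update (Function.update j m (head b)) ℓ (head a) → False)
    (h : Function.update j m (head b) ℓ = tail a) :
    edgeOp lam ν i S X a ℓ (edgeOp lam ν i S X b m (idemOp (k := k) i j f)) w = 0 := by
  by_cases hb : j m = tail b
  · rw [edge_idem b m f j hb, edge_idem a ℓ _ _ h]
    exact idem_apply_ne _ hw
  · rw [edge_idem_ne b m f j hb, map_zero, Pi.zero_apply]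

theorem edge_star_idem_zero [IsEmpty (i ⟶ i)] {a : DArrow I} {ℓ : Fin n} {f : Word n i → V}
    {j : Fin n → I} {w : Word n i} (hw : w.vertex ≠ j) :
    edgeOp lam ν i S X a ℓ (edgeOp lam ν i S X (star a) ℓ (idemOp (k := k) i j f)) w = 0 := by
  by_cases hj : j ℓ = head a
  · refine edge_edge_idem_zero (fun h => hw ?_) (by simp)
    rw [h, Function.update_idem, ← hj, Function.update_eq_self]
  · rw [edge_idem_ne (star a) ℓ f j (by simpa using hj), map_zero, Pi.zero_apply]

theorem rel_one_reflection [IsEmpty (i ⟶ i)] (hR : Satisfies lam ν E S X) {f : Word n i → V}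
    (hf : f ∈ reflectionSubmodule i E X) (ℓ : Fin n) (j : Fin n → I) :
    ∑ a : DArrow I, sgn a • edgeOp lam ν i S X a ℓ
        (edgeOp lam ν i S X (star a) ℓ (idemOp (k := k) i j f)) =
      reflect i lam (j ℓ) • idemOp (k := k) i j f + ν • ∑ m with m ≠ ℓ ∧ j m = j ℓ,
        permOp i S (Equiv.swap ℓ m) (idemOp (k := k) i j f) := by
  ext w
  have hs : ∀ m, permOp i S (Equiv.swap ℓ m) (idemOp (k := k) i j f) w =
      S (Equiv.swap ℓ m) (idemOp (k := k) i j f (w ∘ Equiv.swap ℓ m)) := fun m => rfl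
  simp only [Finset.sum_apply, Pi.smul_apply, Pi.add_apply, hs]
  by_cases hw : w.vertex = j
  · subst hw
    exact rel_one_at hR (idem_mem hf w.vertex) ℓ w
  · rw [Finset.sum_eq_zero, idem_apply_ne _ hw, smul_zero, zero_add, Finset.sum_eq_zero, smul_zero]
    · intro m hm
      simp only [Finset.mem_filter, Finset.mem_univ, true_and] at hm
      rw [idem_apply_ne, map_zero]
      intro h
      apply hw
      rw [Word.vertex_comp] at h
      rw [← comp_swap_of_eq j hm.2.symm, ← h]
      ext p
      simp
    · intro a _
      rw [edge_star_idem_zero hw, smul_zero]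

theorem rel_two_reflection [IsEmpty (i ⟶ i)] (hR : Satisfies lam ν E S X) {f : Word n i → V}
    (hf : f ∈ reflectionSubmodule i E X) {ℓ m : Fin n} (hne : ℓ ≠ m) (a b : DArrow I)
    (j : Fin n → I) (ha : j ℓ = tail a) (hb : j m = tail b) :
    edgeOp lam ν i S X a ℓ (edgeOp lam ν i S X b m (idemOp (k := k) i j f)) -
      edgeOp lam ν i S X b m (edgeOp lam ν i S X a ℓ (idemOp (k := k) i j f)) =
      (if a = star b then (sgn b : k) * ν else 0) •
        permOp i S (Equiv.swap ℓ m) (idemOp (k := k) i j f) := by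
  ext w
  have hs : permOp i S (Equiv.swap ℓ m) (idemOp (k := k) i j f) w =
      S (Equiv.swap ℓ m) (idemOp (k := k) i j f (w ∘ Equiv.swap ℓ m)) := rfl
  simp only [Pi.sub_apply, Pi.smul_apply, hs]
  by_cases hw : w.vertex = Function.update (Function.update j m (head b)) ℓ (head a)
  · have h := comm_at hR (idem_mem hf j) a b hne (w := w) (by rw [hw]; simp)
      (by rw [hw]; simp [hne.symm])
    unfold CommAt at h
    rw [h, add_sub_cancel_left]
    split_ifs
    · rw [mul_comm, mul_smul]
      congr 1
      rw [Int.cast_smul_eq_zsmul]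
    · rw [zero_smul]
  · rw [edge_edge_idem_zero hw (by simpa [hne] using ha), edge_edge_idem_zero
      (fun h => hw (by rw [h, Function.update_comm hne])) (by simpa [hne.symm] using hb), sub_self]
    split_ifs with hab
    · rw [idem_apply_ne, map_zero, smul_zero]
      intro h
      apply hw
      subst hab
      have h2 : w.vertex = j ∘ Equiv.swap ℓ m := by
        rw [← h, Word.vertex_comp]; ext p; simp
      rw [h2, comp_swap_eq_update j hne, ha, hb, Function.update_comm hne, head_star, tail_star]
    · rw [zero_smul]

/-- `idemOp` on `F_i(V)`. -/
def idemR (lam : I → k) (ν : k) (i : I) (_hR : Satisfies lam ν E S X) (j : Fin n → I) :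
    Module.End k (reflectionSubmodule i E X) :=
  (idemOp i j).restrict fun _ hf => idem_mem hf j

/-- `permOp` on `F_i(V)`. -/
def permR (lam : I → k) (ν : k) (i : I) (hR : Satisfies lam ν E S X) (σ : Equiv.Perm (Fin n)) :
    Module.End k (reflectionSubmodule i E X) :=
  (permOp i S σ).restrict fun _ hf => perm_mem hR hf σ

/-- `edgeOp` on `F_i(V)`. -/
def edgeR (lam : I → k) (ν : k) (i : I) [IsEmpty (i ⟶ i)] (hR : Satisfies lam ν E S X)
    (a : DArrow I) (ℓ : Fin n) : Module.End k (reflectionSubmodule i E X) :=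
  (edgeOp lam ν i S X a ℓ).restrict fun _ hf => edge_mem hR hf a ℓ

theorem idemR_coe (hR : Satisfies lam ν E S X) (j : Fin n → I) (f : reflectionSubmodule i E X) :
    (idemR lam ν i hR j f : Word n i → V) = idemOp (k := k) i j f := rfl

theorem permR_coe (hR : Satisfies lam ν E S X) (σ : Equiv.Perm (Fin n))
    (f : reflectionSubmodule i E X) :
    (permR lam ν i hR σ f : Word n i → V) = permOp i S σ f := rfl

theorem edgeR_coe [IsEmpty (i ⟶ i)] (hR : Satisfies lam ν E S X) (a : DArrow I) (ℓ : Fin n)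
    (f : reflectionSubmodule i E X) :
    (edgeR lam ν i hR a ℓ f : Word n i → V) = edgeOp lam ν i S X a ℓ f := rfl

/-- The operators on `F_i(V)` satisfy the relations for the parameters `r_i λ`, `ν`. -/
theorem satisfies_reflection [IsEmpty (i ⟶ i)] (hR : Satisfies lam ν E S X) :
    Satisfies (reflect i lam) ν (idemR lam ν i hR) (permR lam ν i hR) (edgeR lam ν i hR) := by
  intro p q h
  cases h with
  | idem_self j =>
    ext f w
    change idemOp (k := k) i j (idemOp (k := k) i j f.1) w = idemOp (k := k) i j f.1 w
    rw [idem_apply, idem_apply]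
    split_ifs <;> rfl
  | idem_ne j j' h =>
    ext f w
    change idemOp (k := k) i j (idemOp (k := k) i j' f.1) w = 0
    rw [idem_apply, idem_apply]
    split_ifs with h1 h2
    · exact absurd (h1.symm.trans h2) h
    · rfl
    · rfl
  | idem_sum =>
    ext f w
    simp [idemR_coe, idem_apply]
  | perm_one =>
    ext f w
    exact S_one hR _
  | perm_mul σ τ =>
    refine LinearMap.ext fun f => Subtype.ext ?_
    exact congrArg (fun F : Module.End k (Word n i → V) => F f.1) (permOp_mul hR σ τ).symm
  | perm_idem σ j =>
    ext f w
    change S σ (idemOp (k := k) i j f.1 (w ∘ σ)) =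
      idemOp (k := k) i (j ∘ ⇑σ⁻¹) (permOp i S σ f.1) w
    have : Word.vertex (w ∘ σ) = j ↔ w.vertex = j ∘ ⇑σ⁻¹ := by
      rw [Word.vertex_comp]
      constructor
      · rintro rfl; ext p; simp
      · intro h; rw [h]; ext p; simp
    rw [idem_apply, idem_apply]
    by_cases h : w.vertex = j ∘ ⇑σ⁻¹
    · rw [if_pos h, if_pos (this.2 h)]; rfl
    · rw [if_neg h, if_neg (fun h' => h (this.1 h')), map_zero]
  | perm_arrow σ a ℓ =>
    refine LinearMap.ext fun f => Subtype.ext ?_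
    exact perm_edge hR σ a ℓ f.1
  | arrow_idem a ℓ j h =>
    refine LinearMap.ext fun f => Subtype.ext ?_
    exact edge_idem a ℓ f.1 j h
  | arrow_idem_ne a ℓ j h =>
    refine LinearMap.ext fun f => Subtype.ext ?_
    exact edge_idem_ne a ℓ f.1 j h
  | rel_one ℓ j =>
    refine LinearMap.ext fun f => Subtype.ext ?_
    have h := rel_one_reflection hR f.2 ℓ j
    rw [Fintype.sum_sum_type, ← Finset.sum_add_distrib] at h
    simp only [Module.End.mul_apply, LinearMap.sub_apply, LinearMap.smul_apply,
      LinearMap.sum_apply, Submodule.coe_sub, Submodule.coe_smul, Submodule.coe_sum, edgeR_coe,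
      idemR_coe, permR_coe]
    rw [sub_eq_iff_eq_add', ← h]
    refine Finset.sum_congr rfl fun a _ => ?_
    simp [sgn, star, sub_eq_add_neg]
  | rel_two ℓ m hne a b j ha hb =>
    refine LinearMap.ext fun f => Subtype.ext ?_
    exact rel_two_reflection hR f.2 hne a b j ha hb

end functor
end
end WreathReflection

namespace WreathReflection
noncomputable section
universe uI uQ uk uV

section functor

variable {I : Type uI} [Quiver.{uQ} I] [Fintype I] [Fintype (Quiver.Total I)]
  {k : Type uk} [CommRing k] (n : ℕ) (lam : I → k) (ν : k) (i : I)
  (V : Type uV) [AddCommGroup V] [Module k V] [Module (WreathAlg n lam ν) V]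
  [IsScalarTower k (WreathAlg n lam ν) V]

/-- The operator by which an element of `𝒜_{n,λ,ν}` acts on the module `V`. -/
abbrev act : WreathAlg n lam ν →ₐ[k] Module.End k V := Algebra.lsmul k k V

/-- The operators by which the generators of `𝒜_{n,λ,ν}` act on `V` satisfy the relations. -/
theorem satisfies_act : Satisfies lam ν (fun j => act n lam ν V (WreathAlg.e lam ν j))
    (fun σ => act n lam ν V (WreathAlg.s lam ν σ))
    (fun a ℓ => act n lam ν V (WreathAlg.x lam ν a ℓ)) := by
  intro P Q h
  obtain ⟨p, q, h', rfl, rfl⟩ := Rel.exists_preimage (k' := k) (act n lam ν V) h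
  rw [WreathAlg.rel h']

/-- The space `F_i(V)` for an `𝒜_{n,λ,ν}`-module `V`. -/
def Reflection : Type (max uI uQ uV) :=
  reflectionSubmodule (k := k) i (fun j : Fin n → I => act n lam ν V (WreathAlg.e lam ν j))
    (fun a ℓ => act n lam ν V (WreathAlg.x lam ν a ℓ))

instance : AddCommGroup (Reflection n lam ν i V) :=
  inferInstanceAs (AddCommGroup (reflectionSubmodule (k := k) i _ _))
instance : Module k (Reflection n lam ν i V) :=
  inferInstanceAs (Module k (reflectionSubmodule (k := k) i _ _))

variable {n lam ν i V}

/-- An element of `F_i(V)` is a family of elements of `V` indexed by the words. -/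
def Reflection.val (f : Reflection n lam ν i V) : Word n i → V := Subtype.val f

variable (n lam ν i V)

/-- The homomorphism from `𝒜_{n,r_iλ,ν}` to the linear operators on `F_i(V)`: `|_j` acts by the
projection to `V'_j`, `σ ∈ S_n` by the sum of the maps `σ|_j`, and `a_ℓ` by `a'_ℓ`. -/
def Reflection.actHom [IsEmpty (i ⟶ i)] : WreathAlg n (reflect i lam) ν →ₐ[k]
    Module.End k (Reflection n lam ν i V) :=
  WreathAlg.lift (S := Module.End k (reflectionSubmodule (k := k) i _ _))
    (idemR lam ν i (satisfies_act n lam ν V)) (permR lam ν i (satisfies_act n lam ν V))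
    (edgeR lam ν i (satisfies_act n lam ν V)) (satisfies_reflection (satisfies_act n lam ν V))

/-- `F_i(V)` is an `𝒜_{n,r_iλ,ν}`-module. -/
instance [IsEmpty (i ⟶ i)] : Module (WreathAlg n (reflect i lam) ν) (Reflection n lam ν i V) :=
  Module.compHom (Reflection n lam ν i V) (Reflection.actHom n lam ν i V).toRingHom

instance [IsEmpty (i ⟶ i)] :
    IsScalarTower k (WreathAlg n (reflect i lam) ν) (Reflection n lam ν i V) where
  smul_assoc c a v := congrArg (fun f : Module.End k (Reflection n lam ν i V) => f v)
    (map_smul (Reflection.actHom n lam ν i V) c a)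

variable {n lam ν i V}

theorem Reflection.e_smul_val [IsEmpty (i ⟶ i)] (j : Fin n → I) (f : Reflection n lam ν i V) :
    (WreathAlg.e (reflect i lam) ν j • f).val = idemOp (k := k) i j f.val :=
  congrArg (fun F : Module.End k (reflectionSubmodule (k := k) i _ _) => (F f).1)
    (WreathAlg.lift_e _ _ _ (satisfies_reflection (satisfies_act n lam ν V)) j)

theorem Reflection.s_smul_val [IsEmpty (i ⟶ i)] (σ : Equiv.Perm (Fin n))
    (f : Reflection n lam ν i V) : (WreathAlg.s (reflect i lam) ν σ • f).val =
      permOp i (fun σ => act n lam ν V (WreathAlg.s lam ν σ)) σ f.val :=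
  congrArg (fun F : Module.End k (reflectionSubmodule (k := k) i _ _) => (F f).1)
    (WreathAlg.lift_s _ _ _ (satisfies_reflection (satisfies_act n lam ν V)) σ)

theorem Reflection.x_smul_val [IsEmpty (i ⟶ i)] (a : DArrow I) (ℓ : Fin n)
    (f : Reflection n lam ν i V) : (WreathAlg.x (reflect i lam) ν a ℓ • f).val =
      edgeOp lam ν i (fun σ => act n lam ν V (WreathAlg.s lam ν σ))
        (fun a ℓ => act n lam ν V (WreathAlg.x lam ν a ℓ)) a ℓ f.val :=
  congrArg (fun F : Module.End k (reflectionSubmodule (k := k) i _ _) => (F f).1)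
    (WreathAlg.lift_x _ _ _ (satisfies_reflection (satisfies_act n lam ν V)) a ℓ)

variable (n lam ν i V)

/-- The set `Λ_i` of all `(λ, ν)` such that `λ_i ± ν ∑_{m=2}^r s_{1m}` are invertible in `k[S_r]`
for all `r ∈ [1, n]` (here `r` is replaced by `r + 1` with `r < n`, and `1, …, r` by `0, …, r`). -/
def Lambda : Set ((I → k) × k) :=
  {p | ∀ r < n,
    IsUnit (algebraMap k (MonoidAlgebra k (Equiv.Perm (Fin (r + 1)))) (p.1 i) +
      p.2 • ∑ m : Fin r, MonoidAlgebra.of k _ (Equiv.swap 0 m.succ)) ∧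
    IsUnit (algebraMap k (MonoidAlgebra k (Equiv.Perm (Fin (r + 1)))) (p.1 i) -
      p.2 • ∑ m : Fin r, MonoidAlgebra.of k _ (Equiv.swap 0 m.succ))}

/-- The reflection on parameters commutes with a change of rings. -/
theorem algebraMap_reflect (k' : Type*) [CommRing k'] [Algebra k k'] :
    (fun j => algebraMap k k' (reflect i lam j)) = reflect i (fun j => algebraMap k k' (lam j)) := by
  ext j
  simp [reflect]

end functor
end
end WreathReflection

/-! The space `F_i(V)` is cut out by kernels, and kernels do not commute with tensor products in
general. For parameters in `Lambda`, however, `F_i(V)` is a direct summand of the space of all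
families on words, and a projection onto it can be written using only the operators `π`, `μ`, the
action of the symmetric group, the idempotents and scalars from `k`. Such a formula makes sense for
every module and commutes with every homomorphism. In particular it commutes with the maps `v ↦ c ⊗
v`, and a summand split off by such a projection survives any change of rings.

The projection is built for a fixed set `D` of positions with letters in `R`, by adding one position
at a time to the set `A` of those `q` for which `π_q` has been made to vanish. Let `P` project onto
the common kernel of the `π_q` with `q ∈ A`, let `p` be a new position, and put `g = π_p P f`. The
family `g` lives on words whose only letter `i` is at `p`, and `π_q g = 0` for `q ∈ A`, because the
`π`'s commute (`piOp_comm`). The two defining relations give `π_p μ_p g = λ_i g` (`piOp_muOp_self`)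
and `π_q μ_p g = -ν s_{pq} g` for `q ∈ A` (`piOp_muOp_ne`).

These are the pieces of `J g` with letter `i` at `p` and at `q` respectively, where `J = λ_i - ν
∑_{q ∈ A} s_{pq}` (`piOp_muOp_eq`). By equivariance the same holds with an element `c` of the group
algebra in front: `π_q (c μ_p g)` is the piece of `c J g` with letter `i` at `q`
(`piOp_groupAlgHom_muOp`). If `c J = 1`, this piece is `g` for `q = p` and `0` for `q ∈ A`.
Therefore `P - c μ_p π_p P` projects onto the kernel for `A ∪ {p}` (`ProjectsToKer.insert`). The
condition defining `Lambda` provides such a `c` at every stage.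

Summing over all `D` gives projections for `V` and for `k' ⊗ V` by one and the same recipe
(`exists_projectsToReflection`). The projection on `V` makes the natural map split injective
(`tensorFamily_injective`). The compatibility of the two projections makes it surjective
(`exists_tensorFamily_eq`): a family in `F_i(V ⊗ k')` is its own projection, and the projection of a
pure tensor is a pure tensor with second factor in `F_i(V)`. Compatibility with the algebra actions
is checked on generators (`reflectionBaseChange_smul`). -/

namespace WreathReflection
noncomputable section
universe uI uQ uk uV

/-! ## A natural projection onto `F_i(V)` -/

/-! ### The operators `π` and `μ` on families with prescribed support. -/

section support

variable {I : Type uI} [Quiver.{uQ} I] [Fintype I] [Fintype (Quiver.Total I)]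
  {k : Type uk} [CommRing k] {n : ℕ} {lam : I → k} {ν : k} {i : I}
  {V : Type uV} [AddCommGroup V] [Module k V]
  {E : (Fin n → I) → Module.End k V} {S : Equiv.Perm (Fin n) → Module.End k V}
  {X : DArrow I → Fin n → Module.End k V}

/-- The families `f` with `f w ∈ V_{t(w)}` that are supported on the words `w` with letters in `R`
exactly at the positions in `D`, and with letter `i` exactly at the positions in `Z`. -/
def wordSupport (i : I) (E : (Fin n → I) → Module.End k V) (D Z : Finset (Fin n)) :
    Submodule k (Word n i → V) where
  carrier := {f | (∀ w, E w.tail (f w) = f w) ∧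
    ∀ w, f w ≠ 0 → ∀ m, (m ∈ D ↔ (w m).isRight) ∧ (m ∈ Z ↔ w m = .inl i)}
  add_mem' {f g} hf hg := ⟨fun w => by simp [hf.1 w, hg.1 w], fun w h => by
    by_cases hfw : f w = 0
    · exact hg.2 w (by simpa [hfw] using h)
    · exact hf.2 w hfw⟩
  zero_mem' := by simp
  smul_mem' c f hf := ⟨fun w => by simp [hf.1 w],
    fun w h => hf.2 w fun h' => h (by simp [h'])⟩

theorem wordSupport_eq_zero {D Z : Finset (Fin n)} {f : Word n i → V}
    (hf : f ∈ wordSupport i E D Z) {w : Word n i} {m : Fin n}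
    (h : ¬ ((m ∈ D ↔ (w m).isRight) ∧ (m ∈ Z ↔ w m = .inl i))) : f w = 0 := by
  by_contra h'
  exact h (hf.2 w h' m)

theorem piOp_apply_inl (f : Word n i → V) {w : Word n i} {p : Fin n} (h : w p = .inl i) :
    piOp i X p f w = ∑ r : RArrow i, X r.1 p (f (Function.update w p (.inr r))) := by
  simp [piOp, h]

theorem piOp_apply_ne (f : Word n i → V) {w : Word n i} {p : Fin n} (h : w p ≠ .inl i) :
    piOp i X p f w = 0 := by
  simp [piOp, h]

theorem muOp_apply_inr (f : Word n i → V) {w : Word n i} {p : Fin n} {r : RArrow i}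
    (h : w p = .inr r) :
    muOp i X p f w = sgn r.1 • X (star r.1) p (f (Function.update w p (.inl i))) := by
  simp [muOp, h]

theorem muOp_apply_inl (f : Word n i → V) {w : Word n i} {p : Fin n} {v : I} (h : w p = .inl v) :
    muOp i X p f w = 0 := by
  simp [muOp, h]

theorem permOp_apply (σ : Equiv.Perm (Fin n)) (f : Word n i → V) (w : Word n i) :
    permOp i S σ f w = S σ (f (w ∘ σ)) := rfl

/-- An arrow of `R` has head `i`, so applying it at `p` lands in the component of the word with
letter `i` at `p`. The letters at the other positions are untouched. -/
theorem piOp_mem_wordSupport (hR : Satisfies lam ν E S X) {D : Finset (Fin n)} {p : Fin n}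
    {f : Word n i → V} (hf : f ∈ wordSupport i E D ∅) :
    piOp i X p f ∈ wordSupport i E (D.erase p) {p} := by
  constructor
  · intro w
    by_cases hw : w p = .inl i
    · rw [piOp_apply_inl f hw, map_sum]
      refine Finset.sum_congr rfl fun r _ => E_X hR (hf.1 _) r.1 p ?_ ?_
      · simp [Word.tail_update]
      · rw [Word.tail_update, Function.update_idem, eq_comm, Function.update_eq_self_iff,
          Word.tail_apply, hw, r.2]; rfl
    · rw [piOp_apply_ne f hw, map_zero]
  · intro w h m
    have hw : w p = .inl i := by
      by_contra hw
      exact h (piOp_apply_ne f hw)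
    rw [piOp_apply_inl f hw] at h
    obtain ⟨r, _, hr⟩ := Finset.exists_ne_zero_of_sum_ne_zero h
    have := hf.2 _ (fun h0 => hr (by rw [h0, map_zero])) m
    by_cases hm : m = p
    · subst hm; simp [hw]
    · simpa [hm] using this

/-- The reversed arrow `r*` leads from `i` to the tail of `r`, so the letter `i` at `p` is exchanged
for a letter of `R`, and `p` returns to the set of positions with letters in `R`. -/
theorem muOp_mem_wordSupport (hR : Satisfies lam ν E S X) {D : Finset (Fin n)} {p : Fin n}
    (hp : p ∈ D) {g : Word n i → V} (hg : g ∈ wordSupport i E (D.erase p) {p}) :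
    muOp i X p g ∈ wordSupport i E D ∅ := by
  constructor
  · intro w
    rcases hw : w p with v | r
    · rw [muOp_apply_inl g hw, map_zero]
    · rw [muOp_apply_inr g hw, map_zsmul]
      congr 1
      refine E_X hR (hg.1 _) _ p ?_ ?_
      · simp [Word.tail_update, r.2]
      · rw [Word.tail_update, Function.update_idem, eq_comm, Function.update_eq_self_iff,
          Word.tail_apply, hw, head_star]; rfl
  · intro w h m
    rcases hw : w p with v | r
    · exact absurd (muOp_apply_inl g hw) h
    · rw [muOp_apply_inr g hw] at h
      have := hg.2 _ (fun h0 => h (by rw [h0, map_zero, smul_zero])) m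
      by_cases hm : m = p
      · subst hm; simp [hw, hp]
      · simpa [hm] using this

theorem permOp_mem_wordSupport (hR : Satisfies lam ν E S X) {D : Finset (Fin n)}
    {σ : Equiv.Perm (Fin n)} (hσ : ∀ m, σ m ∈ D ↔ m ∈ D) {f : Word n i → V}
    (hf : f ∈ wordSupport i E D ∅) : permOp i S σ f ∈ wordSupport i E D ∅ := by
  refine ⟨fun w => E_S hR (hf.1 (w ∘ σ)) σ rfl, fun w h m => ?_⟩
  have := hf.2 _ (fun h0 => h (by rw [permOp_apply, h0, map_zero])) (σ⁻¹ m)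
  rw [← hσ (σ⁻¹ m)] at this
  simpa using this

/-- This equivariance is the relation `σ a_q = a_{σ(q)} σ`, summed over the arrows of `R`. It is
what allows elements of the group algebra to be moved past `π`. -/
theorem piOp_permOp (hR : Satisfies lam ν E S X) (σ : Equiv.Perm (Fin n)) (q : Fin n)
    (f : Word n i → V) : piOp i X (σ q) (permOp i S σ f) = permOp i S σ (piOp i X q f) := by
  ext w
  rw [permOp_apply]
  by_cases hw : w (σ q) = .inl i
  · rw [piOp_apply_inl _ hw, piOp_apply_inl f (w := w ∘ σ) hw, map_sum]
    refine Finset.sum_congr rfl fun r _ => ?_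
    rw [S_X hR, permOp_apply, update_comp_perm]
  · rw [piOp_apply_ne _ hw, piOp_apply_ne f (w := w ∘ σ) hw, map_zero]

/-- Two arrows with head `i` are never opposite to each other, because `i` carries no loop. The
second relation therefore has no correction term for them. -/
theorem piOp_comm [IsEmpty (i ⟶ i)] (hR : Satisfies lam ν E S X) {f : Word n i → V}
    (hf : ∀ w, E w.tail (f w) = f w) {p q : Fin n} (hne : p ≠ q) :
    piOp i X p (piOp i X q f) = piOp i X q (piOp i X p f) := by
  ext w
  by_cases hp : w p = .inl i
  · by_cases hq : w q = .inl i
    · rw [piOp_apply_inl _ hp, piOp_apply_inl _ hq]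
      have h1 : ∀ r : RArrow i, Function.update w p (.inr r) q = .inl i := fun r => by
        simpa [hne.symm] using hq
      have h2 : ∀ r : RArrow i, Function.update w q (.inr r) p = .inl i := fun r => by
        simpa [hne] using hp
      simp_rw [piOp_apply_inl f (h1 _), piOp_apply_inl f (h2 _), map_sum]
      rw [Finset.sum_comm]
      refine Finset.sum_congr rfl fun r _ => Finset.sum_congr rfl fun r' _ => ?_
      rw [Function.update_comm hne]
      exact X_comm hR (hf _) hne _ _ (by simp [Word.tail_update])
        (by simp [Word.tail_update, hne.symm]) (ne_star _ _)
    · rw [piOp_apply_ne _ hq, piOp_apply_inl _ hp]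
      refine Finset.sum_eq_zero fun r _ => ?_
      rw [piOp_apply_ne f (by simpa [hne.symm] using hq), map_zero]
  · rw [piOp_apply_ne _ hp]
    by_cases hq : w q = .inl i
    · rw [piOp_apply_inl _ hq]
      symm
      refine Finset.sum_eq_zero fun r _ => ?_
      rw [piOp_apply_ne f (by simpa [hne] using hp), map_zero]
    · rw [piOp_apply_ne _ hq]

/-- This is the first relation at the vertex `i`. Its transposition terms are indexed by the further
positions with tail `i`, and on the support of `g` there are none. -/
theorem piOp_muOp_self [IsEmpty (i ⟶ i)] (hR : Satisfies lam ν E S X) {D : Finset (Fin n)}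
    {p : Fin n} {g : Word n i → V} (hg : g ∈ wordSupport i E D {p}) :
    piOp i X p (muOp i X p g) = lam i • g := by
  ext w
  rw [Pi.smul_apply]
  by_cases hw : w p = .inl i
  · rw [piOp_apply_inl _ hw]
    have h1 : ∀ r : RArrow i, X r.1 p (muOp i X p g (Function.update w p (.inr r))) =
        sgn r.1 • X r.1 p (X (star r.1) p (g w)) := by
      intro r
      rw [muOp_apply_inr g (r := r) (by simp), map_zsmul, Function.update_idem]
      congr 4
      rw [Function.update_eq_self_iff, hw]
    simp_rw [h1]
    rw [rel_one_R hR (hg.1 w) p (by rw [Word.tail_apply, hw]; rfl), add_eq_left]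
    convert smul_zero ν
    -- A second position with tail `i` would carry either the letter `i`, which the support of `g`
    -- excludes, or an arrow of `R` with tail `i`, which would be a loop.
    refine Finset.sum_eq_zero fun m hm => ?_
    simp only [Finset.mem_filter, Finset.mem_univ, true_and] at hm
    rw [wordSupport_eq_zero hg (m := m), map_zero]
    intro h
    have hwm : w m ≠ .inl i := fun h' => hm.1 (by simpa using h.2.2 h')
    rcases h' : w m with v | r
    · exact hwm (by rw [h', ← hm.2, Word.tail_apply, h']; rfl)
    · have h2 := hm.2
      rw [Word.tail_apply, h'] at h2
      exact tail_ne r h2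
  · rw [piOp_apply_ne _ hw, wordSupport_eq_zero hg (m := p) (by simp [hw]), smul_zero]

/-- Moving an arrow at `m` past a reversed arrow at `p` by the second relation leaves a term that
contains `π_m g = 0`, and one correction term, from the pair of opposite arrows. The correction is
the transposition of `p` and `m`. -/
theorem piOp_muOp_ne [IsEmpty (i ⟶ i)] (hR : Satisfies lam ν E S X) {D : Finset (Fin n)}
    {p m : Fin n} (hne : m ≠ p) (hm : m ∈ D) {g : Word n i → V}
    (hg : g ∈ wordSupport i E D {p}) (hgm : piOp i X m g = 0) :
    piOp i X m (muOp i X p g) = -ν • permOp i S (Equiv.swap p m) g := by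
  ext w
  rw [Pi.smul_apply, permOp_apply]
  by_cases hw : w m = .inl i
  · rw [piOp_apply_inl _ hw]
    -- Without a letter of `R` at `p` both sides vanish: `μ_p` produces nothing there, and the
    -- transposed word has no letter of `R` at `m ∈ D`.
    rcases hp : w p with v | r'
    · rw [wordSupport_eq_zero hg (m := m) (by simp [hp, hm]), map_zero, smul_zero]
      refine Finset.sum_eq_zero fun r _ => ?_
      rw [muOp_apply_inl g (v := v) (by simpa [hne.symm] using hp), map_zero]
    · have h1 : ∀ r : RArrow i, X r.1 m (muOp i X p g (Function.update w m (.inr r))) =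
          sgn r'.1 • X (star r'.1) p
            (X r.1 m (g (Function.update (Function.update w p (.inl i)) m (.inr r)))) +
          if r = r' then -ν • S (Equiv.swap p m)
            (g (Function.update (Function.update w p (.inl i)) m (.inr r'))) else 0 := by
        intro r
        rw [muOp_apply_inr g (r := r') (by simpa [hne.symm] using hp), map_zsmul,
          Function.update_comm hne,
          rel_two' hR (hg.1 _) hne r.1 (star r'.1) (by simp [Word.tail_update])
          (by simp [Word.tail_update, hne.symm, r'.2]), smul_add, star_star]
        congr 1
        -- The sign in the definition of `μ` and the sign of the reversed arrow in the relation
        -- multiply to `-1`, independently of the orientation of the arrow in `Q`.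
        by_cases h : r = r'
        · subst h
          rw [if_pos rfl, if_pos rfl, sgn_star, neg_smul, smul_neg, smul_neg, smul_comm ν,
            sgn_smul_smul, neg_smul, Equiv.swap_comm]
        · rw [if_neg h, if_neg (fun h' => h (Subtype.ext h')), smul_zero]
      simp_rw [h1]
      rw [Finset.sum_add_distrib, ← Finset.smul_sum, ← map_sum, Finset.sum_ite_eq' Finset.univ r',
        if_pos (Finset.mem_univ _), ← piOp_apply_inl g (w := Function.update w p (.inl i)) (by
          simpa [hne] using hw), hgm, Pi.zero_apply, map_zero, smul_zero, zero_add,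
        comp_swap_eq_update w hne.symm, hw, hp]
  · rw [piOp_apply_ne _ hw, wordSupport_eq_zero hg (m := p) (by simp [hw]), map_zero, smul_zero]

/-! ### Positions of the letter `i`, and the action of Jucys–Murphy elements. -/

/-- The projection to the words with letter `i` at the position `q`. -/
def fixOp (k : Type uk) [CommRing k] (i : I) (V : Type uV) [AddCommGroup V] [Module k V]
    (q : Fin n) : Module.End k (Word n i → V) where
  toFun f w := if w q = .inl i then f w else 0
  map_add' f g := by ext w; by_cases h : w q = .inl i <;> simp [h]
  map_smul' c f := by ext w; by_cases h : w q = .inl i <;> simp [h]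

theorem fixOp_apply (q : Fin n) (f : Word n i → V) (w : Word n i) :
    fixOp k i V q f w = if w q = .inl i then f w else 0 := rfl

theorem fixOp_permOp (σ : Equiv.Perm (Fin n)) (q : Fin n) (f : Word n i → V) :
    fixOp k i V (σ q) (permOp i S σ f) = permOp i S σ (fixOp k i V q f) := by
  ext w
  rw [permOp_apply, fixOp_apply, fixOp_apply, permOp_apply]
  by_cases hw : w (σ q) = .inl i
  · rw [if_pos hw, if_pos (show (w ∘ σ) q = .inl i from hw)]
  · rw [if_neg hw, if_neg (show ¬ (w ∘ σ) q = .inl i from hw), map_zero]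

/-- The only letter `i` of a word in the support of `g` is at `p`. Hence families whose letter `i`
sits at different positions can be told apart inside a sum. -/
theorem fixOp_of_mem {D : Finset (Fin n)} {p q : Fin n} {g : Word n i → V}
    (hg : g ∈ wordSupport i E D {p}) : fixOp k i V q g = if q = p then g else 0 := by
  ext w
  rw [fixOp_apply]
  by_cases hw : g w = 0
  · split_ifs <;> simp [hw]
  · have := (hg.2 w hw q).2
    rw [Finset.mem_singleton] at this
    by_cases h : q = p
    · rw [if_pos h, if_pos (this.1 h)]
    · rw [if_neg h, if_neg (fun h' => h (this.2 h'))]; rfl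

/-- The transposition carries the unique letter `i` from `p` to `m`. -/
theorem fixOp_swap {D : Finset (Fin n)} {p q m : Fin n} {g : Word n i → V}
    (hg : g ∈ wordSupport i E D {p}) : fixOp k i V q (permOp i S (Equiv.swap p m) g) =
      if q = m then permOp i S (Equiv.swap p m) g else 0 := by
  have h := fixOp_permOp (k := k) (S := S) (Equiv.swap p m) (Equiv.swap p m q) g
  rw [Equiv.swap_apply_self, fixOp_of_mem hg] at h
  rw [h]
  have : Equiv.swap p m q = p ↔ q = m := by
    rw [Equiv.swap_apply_eq_iff, Equiv.swap_apply_left]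
  by_cases hq : q = m
  · rw [if_pos hq, if_pos (this.2 hq)]
  · rw [if_neg hq, if_neg (fun h' => hq (this.1 h')), map_zero]

/-- The action of `S_n` on families indexed by words, as a homomorphism. -/
def permHom (i : I) (hR : Satisfies lam ν E S X) :
    Equiv.Perm (Fin n) →* Module.End k (Word n i → V) where
  toFun := permOp i S
  map_one' := LinearMap.ext fun _ => funext fun _ => S_one hR _
  map_mul' σ τ := (permOp_mul hR σ τ).symm

/-- The action of `k[S_{r+1}]` on families indexed by words, by permutation of the positions in the
range of `ι`. -/
def groupAlgHom {r : ℕ} (i : I) (hR : Satisfies lam ν E S X) (ι : Fin (r + 1) ↪ Fin n) :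
    MonoidAlgebra k (Equiv.Perm (Fin (r + 1))) →ₐ[k] Module.End k (Word n i → V) :=
  MonoidAlgebra.lift k _ _ ((permHom i hR).comp (Equiv.Perm.viaEmbeddingHom ι))

theorem groupAlgHom_of {r : ℕ} (hR : Satisfies lam ν E S X) (ι : Fin (r + 1) ↪ Fin n)
    (σ : Equiv.Perm (Fin (r + 1))) :
    groupAlgHom i hR ι (MonoidAlgebra.of k _ σ) = permOp i S (σ.viaEmbedding ι) :=
  MonoidAlgebra.lift_of _ _

/-- Needed to recognise the image of a Jucys–Murphy element as a sum of transpositions of positions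
in `Fin n`. -/
theorem viaEmbedding_swap {α β : Type*} [DecidableEq α] [DecidableEq β] (ι : α ↪ β) (a b : α) :
    (Equiv.swap a b).viaEmbedding ι = Equiv.swap (ι a) (ι b) := by
  ext x
  by_cases hx : x ∈ Set.range ι
  · obtain ⟨y, rfl⟩ := hx
    rw [Equiv.Perm.viaEmbedding_apply, ι.injective.map_swap]
  · rw [Equiv.Perm.viaEmbedding_apply_of_notMem _ _ _ hx, Equiv.swap_apply_of_ne_of_ne]
    · rintro rfl; exact hx ⟨a, rfl⟩
    · rintro rfl; exact hx ⟨b, rfl⟩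

/-- The element `c - ν ∑_m s_{0m}` of `k[S_{r+1}]`. -/
def jucysMurphy (c ν : k) (r : ℕ) : MonoidAlgebra k (Equiv.Perm (Fin (r + 1))) :=
  algebraMap k _ c - ν • ∑ m : Fin r, MonoidAlgebra.of k _ (Equiv.swap 0 m.succ)

theorem groupAlgHom_jucysMurphy {r : ℕ} (hR : Satisfies lam ν E S X) (ι : Fin (r + 1) ↪ Fin n)
    (c : k) (f : Word n i → V) : groupAlgHom i hR ι (jucysMurphy c ν r) f =
      c • f - ν • ∑ m : Fin r, permOp i S (Equiv.swap (ι 0) (ι m.succ)) f := by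
  simp only [jucysMurphy, map_sub, map_smul, map_sum, groupAlgHom_of, AlgHom.commutes,
    viaEmbedding_swap, LinearMap.sub_apply, LinearMap.smul_apply, LinearMap.sum_apply,
    Module.algebraMap_end_apply]

/-- The terms of the Jucys–Murphy element move the letter `i` of `g` to pairwise different
positions: the scalar keeps it at `ι 0`, and each transposition takes it to one `ι m.succ`.
Selecting a position thus selects one term, which is the value found in `piOp_muOp_self` or in
`piOp_muOp_ne`. -/
theorem piOp_muOp_eq [IsEmpty (i ⟶ i)] (hR : Satisfies lam ν E S X) {D : Finset (Fin n)} {r : ℕ}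
    (ι : Fin (r + 1) ↪ Fin n) {g : Word n i → V} (hg : g ∈ wordSupport i E D {ι 0})
    (hD : ∀ m : Fin r, ι m.succ ∈ D) (hK : ∀ m : Fin r, piOp i X (ι m.succ) g = 0)
    (q : Fin (r + 1)) : piOp i X (ι q) (muOp i X (ι 0) g) =
      fixOp k i V (ι q) (groupAlgHom i hR ι (jucysMurphy (lam i) ν r) g) := by
  rw [groupAlgHom_jucysMurphy, map_sub, map_smul, map_smul, map_sum, fixOp_of_mem hg]
  simp_rw [fixOp_swap hg]
  cases q using Fin.cases with
  | zero =>
    rw [if_pos rfl, piOp_muOp_self hR hg, Finset.sum_eq_zero, smul_zero, sub_zero]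
    intro m _
    rw [if_neg]
    exact fun h => Fin.succ_ne_zero m (ι.injective h).symm
  | succ m =>
    have h0 : ι m.succ ≠ ι 0 := fun h => Fin.succ_ne_zero m (ι.injective h)
    rw [if_neg h0, smul_zero, zero_sub, piOp_muOp_ne hR h0 (hD m) hg (hK m),
      Finset.sum_eq_single m, if_pos rfl, neg_smul]
    · intro m' _ h
      rw [if_neg]
      exact fun h' => h (Fin.succ_injective _ (ι.injective h')).symm
    · simp

/-- Both sides are linear in `c`, and for a permutation the claim follows from `piOp_muOp_eq` by
equivariance. The formula has to be known at all positions `q` simultaneously, since a permutation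
moves one into another. Taking `c` to be a left inverse makes the right side a piece of `g` itself.
-/
theorem piOp_groupAlgHom_muOp [IsEmpty (i ⟶ i)] (hR : Satisfies lam ν E S X)
    {D : Finset (Fin n)} {r : ℕ} (ι : Fin (r + 1) ↪ Fin n) {g : Word n i → V}
    (hg : g ∈ wordSupport i E D {ι 0})
    (hD : ∀ m : Fin r, ι m.succ ∈ D) (hK : ∀ m : Fin r, piOp i X (ι m.succ) g = 0)
    (c : MonoidAlgebra k (Equiv.Perm (Fin (r + 1)))) (q : Fin (r + 1)) :
    piOp i X (ι q) (groupAlgHom i hR ι c (muOp i X (ι 0) g)) =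
      fixOp k i V (ι q) (groupAlgHom i hR ι (c * jucysMurphy (lam i) ν r) g) := by
  induction c using MonoidAlgebra.induction_on with
  | of σ =>
    -- Writing the position as an image under `σ` lets both `π` and the selection of a position move
    -- past `σ`.
    have hq : ι q = σ.viaEmbedding ι (ι (σ⁻¹ q)) := by
      rw [Equiv.Perm.viaEmbedding_apply]; simp
    rw [map_mul, Module.End.mul_apply, groupAlgHom_of, hq, piOp_permOp hR, fixOp_permOp,
      piOp_muOp_eq hR ι hg hD hK]
  | add x y hx hy => simp only [add_mul, map_add, LinearMap.add_apply, hx, hy]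
  | smul b x hx => simp only [smul_mul_assoc, map_smul, LinearMap.smul_apply, hx]

/-- The permutations involved fix every position outside the range of `ι`, and the range lies in
`D`, so `D` is stable. -/
theorem groupAlgHom_mem_wordSupport (hR : Satisfies lam ν E S X) {D : Finset (Fin n)} {r : ℕ}
    (ι : Fin (r + 1) ↪ Fin n) (hD : ∀ m, ι m ∈ D)
    (c : MonoidAlgebra k (Equiv.Perm (Fin (r + 1)))) {f : Word n i → V}
    (hf : f ∈ wordSupport i E D ∅) : groupAlgHom i hR ι c f ∈ wordSupport i E D ∅ := by
  induction c using MonoidAlgebra.induction_on with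
  | of σ =>
    rw [groupAlgHom_of]
    refine permOp_mem_wordSupport hR (fun m => ?_) hf
    by_cases hm : m ∈ Set.range ι
    · obtain ⟨y, rfl⟩ := hm
      rw [Equiv.Perm.viaEmbedding_apply]
      simp [hD]
    · rw [Equiv.Perm.viaEmbedding_apply_of_notMem _ _ _ hm]
  | add x y hx hy =>
    rw [map_add, LinearMap.add_apply]
    exact add_mem hx hy
  | smul b x hx =>
    rw [map_smul, LinearMap.smul_apply]
    exact Submodule.smul_mem _ _ hx

/-! ### Projections to common kernels, one position at a time. -/

/-- On the families supported on the words with `Δ = D`, the operator `P` is a projection to the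
common kernel of the `π_q` with `q ∈ A`. -/
def ProjectsToKer (i : I) (E : (Fin n → I) → Module.End k V) (X : DArrow I → Fin n → Module.End k V)
    (D A : Finset (Fin n)) (P : Module.End k (Word n i → V)) : Prop :=
  ∀ f ∈ wordSupport i E D ∅, (P f ∈ wordSupport i E D ∅ ∧ ∀ q ∈ A, piOp i X q (P f) = 0) ∧
    ((∀ q ∈ A, piOp i X q f = 0) → P f = f)

/-- The correction `c μ_p π_p P` is chosen so that `π_p` of it equals `π_p P`, while `π_q` of it is
zero for `q ∈ A`. Subtracting it creates the new vanishing without destroying the old. It is zero on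
families already killed by all the `π`'s, so these remain fixed. -/
theorem ProjectsToKer.insert [IsEmpty (i ⟶ i)] (hR : Satisfies lam ν E S X)
    {D A : Finset (Fin n)} {P : Module.End k (Word n i → V)} (hP : ProjectsToKer i E X D A P)
    {p : Fin n} (hpA : p ∉ A) (hAD : insert p A ⊆ D) {r : ℕ} (ι : Fin (r + 1) ↪ Fin n)
    (h0 : ι 0 = p) (hA : ∀ q, q ∈ A ↔ ∃ m : Fin r, ι m.succ = q)
    {c : MonoidAlgebra k (Equiv.Perm (Fin (r + 1)))} (hc : c * jucysMurphy (lam i) ν r = 1) :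
    ProjectsToKer i E X D (insert p A)
      (P - groupAlgHom i hR ι c * muOp i X p * piOp i X p * P) := by
  intro f hf
  subst h0
  have hpD : ι 0 ∈ D := hAD (Finset.mem_insert_self _ _)
  have hD : ∀ m : Fin r, ι m.succ ∈ D := fun m =>
    hAD (Finset.mem_insert_of_mem ((hA _).2 ⟨m, rfl⟩))
  have hιD : ∀ m, ι m ∈ D := Fin.cases hpD hD
  simp only [LinearMap.sub_apply, Module.End.mul_apply]
  obtain ⟨⟨hPf, hK⟩, hfix⟩ := hP f hf
  have hg := piOp_mem_wordSupport (X := X) hR (p := ι 0) hPf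
  -- Commuting the two `π`'s reduces this to the vanishing already achieved by `P` on `A`.
  have hgK : ∀ m : Fin r, piOp i X (ι m.succ) (piOp i X (ι 0) (P f)) = 0 := fun m => by
    rw [piOp_comm hR hPf.1, hK _ ((hA _).2 ⟨m, rfl⟩), map_zero]
    exact fun h => Fin.succ_ne_zero m (ι.injective h)
  have hD' : ∀ m : Fin r, ι m.succ ∈ D.erase (ι 0) := fun m =>
    Finset.mem_erase.2 ⟨fun h => Fin.succ_ne_zero m (ι.injective h), hD m⟩
  -- With `c` a left inverse, `π_q` of the correction becomes the piece of `g = π_p (P f)` with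
  -- letter `i` at `q`.
  have key := piOp_groupAlgHom_muOp hR ι hg hD' hgK c
  rw [hc] at key
  refine ⟨⟨sub_mem hPf (groupAlgHom_mem_wordSupport hR ι hιD c (muOp_mem_wordSupport hR hpD hg)),
    fun q hq => ?_⟩, fun h => ?_⟩
  · rw [map_sub]
    rcases Finset.mem_insert.1 hq with rfl | hq
    · rw [key, map_one, Module.End.one_apply, fixOp_of_mem hg, if_pos rfl, sub_self]
    · obtain ⟨m, rfl⟩ := (hA q).1 hq
      rw [hK _ hq, key, map_one, Module.End.one_apply, fixOp_of_mem hg, if_neg, sub_zero]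
      exact fun h => Fin.succ_ne_zero m (ι.injective h)
  · rw [hfix fun q hq => h q (Finset.mem_insert_of_mem hq), h _ (Finset.mem_insert_self _ _),
      map_zero, map_zero, sub_zero]

end support
end
end WreathReflection

namespace WreathReflection
noncomputable section
universe uI uQ uk uV

/-! ### Naturality of the projections, and assembly over all `D`. -/

section naturality

variable {I : Type uI} [Quiver.{uQ} I] [Fintype I] [Fintype (Quiver.Total I)]
  {k : Type uk} [CommRing k] {n : ℕ} {lam : I → k} {ν : k} {i : I}
  {V : Type uV} [AddCommGroup V] [Module k V]
  {E : (Fin n → I) → Module.End k V} {S : Equiv.Perm (Fin n) → Module.End k V}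
  {X : DArrow I → Fin n → Module.End k V}
  {V' : Type*} [AddCommGroup V'] [Module k V']
  {E' : (Fin n → I) → Module.End k V'} {S' : Equiv.Perm (Fin n) → Module.End k V'}
  {X' : DArrow I → Fin n → Module.End k V'}

/-- A linear map that commutes with the operators for the generators of `𝒜_{n,λ,ν}`. -/
structure Intertwines (E : (Fin n → I) → Module.End k V) (S : Equiv.Perm (Fin n) → Module.End k V)
    (X : DArrow I → Fin n → Module.End k V) (E' : (Fin n → I) → Module.End k V')
    (S' : Equiv.Perm (Fin n) → Module.End k V') (X' : DArrow I → Fin n → Module.End k V')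
    (φ : V →ₗ[k] V') : Prop where
  idem : ∀ j v, φ (E j v) = E' j (φ v)
  perm : ∀ σ v, φ (S σ v) = S' σ (φ v)
  arrow : ∀ a ℓ v, φ (X a ℓ v) = X' a ℓ (φ v)

theorem Intertwines.piOp {φ : V →ₗ[k] V'} (hφ : Intertwines E S X E' S' X' φ) (p : Fin n)
    (f : Word n i → V) :
    piOp i X' p (φ.compLeft _ f) = φ.compLeft _ (piOp i X p f) := by
  ext w
  rw [LinearMap.compLeft_apply, Function.comp_apply]
  by_cases hw : w p = .inl i
  · rw [piOp_apply_inl _ hw, piOp_apply_inl _ hw, map_sum]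
    exact Finset.sum_congr rfl fun r _ => (hφ.arrow _ _ _).symm
  · rw [piOp_apply_ne _ hw, piOp_apply_ne _ hw, map_zero]

theorem Intertwines.muOp {φ : V →ₗ[k] V'} (hφ : Intertwines E S X E' S' X' φ) (p : Fin n)
    (f : Word n i → V) :
    muOp i X' p (φ.compLeft _ f) = φ.compLeft _ (muOp i X p f) := by
  ext w
  rw [LinearMap.compLeft_apply, Function.comp_apply]
  rcases hw : w p with v | r
  · rw [muOp_apply_inl _ hw, muOp_apply_inl _ hw, map_zero]
  · rw [muOp_apply_inr _ hw, muOp_apply_inr _ hw, map_zsmul, hφ.arrow]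
    rfl

theorem Intertwines.permOp {φ : V →ₗ[k] V'} (hφ : Intertwines E S X E' S' X' φ)
    (σ : Equiv.Perm (Fin n)) (f : Word n i → V) :
    permOp i S' σ (φ.compLeft _ f) = φ.compLeft _ (permOp i S σ f) :=
  funext fun _ => (hφ.perm _ _).symm

/-- The coefficients of `c` lie in `k`, over which `φ` is linear, so compatibility with single
permutations suffices. -/
theorem Intertwines.groupAlgHom {φ : V →ₗ[k] V'} (hφ : Intertwines E S X E' S' X' φ)
    (hR : Satisfies lam ν E S X) (hR' : Satisfies lam ν E' S' X') {r : ℕ}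
    (ι : Fin (r + 1) ↪ Fin n) (c : MonoidAlgebra k (Equiv.Perm (Fin (r + 1))))
    (f : Word n i → V) :
    groupAlgHom i hR' ι c (φ.compLeft _ f) = φ.compLeft _ (groupAlgHom i hR ι c f) := by
  induction c using MonoidAlgebra.induction_on with
  | of σ => rw [groupAlgHom_of, groupAlgHom_of, hφ.permOp]
  | add x y hx hy => simp only [map_add, LinearMap.add_apply, hx, hy]
  | smul b x hx => simp only [map_smul, LinearMap.smul_apply, hx]

/-- Numbers the positions in `A ∪ {p}` with `p` first. The distinguished point of the Jucys–Murphy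
element then corresponds to the position being added, and its transpositions to the positions in
`A`. -/
theorem exists_embedding (A : Finset (Fin n)) {p : Fin n} (hp : p ∉ A) :
    ∃ ι : Fin (A.card + 1) ↪ Fin n, ι 0 = p ∧ ∀ q, q ∈ A ↔ ∃ m, ι (Fin.succ m) = q := by
  refine ⟨⟨Fin.cons p fun m => (A.equivFin.symm m : Fin n), Fin.cons_injective_iff.2 ⟨?_, ?_⟩⟩,
    rfl, fun q => ⟨fun hq => ⟨A.equivFin ⟨q, hq⟩, ?_⟩, ?_⟩⟩
  · rintro ⟨m, rfl⟩
    exact hp (A.equivFin.symm m).2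
  · exact Subtype.val_injective.comp A.equivFin.symm.injective
  · simp
  · rintro ⟨m, rfl⟩
    exact (A.equivFin.symm m).2

theorem exists_left_inverse (hΛ : (lam, ν) ∈ Lambda n i) {r : ℕ} (hr : r < n) :
    ∃ c, c * jucysMurphy (lam i) ν r = 1 :=
  (hΛ r hr).2.exists_left_inv

/-- The two projections are produced together, so that each step of the induction on `A` can use the
same numbering and the same group algebra element for both modules. The statement quantifies over
`φ` after the projections: one pair has to serve all homomorphisms. -/
theorem exists_projectsToKer [IsEmpty (i ⟶ i)] (hR : Satisfies lam ν E S X)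
    (hR' : Satisfies lam ν E' S' X') (hΛ : (lam, ν) ∈ Lambda n i) (D A : Finset (Fin n))
    (hA : A ⊆ D) : ∃ (P : Module.End k (Word n i → V)) (P' : Module.End k (Word n i → V')),
      ProjectsToKer i E X D A P ∧ ProjectsToKer i E' X' D A P' ∧
      ∀ φ, Intertwines E S X E' S' X' φ →
        ∀ f, P' (φ.compLeft _ f) = φ.compLeft _ (P f) := by
  induction A using Finset.induction_on with
  -- No kernel condition is imposed yet, so the identity projects.
  | empty => exact ⟨1, 1, fun f hf => ⟨⟨hf, by simp⟩, fun _ => rfl⟩,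
      fun f hf => ⟨⟨hf, by simp⟩, fun _ => rfl⟩, fun _ _ _ => rfl⟩
  | insert p A hp ih =>
    obtain ⟨P, P', hP, hP', h⟩ := ih ((Finset.subset_insert _ _).trans hA)
    obtain ⟨ι, h0, hι⟩ := exists_embedding A hp
    -- The numbering embeds `A.card + 1` positions into `n`. This is the bound required in `Lambda`,
    -- where the index `r` refers to the group on `r + 1` letters.
    have hr : A.card < n := by
      simpa using Fintype.card_le_of_injective ι ι.injective
    obtain ⟨c, hc⟩ := exists_left_inverse hΛ hr
    -- Both sides use the same `ι` and `c`; every ingredient of the new operators is natural, hence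
    -- so are the operators.
    refine ⟨_, _, hP.insert hR hp hA ι h0 hι hc, hP'.insert hR' hp hA ι h0 hι hc,
      fun φ hφ f => ?_⟩
    simp only [LinearMap.sub_apply, Module.End.mul_apply, map_sub, h φ hφ, hφ.piOp, hφ.muOp,
      hφ.groupAlgHom hR hR']

/-- The projection to the families `f` with `f w ∈ V_{t(w)}` that are supported on the words with
`Δ = D` and with all letters at positions in `Δ` in `R`. -/
def deltaOp (i : I) (E : (Fin n → I) → Module.End k V) (D : Finset (Fin n)) :
    Module.End k (Word n i → V) where
  toFun f w := if ∀ m, (m ∈ D ↔ (w m).isRight) ∧ w m ≠ .inl i then E w.tail (f w) else 0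
  map_add' f g := by ext w; simp only [Pi.add_apply]; split_ifs <;> simp
  map_smul' c f := by ext w; simp only [Pi.smul_apply]; split_ifs <;> simp

theorem deltaOp_apply (D : Finset (Fin n)) (f : Word n i → V) (w : Word n i) :
    deltaOp i E D f w =
      if ∀ m, (m ∈ D ↔ (w m).isRight) ∧ w m ≠ .inl i then E w.tail (f w) else 0 := rfl

theorem deltaOp_mem (hR : Satisfies lam ν E S X) (D : Finset (Fin n)) (f : Word n i → V) :
    deltaOp i E D f ∈ wordSupport i E D ∅ := by
  constructor
  · intro w
    rw [deltaOp_apply]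
    split_ifs
    · exact rel_apply hR (.idem_self _) _
    · rw [map_zero]
  · intro w h m
    rw [deltaOp_apply] at h
    split_ifs at h with h'
    · simpa using h' m
    · exact absurd rfl h

theorem Intertwines.deltaOp {φ : V →ₗ[k] V'} (hφ : Intertwines E S X E' S' X' φ)
    (D : Finset (Fin n)) (f : Word n i → V) :
    deltaOp i E' D (φ.compLeft _ f) = φ.compLeft _ (deltaOp i E D f) := by
  ext w
  rw [LinearMap.compLeft_apply, Function.comp_apply, deltaOp_apply, deltaOp_apply]
  split_ifs
  · exact (hφ.idem _ _).symm
  · rw [map_zero]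

/-- The words that enter one value of `π_p` differ only in the letter of `R` at `p ∈ D`. Either all
or none of them are kept by the truncation to `D`, so each value is either that of `π_p f`, which is
zero, or an empty contribution. -/
theorem piOp_deltaOp {f : Word n i → V} (hf : f ∈ reflectionSubmodule i E X)
    (D : Finset (Fin n)) {p : Fin n} (hp : p ∈ D) : piOp i X p (deltaOp i E D f) = 0 := by
  ext w
  by_cases hw : w p = .inl i
  · rw [piOp_apply_inl _ hw, Pi.zero_apply]
    by_cases h : ∀ m, m ≠ p → (m ∈ D ↔ (w m).isRight) ∧ w m ≠ .inl i
    · refine (Finset.sum_congr rfl fun r _ => ?_).trans (memK hf w p)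
      rw [deltaOp_apply, if_pos, memE hf]
      intro m
      by_cases hm : m = p
      · subst hm; simp [hp]
      · simpa [hm] using h m hm
    · refine Finset.sum_eq_zero fun r _ => ?_
      rw [deltaOp_apply, if_neg, map_zero]
      refine fun h' => h fun m hm => ?_
      simpa [hm] using h' m
  · rw [piOp_apply_ne _ hw, Pi.zero_apply]

/-- Words containing the letter `i` are dropped by every truncation, but there `f` is zero by the
definition of `F_i(V)`. Every other word belongs to one `D` only. -/
theorem sum_deltaOp {f : Word n i → V} (hf : f ∈ reflectionSubmodule i E X) :
    ∑ D, deltaOp i E D f = f := by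
  ext w
  rw [Finset.sum_apply]
  by_cases h : ∃ p, w p = .inl i
  · obtain ⟨p, hp⟩ := h
    rw [memZ hf hp]
    refine Finset.sum_eq_zero fun D _ => ?_
    rw [deltaOp_apply, if_neg fun h => (h p).2 hp]
  · push Not at h
    -- The only truncation that keeps `w` is the one for the set of its positions with letters in
    -- `R`.
    rw [Finset.sum_eq_single (Finset.univ.filter fun m => (w m).isRight), deltaOp_apply,
      if_pos fun m => ⟨by simp, h m⟩, memE hf]
    · intro D _ hD
      rw [deltaOp_apply, if_neg]
      exact fun h' => hD (Finset.ext fun m => by simpa using (h' m).1)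
    · simp

/-- For `p ∉ D` the condition `π_p f = 0` is automatic, since `π_p` only reads words with a letter
of `R` at `p`. -/
theorem mem_reflectionSubmodule_of_mem_wordSupport {D : Finset (Fin n)} {f : Word n i → V}
    (hf : f ∈ wordSupport i E D ∅) (hK : ∀ q ∈ D, piOp i X q f = 0) :
    f ∈ reflectionSubmodule i E X := by
  refine ⟨hf.1, fun w p hp => wordSupport_eq_zero hf (m := p) (by simp [hp]), fun p => ?_⟩
  by_cases hp : p ∈ D
  · exact hK p hp
  · ext w
    by_cases hw : w p = .inl i
    · rw [piOp_apply_inl _ hw, Pi.zero_apply]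
      refine Finset.sum_eq_zero fun r _ => ?_
      rw [wordSupport_eq_zero hf (m := p) (by simp [hp]), map_zero]
    · rw [piOp_apply_ne _ hw, Pi.zero_apply]

/-- The operator `P` is a projection to `F_i(V)`. -/
def ProjectsToReflection (i : I) (E : (Fin n → I) → Module.End k V)
    (X : DArrow I → Fin n → Module.End k V) (P : Module.End k (Word n i → V)) : Prop :=
  (∀ f, P f ∈ reflectionSubmodule i E X) ∧ ∀ f ∈ reflectionSubmodule i E X, P f = f

/-- A family in `F_i(V)` is the sum of its truncations, and each truncation again satisfies the
kernel conditions, so it is fixed by the projection for its `D`. -/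
theorem projectsToReflection_sum (hR : Satisfies lam ν E S X)
    {P : Finset (Fin n) → Module.End k (Word n i → V)}
    (hP : ∀ D, ProjectsToKer i E X D D (P D)) :
    ProjectsToReflection i E X (∑ D, P D * deltaOp i E D) := by
  constructor
  · intro f
    rw [LinearMap.sum_apply]
    refine Submodule.sum_mem _ fun D _ => ?_
    have h := (hP D _ (deltaOp_mem hR D f)).1
    exact mem_reflectionSubmodule_of_mem_wordSupport h.1 h.2
  · intro f hf
    rw [LinearMap.sum_apply]
    refine (Finset.sum_congr rfl fun D _ => ?_).trans (sum_deltaOp hf)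
    exact (hP D _ (deltaOp_mem hR D f)).2 fun q hq => piOp_deltaOp hf D hq

/-- There are projections to `F_i(V)` and `F_i(V')` that commute with all linear maps induced by
homomorphisms from `V` to `V'`. -/
theorem exists_projectsToReflection [IsEmpty (i ⟶ i)] (hR : Satisfies lam ν E S X)
    (hR' : Satisfies lam ν E' S' X') (hΛ : (lam, ν) ∈ Lambda n i) :
    ∃ (P : Module.End k (Word n i → V)) (P' : Module.End k (Word n i → V')),
      ProjectsToReflection i E X P ∧ ProjectsToReflection i E' X' P' ∧
      ∀ φ, Intertwines E S X E' S' X' φ →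
        ∀ f, P' (φ.compLeft _ f) = φ.compLeft _ (P f) := by
  -- The induction is used at its last stage, `A = D`, where the kernel conditions at all positions
  -- of `D` are imposed.
  choose P P' hP hP' h using fun D : Finset (Fin n) =>
    exists_projectsToKer (E := E) (E' := E') hR hR' hΛ D D subset_rfl
  refine ⟨_, _, projectsToReflection_sum hR hP, projectsToReflection_sum hR' hP',
    fun φ hφ f => ?_⟩
  simp only [LinearMap.sum_apply, Module.End.mul_apply, map_sum, hφ.deltaOp, h _ φ hφ]

end naturality
end
end WreathReflection

namespace WreathReflection
noncomputable section
universe uI uQ uk uV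

/-! ### Comparison of the constructions over two rings. -/

section congr

variable {I : Type uI} [Quiver.{uQ} I] [Fintype I] [Fintype (Quiver.Total I)]
  {k : Type uk} [CommRing k] {n : ℕ} {i : I}
  {k' : Type*} [CommRing k'] {V : Type uV} [AddCommGroup V] [Module k V] [Module k' V]
  {E : (Fin n → I) → Module.End k V} {X : DArrow I → Fin n → Module.End k V}
  {E' : (Fin n → I) → Module.End k' V} {X' : DArrow I → Fin n → Module.End k' V}

/-- The space `F_i(V)` depends only on the underlying additive maps of the operators on `V`. -/
theorem mem_reflectionSubmodule_congr (hE : ∀ j v, E j v = E' j v)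
    (hX : ∀ a ℓ v, X a ℓ v = X' a ℓ v) (f : Word n i → V) :
    f ∈ reflectionSubmodule i E X ↔ f ∈ reflectionSubmodule i E' X' := by
  have h : ∀ p, piOp i X p f = piOp i X' p f := fun p => by
    ext w
    by_cases hw : w p = .inl i
    · rw [piOp_apply_inl _ hw, piOp_apply_inl _ hw]
      exact Finset.sum_congr rfl fun r _ => hX _ _ _
    · rw [piOp_apply_ne _ hw, piOp_apply_ne _ hw]
  change (_ ∧ _ ∧ _) ↔ (_ ∧ _ ∧ _)
  simp only [hE, h]

end congr

section scalars

variable {I : Type uI} [Quiver.{uQ} I] [Fintype I] [Fintype (Quiver.Total I)]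
  {k : Type uk} [CommRing k] {n : ℕ} {lam : I → k} {ν : k} {i : I}
  {V : Type uV} [AddCommGroup V] [Module k V]
  {S : Equiv.Perm (Fin n) → Module.End k V} {X : DArrow I → Fin n → Module.End k V}
  {k' : Type*} [CommRing k'] [Algebra k k']
  {V' : Type*} [AddCommGroup V'] [Module k' V'] {S' : Equiv.Perm (Fin n) → Module.End k' V'}
  {X' : DArrow I → Fin n → Module.End k' V'}

/-- The operators `a'_ℓ` are built from the actions of permutations and arrows, signs, and the
scalars `λ_i` and `ν`. A map that is semilinear along `k → k'` and respects these actions therefore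
commutes with them. The map is only additive by type because source and target are modules over
different rings. -/
theorem edgeOp_map [IsEmpty (i ⟶ i)] (φ : V →+ V')
    (hφ : ∀ (c : k) v, φ (c • v) = algebraMap k k' c • φ v) (hS : ∀ σ v, φ (S σ v) = S' σ (φ v))
    (hX : ∀ a ℓ v, φ (X a ℓ v) = X' a ℓ (φ v)) (a : DArrow I) (ℓ : Fin n) (f : Word n i → V)
    (w : Word n i) :
    edgeOp (fun v => algebraMap k k' (lam v)) (algebraMap k k' ν) i S' X' a ℓ (fun w => φ (f w)) w =
      φ (edgeOp lam ν i S X a ℓ f w) := by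
  rcases arrow_cases i a with ⟨r, rfl⟩ | ⟨r, rfl⟩ | ⟨h, h'⟩
  · rw [edge_head, edge_head]
    rcases hw : w ℓ with v | r'
    · rw [theta_isLeft _ _ hw, theta_isLeft _ _ hw, map_zero]
    · rw [theta_inr _ _ hw, theta_inr _ _ hw, map_add, map_add, hφ, map_zsmul, hφ,
        map_sum, hX, hX, map_neg, apply_ite φ, map_zero]
      congr 2
      refine Finset.sum_congr rfl fun m _ => ?_
      rw [hS, apply_ite φ, map_zero]
  · rw [edge_tail, edge_tail, LinearMap.smul_apply, LinearMap.smul_apply, Pi.smul_apply,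
      Pi.smul_apply, map_zsmul]
    congr 1
    change (if _ then _ else _) = φ (if _ then _ else _)
    rw [apply_ite φ, map_zero]
  · rw [edge_else h h', edge_else h h']
    change (if _ then _ else _) = φ (if _ then _ else _)
    rw [apply_ite φ, map_zero, hX]

end scalars

/-! ### Base change of families, and bijectivity of the natural map. -/

section baseChange

variable {I : Type uI} [Quiver.{uQ} I] [Fintype I] [Fintype (Quiver.Total I)]
  {k : Type uk} [CommRing k] {n : ℕ} {lam : I → k} {ν : k} {i : I}
  {V : Type uV} [AddCommGroup V] [Module k V]
  {E : (Fin n → I) → Module.End k V} {S : Equiv.Perm (Fin n) → Module.End k V}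
  {X : DArrow I → Fin n → Module.End k V}
  (k' : Type*) [CommRing k'] [Algebra k k']

variable {k'} in
-- Stated for additive maps, so that maps linear over `k` can be compared with maps linear over
-- `k'`.
theorem BaseChange.hom_ext {M : Type*} [AddCommGroup M] {f g : BaseChange n lam ν k' V →+ M}
    (h : ∀ c v, f (BaseChange.tmul n lam ν c v) = g (BaseChange.tmul n lam ν c v)) : f = g := by
  ext y
  induction y using TensorProduct.induction_on with
  | zero => exact (map_zero f).trans (map_zero g).symm
  | add a b ha hb => exact (map_add f a b).trans ((congrArg₂ _ ha hb).trans (map_add g a b).symm)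
  | tmul c v => exact h c v

/-- Regards `k' ⊗ V` as a module over the original ring `k`, with the original parameters. The
projections for `V` and for `k' ⊗ V` can then be taken from one construction, with the same
condition on `(λ, ν)` over `k`. -/
theorem satisfies_lTensor (hR : Satisfies lam ν E S X) :
    Satisfies lam ν (fun j => (E j).lTensor k') (fun σ => (S σ).lTensor k')
      (fun a ℓ => (X a ℓ).lTensor k') := by
  intro P Q h
  obtain ⟨p, q, h', rfl, rfl⟩ :=
    Rel.exists_preimage (k' := k) (lam := lam) (ν := ν) (e := E) (s := S) (x := X)
      (S' := Module.End k (k' ⊗[k] V)) (Module.End.lTensorAlgHom k V k') h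
  rw [hR p q h']

/-- These are the homomorphisms to which naturality is applied; as `c` varies, their images span `k'
⊗ V`. -/
theorem intertwines_mk (c : k') : Intertwines E S X (fun j => (E j).lTensor k')
    (fun σ => (S σ).lTensor k') (fun a ℓ => (X a ℓ).lTensor k') (TensorProduct.mk k k' V c) :=
  ⟨fun _ _ => rfl, fun _ _ => rfl, fun _ _ _ => rfl⟩

variable (i E X)

/-- The natural map from `F_i(V) ⊗ k'` to the families of elements of `V ⊗ k'`. -/
def tensorFamily : k' ⊗[k] reflectionSubmodule (k := k) i E X →ₗ[k'] (Word n i → k' ⊗[k] V) :=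
  (TensorProduct.piRight k k' k' fun _ => V).toLinearMap ∘ₗ
    (reflectionSubmodule (k := k) i E X).subtype.baseChange k'

variable {i E X}

theorem tensorFamily_tmul (c : k') (f : reflectionSubmodule (k := k) i E X) :
    tensorFamily i E X k' (c ⊗ₜ f) = (TensorProduct.mk k k' V c).compLeft _ f.1 := by
  ext w
  simp [tensorFamily]

/-- The projection is a `k`-linear retraction of the inclusion of `F_i(V)`, and a split injection
stays injective after tensoring. -/
theorem tensorFamily_injective {P : Module.End k (Word n i → V)}
    (hP : ProjectsToReflection i E X P) : Function.Injective (tensorFamily i E X k') := by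
  refine (TensorProduct.piRight k k' k' fun _ => V).injective.comp ?_
  refine Function.LeftInverse.injective (g := (P.codRestrict _ hP.1).baseChange k') fun y => ?_
  rw [← LinearMap.comp_apply, ← LinearMap.baseChange_comp]
  have : P.codRestrict _ hP.1 ∘ₗ (reflectionSubmodule (k := k) i E X).subtype = LinearMap.id :=
    LinearMap.ext fun f => Subtype.ext (hP.2 f.1 f.2)
  rw [this, LinearMap.baseChange_id, LinearMap.id_apply]

/-- There are finitely many words, so every family is a sum of families `c ⊗ v` concentrated at a
single word. On these, `P'` acts as `P` on the second factor, whose values lie in `F_i(V)`. -/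
theorem exists_tensorFamily_eq {P : Module.End k (Word n i → V)}
    {P' : Module.End k (Word n i → k' ⊗[k] V)} (hP : ProjectsToReflection i E X P)
    (h : ∀ (c : k') f, P' ((TensorProduct.mk k k' V c).compLeft _ f) =
      (TensorProduct.mk k k' V c).compLeft _ (P f)) (g : Word n i → k' ⊗[k] V) :
    ∃ y, tensorFamily i E X k' y = P' g := by
  -- The range is taken as an additive subgroup: `P'` is linear over `k` and the natural map over
  -- `k'`, and only sums are needed.
  change P' g ∈ (tensorFamily i E X k').toAddMonoidHom.range
  rw [← Finset.univ_sum_single g, map_sum]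
  refine sum_mem fun w _ => ?_
  induction g w using TensorProduct.induction_on with
  | zero => rw [Pi.single_zero, map_zero]; exact zero_mem _
  | add a b ha hb => rw [Pi.single_add, map_add]; exact add_mem ha hb
  | tmul c v =>
    refine ⟨c ⊗ₜ ⟨P (Pi.single w v), hP.1 _⟩, (tensorFamily_tmul k' c _).trans ?_⟩
    rw [← h]
    congr 1
    ext u
    by_cases hu : u = w
    · subst hu; simp
    · simp [hu]

/-- The conditions defining `F_i` are preserved by every intertwining map, in particular by `v ↦ c ⊗
v`, and pure tensors suffice. -/
theorem tensorFamily_mem (y : k' ⊗[k] reflectionSubmodule (k := k) i E X) :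
    tensorFamily i E X k' y ∈ reflectionSubmodule (k := k) i (fun j => (E j).lTensor k')
      (fun a ℓ => (X a ℓ).lTensor k') := by
  induction y using TensorProduct.induction_on with
  | zero => rw [map_zero]; exact zero_mem _
  | add a b ha hb => rw [map_add]; exact add_mem ha hb
  | tmul c f =>
    rw [tensorFamily_tmul]
    -- Permutations do not enter the definition of the space, so the trivial action fills their
    -- place.
    have hφ := intertwines_mk (E := E) (S := fun _ => 1) (X := X) k' c
    refine ⟨fun w => (hφ.idem _ _).symm.trans (congrArg _ (memE f.2 w)), fun w p hw =>
      (congrArg (TensorProduct.mk k k' V c) (memZ f.2 hw)).trans (map_zero _), fun p => ?_⟩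
    rw [hφ.piOp, f.2.2.2 p, map_zero]

end baseChange

/-! ### The natural map for modules over the algebra. -/

section module

variable {I : Type uI} [Quiver.{uQ} I] [Fintype I] [Fintype (Quiver.Total I)]
  {k : Type uk} [CommRing k] {n : ℕ} (lam : I → k) (ν : k) (i : I)
  (k' : Type*) [CommRing k'] [Algebra k k']
  (V : Type uV) [AddCommGroup V] [Module k V] [Module (WreathAlg n lam ν) V]
  [IsScalarTower k (WreathAlg n lam ν) V]

/-- Identifies the two descriptions of the target: over `k`, with the operators `1 ⊗ a` used for the
projections, and over `k'`, with the action of the algebra formed over `k'`. The generators act by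
the same additive maps, as pure tensors show. -/
theorem mem_reflection_baseChange (f : Word n i → k' ⊗[k] V) :
    f ∈ reflectionSubmodule (k := k) i
        (fun j : Fin n → I => (act n lam ν V (WreathAlg.e lam ν j)).lTensor k')
        (fun a ℓ => (act n lam ν V (WreathAlg.x lam ν a ℓ)).lTensor k') ↔
      f ∈ reflectionSubmodule (k := k') (V := BaseChange n lam ν k' V) i
        (fun j : Fin n → I => act n _ _ (BaseChange n lam ν k' V)
          (WreathAlg.e (fun v => algebraMap k k' (lam v)) (algebraMap k k' ν) j))
        (fun a ℓ => act n _ _ (BaseChange n lam ν k' V)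
          (WreathAlg.x (fun v => algebraMap k k' (lam v)) (algebraMap k k' ν) a ℓ)) := by
  refine mem_reflectionSubmodule_congr (k' := k') (V := k' ⊗[k] V)
    (fun j v => ?_) (fun a ℓ v => ?_) f
  · exact DFunLike.congr_fun (BaseChange.hom_ext (n := n) (lam := lam) (ν := ν)
      (f := ((act n lam ν V (WreathAlg.e lam ν j)).lTensor k').toAddMonoidHom)
      (g := (act n (fun v => algebraMap k k' (lam v)) (algebraMap k k' ν)
        (BaseChange n lam ν k' V) (WreathAlg.e _ _ j)).toAddMonoidHom)
      fun c v => (BaseChange.e_smul n lam ν j c v).symm) v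
  · exact DFunLike.congr_fun (BaseChange.hom_ext (n := n) (lam := lam) (ν := ν)
      (f := ((act n lam ν V (WreathAlg.x lam ν a ℓ)).lTensor k').toAddMonoidHom)
      (g := (act n (fun v => algebraMap k k' (lam v)) (algebraMap k k' ν)
        (BaseChange n lam ν k' V) (WreathAlg.x _ _ a ℓ)).toAddMonoidHom)
      fun c v => (BaseChange.x_smul n lam ν a ℓ c v).symm) v

/-- The natural map `F_i(V) ⊗ k' → F_i(V ⊗ k')`. -/
def reflectionBaseChange : BaseChange n (reflect i lam) ν k' (Reflection n lam ν i V) →ₗ[k']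
    Reflection n (fun j => algebraMap k k' (lam j)) (algebraMap k k' ν) i
      (BaseChange n lam ν k' V) :=
  LinearMap.codRestrict (reflectionSubmodule (k := k') (V := BaseChange n lam ν k' V) i _ _)
    (tensorFamily i (fun j : Fin n → I => act n lam ν V (WreathAlg.e lam ν j))
      (fun a ℓ => act n lam ν V (WreathAlg.x lam ν a ℓ)) k')
    fun y => (mem_reflection_baseChange lam ν i k' V _).1 (tensorFamily_mem k' y)

theorem reflectionBaseChange_tmul (c : k') (f : Reflection n lam ν i V) :
    (reflectionBaseChange lam ν i k' V (BaseChange.tmul n (reflect i lam) ν c f)).val =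
      fun w => BaseChange.tmul n lam ν c (f.val w) :=
  tensorFamily_tmul (E := fun j : Fin n → I => act n lam ν V (WreathAlg.e lam ν j))
      (X := fun a ℓ => act n lam ν V (WreathAlg.x lam ν a ℓ)) k' c f

/-- Injectivity comes from the projection on the side of `V`. Surjectivity comes from the projection
on the side of `k' ⊗ V`, which reproduces any `g` in the target and has its values in the image. -/
theorem reflectionBaseChange_bijective [IsEmpty (i ⟶ i)] (hΛ : (lam, ν) ∈ Lambda n i) :
    Function.Bijective (reflectionBaseChange (n := n) lam ν i k' V) := by
  have hR := satisfies_act n lam ν V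
  obtain ⟨P, P', hP, hP', h⟩ :=
    exists_projectsToReflection hR (satisfies_lTensor k' hR) hΛ
  constructor
  · intro y y' hy
    exact tensorFamily_injective k' hP (congrArg Subtype.val hy)
  · intro g
    obtain ⟨y, hy⟩ := exists_tensorFamily_eq k' hP (fun c => h _ (intertwines_mk k' c)) g.val
    refine ⟨y, Subtype.ext (hy.trans ?_)⟩
    exact hP'.2 _ ((mem_reflection_baseChange lam ν i k' V _).2 g.2)

/-! ### Linearity of the natural map over the algebra formed over `k'`. -/

variable {lam ν i k' V}

theorem WreathAlg.induction_on {motive : WreathAlg n lam ν → Prop}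
    (scalar : ∀ c : k, motive (algebraMap k _ c)) (e : ∀ j, motive (e lam ν j))
    (s : ∀ σ, motive (s lam ν σ)) (x : ∀ a ℓ, motive (x lam ν a ℓ))
    (add : ∀ a b, motive a → motive b → motive (a + b))
    (mul : ∀ a b, motive a → motive b → motive (a * b)) (a : WreathAlg n lam ν) : motive a := by
  obtain ⟨a, rfl⟩ : ∃ b, mk n lam ν b = a := RingQuot.mkAlgHom_surjective k _ a
  induction a using FreeAlgebra.induction with
  | grade0 c => rw [AlgHom.commutes]; exact scalar c
  | grade1 g =>
    cases g with
    | idem j => exact e j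
    | perm σ => exact s σ
    | arrow a ℓ => exact x a ℓ
  | mul a b ha hb => rw [map_mul]; exact mul _ _ ha hb
  | add a b ha hb => rw [map_add]; exact add _ _ ha hb

/-- Both sides are additive in `y`. The elements `x` and `x'` are kept independent because they lie
in algebras whose parameters, the image of `r_i λ` and the reflection of the image of `λ`, are equal
but not by definition. -/
theorem reflectionBaseChange_smul_of_tmul [IsEmpty (i ⟶ i)]
    (x : WreathAlg n (fun j => algebraMap k k' (reflect i lam j)) (algebraMap k k' ν))
    (x' : WreathAlg n (reflect i fun j => algebraMap k k' (lam j)) (algebraMap k k' ν))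
    (h : ∀ (c : k') (f : Reflection n lam ν i V),
      reflectionBaseChange lam ν i k' V (x • BaseChange.tmul n (reflect i lam) ν c f) =
        x' • reflectionBaseChange lam ν i k' V (BaseChange.tmul n (reflect i lam) ν c f))
    (y : BaseChange n (reflect i lam) ν k' (Reflection n lam ν i V)) :
    reflectionBaseChange lam ν i k' V (x • y) = x' • reflectionBaseChange lam ν i k' V y :=
  DFunLike.congr_fun (BaseChange.hom_ext
    (f := (reflectionBaseChange lam ν i k' V).toAddMonoidHom.comp (DistribSMul.toAddMonoidHom _ x))
    (g := (DistribSMul.toAddMonoidHom _ x').comp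
      (reflectionBaseChange lam ν i k' V).toAddMonoidHom) h) y

/-- The elements for which this holds for all `y` are closed under sums and products, so scalars and
generators suffice. For generators it is enough to compare both sides on pure tensors, word by word.
-/
theorem reflectionBaseChange_smul [IsEmpty (i ⟶ i)]
    (x : WreathAlg n (fun j => algebraMap k k' (reflect i lam j)) (algebraMap k k' ν))
    (y : BaseChange n (reflect i lam) ν k' (Reflection n lam ν i V)) :
    reflectionBaseChange lam ν i k' V (x • y) =
      WreathAlg.congr (algebraMap_reflect lam i k') x • reflectionBaseChange lam ν i k' V y := by
  -- The case of a product needs the hypothesis for the first factor at the vector moved by the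
  -- second, hence the generalization over `y`.
  induction x using WreathAlg.induction_on generalizing y with
  | scalar c => rw [AlgEquiv.commutes, algebraMap_smul, algebraMap_smul, map_smul]
  | add a b ha hb => rw [add_smul, map_add, map_add, add_smul, ha, hb]
  | mul a b ha hb => rw [mul_smul, map_mul, mul_smul, ha, hb]
  | e j =>
    refine reflectionBaseChange_smul_of_tmul _ _ (fun c f => Subtype.ext ?_) y
    rw [WreathAlg.congr_e, BaseChange.e_smul]
    refine (reflectionBaseChange_tmul lam ν i k' V c _).trans ?_
    refine Eq.trans ?_ (Reflection.e_smul_val j _).symm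
    rw [reflectionBaseChange_tmul, Reflection.e_smul_val]
    ext w
    rw [idem_apply, idem_apply]
    split_ifs
    · rfl
    · exact TensorProduct.tmul_zero _ _
  | s σ =>
    refine reflectionBaseChange_smul_of_tmul _ _ (fun c f => Subtype.ext ?_) y
    rw [WreathAlg.congr_s, BaseChange.s_smul]
    refine (reflectionBaseChange_tmul lam ν i k' V c _).trans ?_
    refine Eq.trans ?_ (Reflection.s_smul_val σ _).symm
    rw [reflectionBaseChange_tmul, Reflection.s_smul_val]
    ext w
    exact (BaseChange.s_smul n lam ν σ c _).symm
  | x a ℓ =>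
    refine reflectionBaseChange_smul_of_tmul _ _ (fun c f => Subtype.ext ?_) y
    rw [WreathAlg.congr_x, BaseChange.x_smul]
    refine (reflectionBaseChange_tmul lam ν i k' V c _).trans ?_
    refine Eq.trans ?_ (Reflection.x_smul_val a ℓ _).symm
    rw [reflectionBaseChange_tmul, Reflection.x_smul_val]
    ext w
    -- Semilinearity of `v ↦ c ⊗ v` lets the scalars `λ_i` and `ν` inside the operator pass to their
    -- images in `k'`.
    exact (edgeOp_map (V' := k' ⊗[k] V) (TensorProduct.mk k k' V c).toAddMonoidHom
      (fun b v => (TensorProduct.tmul_smul b c v).trans (algebraMap_smul k' b (c ⊗ₜ[k] v)).symm)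
      (fun σ v => (BaseChange.s_smul n lam ν σ c v).symm)
      (fun a ℓ v => (BaseChange.x_smul n lam ν a ℓ c v).symm) a ℓ f.val w).symm

end module
end
end WreathReflection
theorem corollary5p3 {I : Type*} [Quiver I] [Fintype I] [Fintype (Quiver.Total I)]
    {k : Type*} [CommRing k] {n : ℕ} (hn : 0 < n) (i : I) [IsEmpty (i ⟶ i)]
    (lam : I → k) (ν : k) (hLambda : (lam, ν) ∈ WreathReflection.Lambda n i)
    (k' : Type*) [CommRing k'] [Algebra k k']
    (V : Type*) [AddCommGroup V] [Module k V] [Module (WreathReflection.WreathAlg n lam ν) V]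
    [IsScalarTower k (WreathReflection.WreathAlg n lam ν) V] :
    ∃ φ : WreathReflection.BaseChange n (WreathReflection.reflect i lam) ν k'
          (WreathReflection.Reflection n lam ν i V) ≃ₗ[k']
        WreathReflection.Reflection n (fun j => algebraMap k k' (lam j)) (algebraMap k k' ν) i
          (WreathReflection.BaseChange n lam ν k' V),
      (∀ (c : k') (f : WreathReflection.Reflection n lam ν i V) (w : WreathReflection.Word n i),
        (φ (WreathReflection.BaseChange.tmul n (WreathReflection.reflect i lam) ν c f)).val w =
          WreathReflection.BaseChange.tmul n lam ν c (f.val w)) ∧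
      ∀ (x : WreathReflection.WreathAlg n
            (fun j => algebraMap k k' (WreathReflection.reflect i lam j)) (algebraMap k k' ν))
        (y : WreathReflection.BaseChange n (WreathReflection.reflect i lam) ν k'
          (WreathReflection.Reflection n lam ν i V)),
        φ (x • y) =
          WreathReflection.WreathAlg.congr (WreathReflection.algebraMap_reflect lam i k') x • φ y := by
  exact ⟨LinearEquiv.ofBijective (WreathReflection.reflectionBaseChange lam ν i k' V)
      (WreathReflection.reflectionBaseChange_bijective lam ν i k' V hLambda),
    fun c f w => congrFun (WreathReflection.reflectionBaseChange_tmul lam ν i k' V c f) w,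
    WreathReflection.reflectionBaseChange_smul⟩
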